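/- Let $b\in\mathbb C$, let $m(z)=\mu_0+\mu_1 z$ be a nonzero polynomial of degree at most $1$ and let $A(z)=\sum_\ell\alpha_\ell z^\ell$, $B(z)=\sum_\ell\beta_\ell z^\ell$, $C(z)=\sum_\ell\gamma_\ell z^\ell$ be polynomials with complex coefficients; put $\mu_\ell=0$ for $\ell\ge 2$ and write $m(x)=m(e^{bx})$, and likewise for $A,B,C$. Let $S\subseteq\mathbb R$ be open and let $\Phi={}^t(\varphi,\psi):S\to\mathbb C^2$ be of class $C^2$ and satisfy, at every $x\in S$ with $m(x)\ne0$, $$\Bigl(\frac{d}{dx}-\frac b2\Bigr)\Phi(x)=\Omega(x)\Phi(x),\qquad \Omega(x)=\frac1{m(x)}\begin{pmatrix}A(x)&B(x)\\-C(x)&-A(x)\end{pmatrix}.$$ Let $$K(x,y)=\frac{{}^t\Phi(x)J\Phi(y)}{e^{bx}-e^{by}}=\frac{\varphi(x)\psi(y)-\psi(x)\varphi(y)}{e^{bx}-e^{by}},\qquad J=\begin{pmatrix}0&1\\-1&0\end{pmatrix},$$ extended to the diagonal by its limit. Call $(a_1,a_2)$ admissible if $a_1<a_2$, $I=[a_1,a_2]\subseteq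 S$, $x\mapsto e^{bx}$ is injective on $I$, and $\det(\mathbb I-\mathbb K_I)\neq 0$, where $\mathbb K_I$ is the integral operator on $L^2(I)$ with kernel $K$ and the determinant is Fredholm's. (1) The set of admissible $(a_1,a_2)$ is open. For every admissible $(a_1,a_2)$ the kernel $K$ is continuous on $I\times I$, $\mathbb I-\mathbb K_I$ is invertible on $L^2(I)$, $\log\det(\mathbb I-\mathbb K_I)$ has a continuous branch near $(a_1,a_2)$, and the following holds. With $\varphi_\ell(x)=e^{\ell bx}\varphi(x)$, $\psi_\ell(x)=e^{\ell bx}\psi(x)$, $\ell\ge0$, define (values at the endpoints being those of the continuous representative, $h=(\mathbb I-\mathbb K_I)^{-1}g$ being read as $h=g+\mathbb K_Ih$) $$R_{jk}=\bigl((\mathbb I-\mathbb K_I)^{-1}K(\cdot,a_k)\bigr)(a_j),\quad q_{\ell j}=\bigl((\mathbb I-\mathbb K_I)^{-1}\varphi_\ell\bigr)(a_j),\quad p_{\ell j}=\bigl((\mathbb I-\mathbb K_I)^{-1}\psi_\ell\bigr)(a_j),$$ $$u_\ell=\int_I\varphi\,(\mathbb I-\mathbb K_I)^{-1}\varphi_\ell,\quad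 w_\ell=\int_I\psi\,(\mathbb I-\mathbb K_I)^{-1}\psi_\ell,\quad v_\ell=\int_I\varphi\,(\mathbb I-\mathbb K_I)^{-1}\psi_\ell,\quad \tilde v_\ell=\int_I\psi\,(\mathbb I-\mathbb K_I)^{-1}\varphi_\ell,$$ $q_j=q_{0j}$, $p_j=p_{0j}$, $u=u_0$, $v=v_0$, $w=w_0$. All partial derivatives below exist, and for every branch of the logarithm that is continuous at $(a_1,a_2)$, all $\ell\ge 0$, $j,k\in\{1,2\}$, with $j\ne k$ wherever both indices occur in an equation: $$\frac{\partial}{\partial a_k}\log\det(\mathbb I-\mathbb K_I)=-(-1)^kR_{kk},$$ $$\frac{\partial q_j}{\partial a_k}=(-1)^kR_{jk}q_k,\qquad \frac{\partial p_j}{\partial a_k}=(-1)^kR_{jk}p_k,$$ $$\frac{\partial u_\ell}{\partial a_k}=(-1)^kq_{\ell k}q_k,\quad \frac{\partial w_\ell}{\partial a_k}=(-1)^kp_{\ell k}p_k,\quad \frac{\partial v_\ell}{\partial a_k}=(-1)^kp_{\ell k}q_k,\quad \frac{\partial\tilde v_\ell}{\partial a_k}=(-1)^kq_{\ell k}p_k,$$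 $$R_{jk}=\frac{q_jp_k-p_jq_k}{e^{ba_j}-e^{ba_k}},\qquad R_{jj}=\frac1{b\,e^{ba_j}}\Bigl(p_j\frac{\partial q_j}{\partial a_j}-q_j\frac{\partial p_j}{\partial a_j}\Bigr),$$ $$e^{\ell ba_j}q_j-q_{\ell j}=\sum_{\substack{n+n'=\ell-1\\ n,n'\ge0}}(v_nq_{n'j}-u_np_{n'j}),\qquad e^{\ell ba_j}p_j-p_{\ell j}=\sum_{\substack{n+n'=\ell-1\\ n,n'\ge0}}(w_nq_{n'j}-\tilde v_np_{n'j}),$$ $$\begin{aligned}m(a_j)\frac{\partial q_j}{\partial a_j}={}&\sum_{\ell\ge0}\Bigl(\alpha_\ell+\tfrac b2\mu_\ell+\sum_{\ell'\ge0}(\alpha_{\ell+\ell'+1}v_{\ell'}+\gamma_{\ell+\ell'+1}u_{\ell'})-\tfrac b2\mu_1v\,\delta_{\ell,0}\Bigr)q_{\ell j}\\&+\sum_{\ell\ge0}\Bigl(\beta_\ell+\sum_{\ell'\ge0}(\alpha_{\ell+\ell'+1}u_{\ell'}+\beta_{\ell+\ell'+1}v_{\ell'})+\tfrac b2\mu_1u\,\delta_{\ell,0}\Bigr)p_{\ell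 j}-(-1)^km(a_k)R_{jk}q_k,\end{aligned}$$ $$\begin{aligned}m(a_j)\frac{\partial p_j}{\partial a_j}={}&\sum_{\ell\ge0}\Bigl(-\gamma_\ell+\sum_{\ell'\ge0}(\alpha_{\ell+\ell'+1}w_{\ell'}+\gamma_{\ell+\ell'+1}\tilde v_{\ell'})-\tfrac b2\mu_1w\,\delta_{\ell,0}\Bigr)q_{\ell j}\\&+\sum_{\ell\ge0}\Bigl(-\alpha_\ell+\tfrac b2\mu_\ell+\sum_{\ell'\ge0}(\alpha_{\ell+\ell'+1}\tilde v_{\ell'}+\beta_{\ell+\ell'+1}w_{\ell'})+\tfrac b2\mu_1v\,\delta_{\ell,0}\Bigr)p_{\ell j}-(-1)^km(a_k)R_{jk}p_k.\end{aligned}$$ (2) This system is closed and determines $\log\det(\mathbb I-\mathbb K_I)$: let $d=\max(1,\deg A,\deg B,\deg C)$, let $D\subseteq\mathbb R^2$ be open and connected with $e^{ba_1}\ne e^{ba_2}$ and $m(a_1)m(a_2)\neq0$ on $D$, and consider two families of functions on $D$ (in the roles of $\log\det(\mathbb I-\mathbb K_I)$, $R_{jk}$, $q_{\ell j}$, $p_{\ell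 j}$, $u_\ell$, $w_\ell$, $v_\ell$, $\tilde v_\ell$) that satisfy all equations of the system at all points of $D$. If the values of $\log\det(\mathbb I-\mathbb K_I)$, $q_j$, $p_j$ ($j=1,2$) and $u_\ell,w_\ell,v_\ell,\tilde v_\ell$ ($0\le\ell<d$) in the two families agree at one point of $D$, they agree everywhere on $D$. -/

import Mathlib

open MeasureTheory Set Filter Topology Polynomial

noncomputable section

namespace ExpTW

/-! ### The integral operator with a continuous kernel on `L²([a₁, a₂])` and its resolvent -/

/-- Lebesgue measure on the interval `[a₁, a₂]`. -/
abbrev vol (a₁ a₂ : ℝ) : Measure ℝ := volume.restrict (Icc a₁ a₂)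

/-- The Hilbert space `L²([a₁, a₂]; ℂ)`. -/
abbrev L2 (a₁ a₂ : ℝ) : Type := Lp ℂ 2 (vol a₁ a₂)

/-- `K` is continuous on the square `[a₁, a₂] × [a₁, a₂]`. -/
def ContKernel (K : ℝ → ℝ → ℂ) (a₁ a₂ : ℝ) : Prop :=
  ContinuousOn (Function.uncurry K) (Icc a₁ a₂ ×ˢ Icc a₁ a₂)

theorem ContKernel.exists_bound {K : ℝ → ℝ → ℂ} {a₁ a₂ : ℝ} (hK : ContKernel K a₁ a₂) :
    ∃ M : ℝ, 0 ≤ M ∧ ∀ x ∈ Icc a₁ a₂, ∀ y ∈ Icc a₁ a₂, ‖K x y‖ ≤ M := by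
  obtain ⟨M, hM⟩ := (isCompact_Icc.prod isCompact_Icc).exists_bound_of_continuousOn hK
  exact ⟨max M 0, le_max_right _ _, fun x hx y hy =>
    (hM (x, y) ⟨hx, hy⟩).trans (le_max_left _ _)⟩

theorem integrable_coe {a₁ a₂ : ℝ} (f : L2 a₁ a₂) : Integrable f (vol a₁ a₂) :=
  (Lp.memLp f).integrable (by norm_num)

theorem ContKernel.norm_integral_le {K : ℝ → ℝ → ℂ} {a₁ a₂ : ℝ} {M : ℝ}
    (hM : ∀ x ∈ Icc a₁ a₂, ∀ y ∈ Icc a₁ a₂, ‖K x y‖ ≤ M) (f : L2 a₁ a₂)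
    {x : ℝ} (hx : x ∈ Icc a₁ a₂) :
    ‖∫ y in Icc a₁ a₂, K x y * f y‖ ≤ M * ∫ y in Icc a₁ a₂, ‖f y‖ := by
  rw [← integral_const_mul]
  refine norm_integral_le_of_norm_le ((integrable_coe f).norm.const_mul M) ?_
  filter_upwards [ae_restrict_mem measurableSet_Icc] with y hy
  rw [norm_mul]
  exact mul_le_mul_of_nonneg_right (hM x hx y hy) (norm_nonneg _)

theorem ContKernel.integrable {K : ℝ → ℝ → ℂ} {a₁ a₂ : ℝ} (hK : ContKernel K a₁ a₂)
    (f : L2 a₁ a₂) {x : ℝ} (hx : x ∈ Icc a₁ a₂) :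
    Integrable (fun y => K x y * f y) (vol a₁ a₂) := by
  obtain ⟨M, -, hM⟩ := hK.exists_bound
  have hc : ContinuousOn (fun y => K x y) (Icc a₁ a₂) :=
    hK.comp (f := fun y => (x, y)) (by fun_prop) (fun y hy => ⟨hx, hy⟩)
  refine (integrable_coe f).bdd_mul (c := M) (hc.aestronglyMeasurable measurableSet_Icc) ?_
  filter_upwards [ae_restrict_mem measurableSet_Icc] with y hy
  exact hM x hx y hy

theorem ContKernel.aestronglyMeasurable {K : ℝ → ℝ → ℂ} {a₁ a₂ : ℝ} (hK : ContKernel K a₁ a₂)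
    (f : L2 a₁ a₂) :
    AEStronglyMeasurable (fun x => ∫ y in Icc a₁ a₂, K x y * f y) (vol a₁ a₂) := by
  have h1 : AEStronglyMeasurable (fun z : ℝ × ℝ => K z.1 z.2)
      ((vol a₁ a₂).prod (vol a₁ a₂)) := by
    rw [Measure.prod_restrict]
    exact ContinuousOn.aestronglyMeasurable hK (measurableSet_Icc.prod measurableSet_Icc)
  have h2 : AEStronglyMeasurable (fun z : ℝ × ℝ => f z.2) ((vol a₁ a₂).prod (vol a₁ a₂)) :=
    (Lp.aestronglyMeasurable f).comp_snd
  exact (h1.mul h2).integral_prod_right'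

theorem integral_norm_le {a₁ a₂ : ℝ} (f : L2 a₁ a₂) :
    ∫ y in Icc a₁ a₂, ‖f y‖ ≤ ‖f‖ * ((vol a₁ a₂) univ ^ (1 / 2 : ℝ)).toReal := by
  have h := eLpNorm_le_eLpNorm_mul_rpow_measure_univ (μ := vol a₁ a₂) (p := 1) (q := 2)
    (by norm_num) (Lp.aestronglyMeasurable f)
  have e : (1 / ENNReal.toReal 1 - 1 / ENNReal.toReal 2 : ℝ) = 1 / 2 := by norm_num
  rw [e, eLpNorm_one_eq_lintegral_enorm] at h
  rw [integral_norm_eq_lintegral_enorm (Lp.aestronglyMeasurable f), Lp.norm_def,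
    ← ENNReal.toReal_mul]
  refine ENNReal.toReal_mono (ENNReal.mul_ne_top (Lp.eLpNorm_ne_top f) ?_) h
  exact (ENNReal.rpow_lt_top_of_nonneg (by norm_num) (measure_ne_top _ _)).ne

theorem ContKernel.memLp {K : ℝ → ℝ → ℂ} {a₁ a₂ : ℝ} (hK : ContKernel K a₁ a₂) (f : L2 a₁ a₂) :
    MemLp (fun x => ∫ y in Icc a₁ a₂, K x y * f y) 2 (vol a₁ a₂) := by
  obtain ⟨M, -, hM⟩ := hK.exists_bound
  refine MemLp.of_bound (hK.aestronglyMeasurable f) (M * ∫ y in Icc a₁ a₂, ‖f y‖) ?_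
  filter_upwards [ae_restrict_mem measurableSet_Icc] with x hx
  exact ContKernel.norm_integral_le hM f hx

/-- The linear map `f ↦ ∫_{[a₁,a₂]} K(·, y) f(y) dy` on `L²([a₁, a₂])`, for a continuous kernel. -/
def intLinear {K : ℝ → ℝ → ℂ} {a₁ a₂ : ℝ} (hK : ContKernel K a₁ a₂) : L2 a₁ a₂ →ₗ[ℂ] L2 a₁ a₂ where
  toFun f := (hK.memLp f).toLp _
  map_add' f g := by
    rw [← MemLp.toLp_add, MemLp.toLp_eq_toLp_iff]
    filter_upwards [ae_restrict_mem measurableSet_Icc] with x hx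
    rw [Pi.add_apply, ← integral_add (hK.integrable f hx) (hK.integrable g hx)]
    refine integral_congr_ae ?_
    filter_upwards [Lp.coeFn_add f g] with y hy
    rw [hy, Pi.add_apply, mul_add]
  map_smul' c f := by
    rw [RingHom.id_apply, ← MemLp.toLp_const_smul, MemLp.toLp_eq_toLp_iff]
    filter_upwards with x
    rw [Pi.smul_apply, smul_eq_mul, ← integral_const_mul]
    refine integral_congr_ae ?_
    filter_upwards [Lp.coeFn_smul c f] with y hy
    rw [hy, Pi.smul_apply, smul_eq_mul]
    ring

theorem intLinear_bound {K : ℝ → ℝ → ℂ} {a₁ a₂ : ℝ} (hK : ContKernel K a₁ a₂) :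
    ∃ C : ℝ, ∀ f : L2 a₁ a₂, ‖intLinear hK f‖ ≤ C * ‖f‖ := by
  obtain ⟨M, hM0, hM⟩ := hK.exists_bound
  set c : ℝ := ((vol a₁ a₂) univ ^ (1 / 2 : ℝ)).toReal
  set d : ℝ := (measureUnivNNReal (vol a₁ a₂) : ℝ) ^ (ENNReal.toReal 2)⁻¹ with hd
  refine ⟨d * (M * c), fun f => ?_⟩
  have h0 : 0 ≤ M * ∫ y in Icc a₁ a₂, ‖f y‖ :=
    mul_nonneg hM0 (integral_nonneg fun _ => norm_nonneg _)
  have h := Lp.norm_le_of_ae_bound (f := intLinear hK f) h0 (by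
    filter_upwards [(hK.memLp f).coeFn_toLp, ae_restrict_mem measurableSet_Icc] with x hx hxI
    have hx' : (intLinear hK f) x = ∫ y in Icc a₁ a₂, K x y * f y := hx
    rw [hx']
    exact ContKernel.norm_integral_le hM f hxI)
  refine h.trans ?_
  have hd0 : 0 ≤ d := by positivity
  rw [mul_assoc d, mul_assoc M, mul_comm c]
  exact mul_le_mul_of_nonneg_left (mul_le_mul_of_nonneg_left (integral_norm_le f) hM0) hd0

open Classical in
/-- The integral operator `𝕂_I` with kernel `K` on `L²(I)`, `I = [a₁, a₂]`
(by convention `0` if `K` is not continuous on `I × I`). -/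
def intOp (K : ℝ → ℝ → ℂ) (a₁ a₂ : ℝ) : L2 a₁ a₂ →L[ℂ] L2 a₁ a₂ :=
  if hK : ContKernel K a₁ a₂ then (intLinear hK).mkContinuousOfExistsBound (intLinear_bound hK)
  else 0

open Classical in
/-- The class in `L²([a₁, a₂])` of a function on the line. -/
def toL2 (a₁ a₂ : ℝ) (g : ℝ → ℂ) : L2 a₁ a₂ :=
  if hg : MemLp g 2 (vol a₁ a₂) then hg.toLp g else 0

/-- The function `(𝕀 - 𝕂_I)⁻¹ g`. The element `h = (𝕀 - 𝕂_I)⁻¹ g` of `L²(I)` is evaluated pointwise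
through `h = g + 𝕂_I h`, that is, `x ↦ g(x) + ∫_I K(x, y) h(y) dy`. -/
def resolve (K : ℝ → ℝ → ℂ) (a₁ a₂ : ℝ) (g : ℝ → ℂ) (x : ℝ) : ℂ :=
  g x + ∫ y in Icc a₁ a₂, K x y * (Ring.inverse (1 - intOp K a₁ a₂) (toL2 a₁ a₂ g) : L2 a₁ a₂) y

/-- The Fredholm determinant
`det(𝕀 - 𝕂_I) = ∑ₙ (-1)ⁿ/n! ∫_{Iⁿ} det [K(xᵢ, xⱼ)] dx₁ ⋯ dxₙ`, `I = [a₁, a₂]`. -/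
def fredholmDet (K : ℝ → ℝ → ℂ) (a₁ a₂ : ℝ) : ℂ :=
  ∑' n : ℕ, (-1 : ℂ) ^ n / (n.factorial : ℂ) *
    ∫ x in univ.pi (fun _ : Fin n => Icc a₁ a₂), (Matrix.of fun i j => K (x i) (x j)).det

/-! ### The kernel -/

/-- The matrix `J`. -/
def J : Matrix (Fin 2) (Fin 2) ℂ := !![0, 1; -1, 0]

/-- `e^{bx}` for real `x`. -/
def ex (b : ℂ) (x : ℝ) : ℂ := Complex.exp (b * x)

open scoped Matrix in
/-- The kernel `K(x, y) = ᵗΦ(x) J Φ(y) / (e^{bx} - e^{by})`, extended to the diagonal by its limit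
`ᵗΦ'(x) J Φ(x) / (b e^{bx})`. -/
def kernel (b : ℂ) (Φ : ℝ → Fin 2 → ℂ) (x y : ℝ) : ℂ :=
  if x = y then (deriv Φ x ⬝ᵥ (J *ᵥ Φ x)) / (b * ex b x)
  else (Φ x ⬝ᵥ (J *ᵥ Φ y)) / (ex b x - ex b y)

/-- The connection matrix `Ω(x) = m⁻¹ [[A, B], [-C, -A]]`, where `m, A, B, C` are polynomials
evaluated at `e^{bx}`. -/
def Omega (b : ℂ) (m A B C : ℂ[X]) (x : ℝ) : Matrix (Fin 2) (Fin 2) ℂ :=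
  (m.eval (ex b x))⁻¹ •
    !![A.eval (ex b x), B.eval (ex b x); -C.eval (ex b x), -A.eval (ex b x)]

open scoped Matrix in
/-- `Φ` is of class `C²` on `S` and solves `(d/dx - b/2) Φ = Ω Φ` at every point of `S`
where `m` does not vanish. -/
structure SolvesODE (b : ℂ) (m A B C : ℂ[X]) (S : Set ℝ) (Φ : ℝ → Fin 2 → ℂ) : Prop where
  contDiffOn : ContDiffOn ℝ 2 Φ S
  eq : ∀ x ∈ S, m.eval (ex b x) ≠ 0 →
    deriv Φ x - (b / 2) • Φ x = Omega b m A B C x *ᵥ Φ x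

/-- The admissible pairs of endpoints `a = (a₁, a₂)` (indexed by `0, 1`): `a₁ < a₂`,
`[a₁, a₂] ⊆ S`, the denominator of the kernel vanishes only on the diagonal of `[a₁, a₂]²`,
and `det(𝕀 - 𝕂_I) ≠ 0`. -/
structure Admissible (b : ℂ) (Φ : ℝ → Fin 2 → ℂ) (S : Set ℝ) (a : Fin 2 → ℝ) : Prop where
  lt : a 0 < a 1
  subset : Icc (a 0) (a 1) ⊆ S
  injOn : InjOn (ex b) (Icc (a 0) (a 1))
  det_ne_zero : fredholmDet (kernel b Φ) (a 0) (a 1) ≠ 0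

/-- `L` is a branch of `log f` near `a`. -/
def IsLogBranchAt (L f : (Fin 2 → ℝ) → ℂ) (a : Fin 2 → ℝ) : Prop :=
  ContinuousAt L a ∧ ∀ᶠ a' in 𝓝 a, Complex.exp (L a') = f a'

/-! ### The system of partial differential equations -/

/-- The unknowns, as functions of the pair of endpoints: `L` stands for `log det(𝕀 - 𝕂_I)`, `R j k`
for `R_{jk}`, `q l j` for `q_{ℓj}`, `p l j` for `p_{ℓj}`, `u l, w l, v l, vt l` for
`u_ℓ, w_ℓ, v_ℓ, ṽ_ℓ`. The index `j : Fin 2` with values `0, 1` stands for `j = 1, 2`. -/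
structure Unknowns where
  L : (Fin 2 → ℝ) → ℂ
  R : Fin 2 → Fin 2 → (Fin 2 → ℝ) → ℂ
  q : ℕ → Fin 2 → (Fin 2 → ℝ) → ℂ
  p : ℕ → Fin 2 → (Fin 2 → ℝ) → ℂ
  u : ℕ → (Fin 2 → ℝ) → ℂ
  w : ℕ → (Fin 2 → ℝ) → ℂ
  v : ℕ → (Fin 2 → ℝ) → ℂ
  vt : ℕ → (Fin 2 → ℝ) → ℂ

/-- The function `x ↦ e^{ℓbx} Φᵢ(x)`: it is `φ_ℓ` for `i = 0` and `ψ_ℓ` for `i = 1`. -/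
def twist (b : ℂ) (Φ : ℝ → Fin 2 → ℂ) (i : Fin 2) (l : ℕ) (x : ℝ) : ℂ := ex b x ^ l * Φ x i

/-- `∫_I Φᵢ (𝕀 - 𝕂_I)⁻¹ (e^{ℓb·} Φᵢ')`. -/
def pairing (b : ℂ) (Φ : ℝ → Fin 2 → ℂ) (i i' : Fin 2) (l : ℕ) (a : Fin 2 → ℝ) : ℂ :=
  ∫ x in Icc (a 0) (a 1), Φ x i * resolve (kernel b Φ) (a 0) (a 1) (twist b Φ i' l) x

/-- The actual quantities attached to the kernel; `L` is a given branch of the logarithm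
of the determinant. -/
def actual (b : ℂ) (Φ : ℝ → Fin 2 → ℂ) (L : (Fin 2 → ℝ) → ℂ) : Unknowns where
  L := L
  R j k a := resolve (kernel b Φ) (a 0) (a 1) (fun x => kernel b Φ x (a k)) (a j)
  q l j a := resolve (kernel b Φ) (a 0) (a 1) (twist b Φ 0 l) (a j)
  p l j a := resolve (kernel b Φ) (a 0) (a 1) (twist b Φ 1 l) (a j)
  u := pairing b Φ 0 0
  w := pairing b Φ 1 1
  v := pairing b Φ 0 1
  vt := pairing b Φ 1 0

/-- `∂F/∂a_k = c` at the point `a` (and the partial derivative exists). -/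
def HasPartial (F : (Fin 2 → ℝ) → ℂ) (k : Fin 2) (c : ℂ) (a : Fin 2 → ℝ) : Prop :=
  HasDerivAt (fun t : ℝ => F (Function.update a k t)) c (a k)

/-- The partial derivative `∂F/∂a_k`. -/
def pd (F : (Fin 2 → ℝ) → ℂ) (k : Fin 2) (a : Fin 2 → ℝ) : ℂ :=
  deriv (fun t : ℝ => F (Function.update a k t)) (a k)

/-- The sign `(-1)^k` for `k = 1, 2`. -/
def sgn (k : Fin 2) : ℂ := (-1) ^ (k.val + 1)

/-- A common bound `max(1, deg A, deg B, deg C)` for the degrees of all polynomials involved;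
all sums over `ℓ, ℓ' ≥ 0` in the system have no nonzero terms beyond it. -/
def bdeg (A B C : ℂ[X]) : ℕ := max 1 (max A.natDegree (max B.natDegree C.natDegree))

/-- Kronecker's `δ_{ℓ,0}`. -/
def delta (l : ℕ) : ℂ := if l = 0 then 1 else 0

/-- The equations at the point `a`. The polynomials `m, A, B, C` have coefficients
`μ_ℓ, α_ℓ, β_ℓ, γ_ℓ`. -/
structure SystemAt (b : ℂ) (m A B C : ℂ[X]) (F : Unknowns) (a : Fin 2 → ℝ) : Prop where
  logdet : ∀ k, HasPartial F.L k (-(sgn k * F.R k k a)) a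
  dq : ∀ j k, j ≠ k → HasPartial (F.q 0 j) k (sgn k * F.R j k a * F.q 0 k a) a
  dp : ∀ j k, j ≠ k → HasPartial (F.p 0 j) k (sgn k * F.R j k a * F.p 0 k a) a
  du : ∀ l k, HasPartial (F.u l) k (sgn k * F.q l k a * F.q 0 k a) a
  dw : ∀ l k, HasPartial (F.w l) k (sgn k * F.p l k a * F.p 0 k a) a
  dv : ∀ l k, HasPartial (F.v l) k (sgn k * F.p l k a * F.q 0 k a) a
  dvt : ∀ l k, HasPartial (F.vt l) k (sgn k * F.q l k a * F.p 0 k a) a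
  Rjk : ∀ j k, j ≠ k → F.R j k a =
    (F.q 0 j a * F.p 0 k a - F.p 0 j a * F.q 0 k a) / (ex b (a j) - ex b (a k))
  Rjj : ∀ j, F.R j j a =
    1 / (b * ex b (a j)) * (F.p 0 j a * pd (F.q 0 j) j a - F.q 0 j a * pd (F.p 0 j) j a)
  qlj : ∀ l j, ex b (a j) ^ l * F.q 0 j a - F.q l j a =
    ∑ n ∈ Finset.range l, (F.v n a * F.q (l - 1 - n) j a - F.u n a * F.p (l - 1 - n) j a)
  plj : ∀ l j, ex b (a j) ^ l * F.p 0 j a - F.p l j a =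
    ∑ n ∈ Finset.range l, (F.w n a * F.q (l - 1 - n) j a - F.vt n a * F.p (l - 1 - n) j a)
  diff_q : ∀ j, DifferentiableAt ℝ (fun t : ℝ => F.q 0 j (Function.update a j t)) (a j)
  diff_p : ∀ j, DifferentiableAt ℝ (fun t : ℝ => F.p 0 j (Function.update a j t)) (a j)
  nu1 : ∀ j k, j ≠ k → m.eval (ex b (a j)) * pd (F.q 0 j) j a =
    (∑ l ∈ Finset.range (bdeg A B C + 1),
      (A.coeff l + b / 2 * m.coeff l
        + (∑ l' ∈ Finset.range (bdeg A B C + 1),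
            (A.coeff (l + l' + 1) * F.v l' a + C.coeff (l + l' + 1) * F.u l' a))
        - b / 2 * m.coeff 1 * F.v 0 a * delta l) * F.q l j a)
    + (∑ l ∈ Finset.range (bdeg A B C + 1),
      (B.coeff l
        + (∑ l' ∈ Finset.range (bdeg A B C + 1),
            (A.coeff (l + l' + 1) * F.u l' a + B.coeff (l + l' + 1) * F.v l' a))
        + b / 2 * m.coeff 1 * F.u 0 a * delta l) * F.p l j a)
    - sgn k * m.eval (ex b (a k)) * F.R j k a * F.q 0 k a
  nu2 : ∀ j k, j ≠ k → m.eval (ex b (a j)) * pd (F.p 0 j) j a =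
    (∑ l ∈ Finset.range (bdeg A B C + 1),
      (-C.coeff l
        + (∑ l' ∈ Finset.range (bdeg A B C + 1),
            (A.coeff (l + l' + 1) * F.w l' a + C.coeff (l + l' + 1) * F.vt l' a))
        - b / 2 * m.coeff 1 * F.w 0 a * delta l) * F.q l j a)
    + (∑ l ∈ Finset.range (bdeg A B C + 1),
      (-A.coeff l + b / 2 * m.coeff l
        + (∑ l' ∈ Finset.range (bdeg A B C + 1),
            (A.coeff (l + l' + 1) * F.vt l' a + B.coeff (l + l' + 1) * F.w l' a))
        + b / 2 * m.coeff 1 * F.v 0 a * delta l) * F.p l j a)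
    - sgn k * m.eval (ex b (a k)) * F.R j k a * F.p 0 k a

/-- `F` and `G` have the same values of `L, q_j, p_j` and of `u_ℓ, w_ℓ, v_ℓ, ṽ_ℓ`, `ℓ < d`,
at the point `a`. -/
structure AgreeAt (d : ℕ) (F G : Unknowns) (a : Fin 2 → ℝ) : Prop where
  L : F.L a = G.L a
  q : ∀ j, F.q 0 j a = G.q 0 j a
  p : ∀ j, F.p 0 j a = G.p 0 j a
  u : ∀ l < d, F.u l a = G.u l a
  w : ∀ l < d, F.w l a = G.w l a
  v : ∀ l < d, F.v l a = G.v l a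
  vt : ∀ l < d, F.vt l a = G.vt l a

end ExpTW

end

/-! Part (1) combines Fredholm theory with the Tracy–Widom method. Everything is local: near I × I
the kernel depends only on Φ near I. Injectivity of e^{bx} on I means that the divided difference of
e^{bx} has no zero on I × I, hence none nearby. Cutting Φ off there gives a compactly supported Φ
whose kernel is bounded and C¹ on the whole plane (`exists_localization`). The interval then enters
only through its indicator function, and the determinants for all endpoints are values of one
functional `wdet K` of an integrable weight.

Hadamard's inequality makes the series of the determinant and of the first minor converge. Expanding
the minor along its first row gives Fredholm's identities (`BddKernel.wminor_eq`), which say that R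
= minor/determinant is the resolvent kernel: 1 + R inverts 1 - K. Perturbing the weight by η changes
the determinant by minus the integral of η against the diagonal minor, up to O(‖η‖₁²). For
indicators this is the derivative in the endpoints, and division by the determinant produces R_kk.
The derivatives of q, p and of the pairings follow by comparing solutions of h = g + 𝕂h on two
intervals: they differ by R applied to the sliver between them (`BddKernel.resolve_update_sub`).

The remaining equations rest on uniqueness for h = g + 𝕂h (`BddKernel.resolve_eq_of_fixed`): a fixed
point equation is found for some explicit function, and its inhomogeneous term is read off. The
commutator of 𝕂 with multiplication by e^{bx} has the kernel ᵗΦ(x)JΦ(y), of rank at most two; this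
yields the formula for R_jk and the recursion in ℓ. The kernel m(x)∂ₓK + ∂_y(m(y)K) has finite rank
as well (`RegularKernel.derivation_kernel`), because A, B, C have divided differences that are
polynomials in two variables. Integration by parts then yields an equation for m times the
derivative of (1 - 𝕂)⁻¹Φ, with boundary terms at a₁ and a₂. At an endpoint a_j its own boundary term
cancels against the effect of moving the interval, and only the one at the other endpoint survives.

For part (2), the system expresses the derivatives of L, q_j, p_j and of the pairings with ℓ < d as
polynomials in the latter seven families (R being eliminated), with coefficients continuous where
e^{ba₁} ≠ e^{ba₂} and m(a₁)m(a₂) ≠ 0. Along a line parallel to an axis the difference e of two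
solutions therefore satisfies e' = O(e), and Grönwall's inequality gives local uniqueness.
Connectedness makes it global. -/

noncomputable section

namespace ExpTW

/-! ### Hadamard's inequality and the Fredholm series -/

-- |det A|² is the product of the eigenvalues of AA*, which are nonnegative with sum Σ|A_ij|² ≤ n ·
-- nM². The inequality of arithmetic and geometric means gives the bound.
open scoped ComplexOrder in
theorem norm_det_sq_le {n : ℕ} (A : Matrix (Fin n) (Fin n) ℂ) {M : ℝ} (hM : ∀ i j, ‖A i j‖ ≤ M) :
    ‖A.det‖ ^ 2 ≤ (n : ℝ) ^ n * (M ^ 2) ^ n := by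
  rcases Nat.eq_zero_or_pos n with rfl | hn
  · simp
  have hn' : (0 : ℝ) < n := by exact_mod_cast hn
  have hA := Matrix.isHermitian_mul_conjTranspose_self A
  have hpos : ∀ i, 0 ≤ hA.eigenvalues i :=
    (Matrix.posSemidef_self_mul_conjTranspose A).eigenvalues_nonneg
  have hdet : ‖A.det‖ ^ 2 = ∏ i, hA.eigenvalues i := by
    have h := hA.det_eq_prod_eigenvalues
    rw [Matrix.det_mul, Matrix.det_conjTranspose] at h
    have h2 : ((‖A.det‖ ^ 2 : ℝ) : ℂ) = ((∏ i, hA.eigenvalues i : ℝ) : ℂ) := by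
      push_cast
      rw [← Complex.mul_conj']
      exact h
    exact_mod_cast h2
  have htr : ∑ i, hA.eigenvalues i ≤ n * (n * M ^ 2) := by
    have h := hA.trace_eq_sum_eigenvalues
    have h2 : ((∑ i, hA.eigenvalues i : ℝ) : ℂ) = ((∑ i, ∑ j, ‖A i j‖ ^ 2 : ℝ) : ℂ) := by
      push_cast
      refine h.symm.trans ?_
      rw [Matrix.trace]
      refine Finset.sum_congr rfl fun i _ => ?_
      rw [Matrix.diag_apply, Matrix.mul_apply]
      refine Finset.sum_congr rfl fun j _ => ?_
      rw [Matrix.conjTranspose_apply, ← Complex.mul_conj']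
      rfl
    have h3 : ∑ i, hA.eigenvalues i = ∑ i, ∑ j, ‖A i j‖ ^ 2 := by exact_mod_cast h2
    rw [h3]
    calc ∑ i, ∑ j, ‖A i j‖ ^ 2 ≤ ∑ _i : Fin n, ∑ _j : Fin n, M ^ 2 := by
          gcongr with i _ j _
          exact hM i j
      _ = n * (n * M ^ 2) := by simp
  have hamgm := Real.geom_mean_le_arith_mean Finset.univ (fun _ : Fin n => (1 : ℝ))
    hA.eigenvalues (by simp) (by simpa using hn) (fun i _ => hpos i)
  simp only [Real.rpow_one, Finset.sum_const, Finset.card_univ, Fintype.card_fin, nsmul_eq_mul,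
    mul_one, one_mul] at hamgm
  have hle : (∏ i, hA.eigenvalues i) ^ ((n : ℝ)⁻¹) ≤ n * M ^ 2 := by
    refine hamgm.trans ?_
    rw [div_le_iff₀ hn']
    linarith
  have hP : 0 ≤ ∏ i, hA.eigenvalues i := Finset.prod_nonneg fun i _ => hpos i
  have h4 := pow_le_pow_left₀ (Real.rpow_nonneg hP _) hle n
  rw [Real.rpow_inv_natCast_pow hP hn.ne', mul_pow] at h4
  rw [hdet]
  exact h4

theorem norm_det_le {n : ℕ} (A : Matrix (Fin n) (Fin n) ℂ) {M : ℝ} (hM0 : 0 ≤ M)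
    (hM : ∀ i j, ‖A i j‖ ≤ M) : ‖A.det‖ ≤ √((n : ℝ) ^ n) * M ^ n := by
  have h := Real.le_sqrt_of_sq_le (norm_det_sq_le A hM)
  rwa [Real.sqrt_mul (by positivity), pow_right_comm, Real.sqrt_sq (by positivity)] at h

/-- The estimate n^n/n! ≤ e^n spends half of the factorial on √(n^n). The remaining 1/√(n!) still
dominates every geometric growth. -/
theorem sqrt_pow_div_factorial_le (n : ℕ) :
    √((n : ℝ) ^ n) / n.factorial ≤ Real.exp n / √(n.factorial) := by
  have h : (n : ℝ) ^ n / n.factorial ≤ Real.exp n := by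
    have := Real.pow_div_factorial_le_exp (n : ℝ) (by positivity) n
    exact this
  have hf : (0 : ℝ) < n.factorial := by positivity
  have h2 : √((n : ℝ) ^ n) / √(n.factorial) ≤ Real.exp n := by
    rw [← Real.sqrt_div (by positivity)]
    calc √((n : ℝ) ^ n / n.factorial) ≤ √(Real.exp n) := Real.sqrt_le_sqrt h
      _ ≤ √(Real.exp n ^ 2) := by
          refine Real.sqrt_le_sqrt ?_
          have : 1 ≤ Real.exp n := Real.one_le_exp (by positivity)
          nlinarith
      _ = Real.exp n := Real.sqrt_sq (by positivity)
  have h3 : √((n : ℝ) ^ n) / n.factorial = (√((n : ℝ) ^ n) / √(n.factorial)) / √(n.factorial) := by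
    rw [div_div, Real.mul_self_sqrt hf.le]
  rw [h3]
  gcongr

theorem summable_pow_div_sqrt_factorial (y : ℝ) :
    Summable fun n : ℕ => y ^ n / √(n.factorial) := by
  rcases eq_or_ne y 0 with rfl | hy
  · refine summable_of_ne_finset_zero (s := {0}) fun n hn => ?_
    rw [zero_pow (by simpa using hn), zero_div]
  refine summable_of_ratio_test_tendsto_lt_one (l := 0) zero_lt_one
    (Eventually.of_forall fun n => by positivity) ?_
  have h : (fun n : ℕ => ‖y ^ (n + 1) / √((n + 1).factorial)‖ / ‖y ^ n / √(n.factorial)‖)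
      = fun n : ℕ => |y| / √((n : ℝ) + 1) := by
    funext n
    have hf : (0 : ℝ) < n.factorial := by positivity
    have h1 : √((n + 1).factorial : ℝ) = √((n : ℝ) + 1) * √(n.factorial) := by
      rw [← Real.sqrt_mul (by positivity)]
      push_cast [Nat.factorial_succ]
      rfl
    simp only [norm_div, norm_pow, Real.norm_eq_abs, h1, abs_mul,
      abs_of_nonneg (Real.sqrt_nonneg _)]
    field_simp
    ring
  rw [h]
  refine Tendsto.div_atTop tendsto_const_nhds ?_
  exact Real.tendsto_sqrt_atTop.comp
    (tendsto_atTop_add_const_right _ _ tendsto_natCast_atTop_atTop)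

theorem summable_hadamard (y : ℝ) (hy : 0 ≤ y) :
    Summable fun n : ℕ => √((n : ℝ) ^ n) * y ^ n / n.factorial := by
  refine Summable.of_nonneg_of_le (fun n => by positivity) (fun n => ?_)
    (summable_pow_div_sqrt_factorial (Real.exp 1 * y))
  have h := sqrt_pow_div_factorial_le n
  calc √((n : ℝ) ^ n) * y ^ n / n.factorial = √((n : ℝ) ^ n) / n.factorial * y ^ n := by ring
    _ ≤ Real.exp n / √(n.factorial) * y ^ n := by gcongr
    _ = (Real.exp 1 * y) ^ n / √(n.factorial) := by
        rw [mul_pow, ← Real.exp_nat_mul, mul_one]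
        ring

/-- Serves the series of the first minor, where n integrations come with a determinant of size n +
1. -/
theorem summable_hadamard_succ (y : ℝ) (hy : 0 ≤ y) :
    Summable fun n : ℕ => √(((n + 1 : ℕ) : ℝ) ^ (n + 1)) * y ^ n / n.factorial := by
  have h := (summable_nat_add_iff 1).2 (summable_hadamard (2 * (y + 1)) (by positivity))
  refine Summable.of_nonneg_of_le (fun n => by positivity) (fun n => ?_) h
  -- The factor n + 1 between n! and (n + 1)! is absorbed by the 2 in 2(y + 1).
  have h2 : ((n + 1 : ℕ) : ℝ) ≤ 2 ^ (n + 1) := by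
    exact_mod_cast (Nat.lt_two_pow_self).le
  have h3 : y ^ n ≤ (y + 1) ^ (n + 1) :=
    calc y ^ n ≤ (y + 1) ^ n := by gcongr; linarith
      _ ≤ (y + 1) ^ (n + 1) := pow_le_pow_right₀ (by linarith) n.le_succ
  rw [div_le_div_iff₀ (by positivity) (by positivity), mul_pow, Nat.factorial_succ]
  push_cast at h2 ⊢
  calc √(((n : ℝ) + 1) ^ (n + 1)) * y ^ n * (((n : ℝ) + 1) * n.factorial)
      = √(((n : ℝ) + 1) ^ (n + 1)) * (((n : ℝ) + 1) * y ^ n) * n.factorial := by ring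
    _ ≤ √(((n : ℝ) + 1) ^ (n + 1)) * (2 ^ (n + 1) * (y + 1) ^ (n + 1)) * n.factorial := by
        gcongr

/-! ### Determinant and first minor as functionals of an integrable weight -/

/-- The matrix `(K(sᵢ, tⱼ))`. -/
def kmat (K : ℝ → ℝ → ℂ) {n : ℕ} (s t : Fin n → ℝ) : Matrix (Fin n) (Fin n) ℂ :=
  Matrix.of fun i j => K (s i) (t j)

/-- The `n`-fold integral in the Fredholm determinant of the kernel `K(x, y) g(y)`. -/
def detTerm (K : ℝ → ℝ → ℂ) (g : ℝ → ℂ) (n : ℕ) : ℂ :=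
  ∫ x : Fin n → ℝ, (∏ i, g (x i)) * (kmat K x x).det

/-- The `n`-fold integral in the first Fredholm minor of the kernel `K(x, y) g(y)`. -/
def minorTerm (K : ℝ → ℝ → ℂ) (g : ℝ → ℂ) (n : ℕ) (s t : ℝ) : ℂ :=
  ∫ x : Fin n → ℝ, (∏ i, g (x i)) *
    (kmat K (Fin.cons s x : Fin (n + 1) → ℝ) (Fin.cons t x : Fin (n + 1) → ℝ)).det

/-- The Fredholm determinant of the kernel `K(x, y) g(y)`. -/
def wdet (K : ℝ → ℝ → ℂ) (g : ℝ → ℂ) : ℂ :=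
  ∑' n : ℕ, (-1 : ℂ) ^ n / (n.factorial : ℂ) * detTerm K g n

/-- The first Fredholm minor of the kernel `K(x, y) g(y)` (without the weight at the outer
variable). -/
def wminor (K : ℝ → ℝ → ℂ) (g : ℝ → ℂ) (s t : ℝ) : ℂ :=
  ∑' n : ℕ, (-1 : ℂ) ^ n / (n.factorial : ℂ) * minorTerm K g n s t

/-- Bounded continuous kernels. -/
structure BddKernel (K : ℝ → ℝ → ℂ) (M : ℝ) : Prop where
  cont : Continuous (Function.uncurry K)
  bound : ∀ x y, ‖K x y‖ ≤ M

variable {K : ℝ → ℝ → ℂ} {M : ℝ} {g η : ℝ → ℂ}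

theorem BddKernel.nonneg (hK : BddKernel K M) : 0 ≤ M :=
  (norm_nonneg _).trans (hK.bound 0 0)

theorem BddKernel.continuous_det (hK : BddKernel K M) {n : ℕ} :
    Continuous fun p : (Fin n → ℝ) × (Fin n → ℝ) => (kmat K p.1 p.2).det := by
  refine Continuous.matrix_det (continuous_matrix fun i j => ?_)
  exact hK.cont.comp (f := fun p : (Fin n → ℝ) × (Fin n → ℝ) => (p.1 i, p.2 j)) (by fun_prop)

theorem BddKernel.norm_det_kmat_le (hK : BddKernel K M) {n : ℕ} (s t : Fin n → ℝ) :
    ‖(kmat K s t).det‖ ≤ √((n : ℝ) ^ n) * M ^ n :=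
  norm_det_le _ hK.nonneg fun _ _ => hK.bound _ _

theorem integrable_prod_weight (hg : Integrable g) (n : ℕ) :
    Integrable fun x : Fin n → ℝ => ∏ i, g (x i) :=
  Integrable.fintype_prod (f := fun _ => g) fun _ => hg

theorem integral_norm_prod_weight (g : ℝ → ℂ) (n : ℕ) :
    ∫ x : Fin n → ℝ, ‖∏ i, g (x i)‖ = (∫ x, ‖g x‖) ^ n := by
  simp_rw [norm_prod]
  have := integral_fintype_prod_volume_eq_pow (ι := Fin n) (fun x => ‖g x‖)
  simpa using this

theorem integrable_weight_mul {n : ℕ} {w f : (Fin n → ℝ) → ℂ} (hw : Integrable w)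
    (hf : Continuous f) {C : ℝ} (hC : ∀ x, ‖f x‖ ≤ C) : Integrable fun x => w x * f x :=
  hw.mul_bdd (c := C) hf.aestronglyMeasurable (Eventually.of_forall hC)

theorem norm_integral_weight_mul_le {n : ℕ} {w f : (Fin n → ℝ) → ℂ} (hw : Integrable w)
    {C : ℝ} (hC : ∀ x, ‖f x‖ ≤ C) : ‖∫ x, w x * f x‖ ≤ C * ∫ x, ‖w x‖ := by
  rw [← integral_const_mul]
  refine norm_integral_le_of_norm_le (hw.norm.const_mul C) (Eventually.of_forall fun x => ?_)
  rw [norm_mul, mul_comm]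
  exact mul_le_mul_of_nonneg_right (hC x) (norm_nonneg _)

theorem BddKernel.integrable_det (hK : BddKernel K M) (hg : Integrable g) (n : ℕ) :
    Integrable fun x : Fin n → ℝ => (∏ i, g (x i)) * (kmat K x x).det :=
  integrable_weight_mul (integrable_prod_weight hg n)
    (hK.continuous_det.comp (f := fun x => (x, x)) (by fun_prop))
    fun x => hK.norm_det_kmat_le x x

theorem continuous_cons (n : ℕ) :
    Continuous fun p : ℝ × (Fin n → ℝ) => (Fin.cons p.1 p.2 : Fin (n + 1) → ℝ) := by
  refine continuous_pi fun i => ?_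
  refine Fin.cases ?_ (fun j => ?_) i
  · simpa using continuous_fst
  · simpa using (continuous_apply j).comp' continuous_snd

theorem BddKernel.continuous_minor (hK : BddKernel K M) (n : ℕ) :
    Continuous fun p : (ℝ × ℝ) × (Fin n → ℝ) =>
      (kmat K (Fin.cons p.1.1 p.2 : Fin (n + 1) → ℝ)
        (Fin.cons p.1.2 p.2 : Fin (n + 1) → ℝ)).det := by
  have h1 := (continuous_cons n).comp
    (f := fun p : (ℝ × ℝ) × (Fin n → ℝ) => (p.1.1, p.2)) (by fun_prop)
  have h2 := (continuous_cons n).comp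
    (f := fun p : (ℝ × ℝ) × (Fin n → ℝ) => (p.1.2, p.2)) (by fun_prop)
  exact hK.continuous_det.comp (h1.prodMk h2)

theorem BddKernel.integrable_minor (hK : BddKernel K M) (hg : Integrable g) (n : ℕ) (s t : ℝ) :
    Integrable fun x : Fin n → ℝ => (∏ i, g (x i)) *
      (kmat K (Fin.cons s x : Fin (n + 1) → ℝ) (Fin.cons t x : Fin (n + 1) → ℝ)).det :=
  integrable_weight_mul (integrable_prod_weight hg n)
    ((hK.continuous_minor n).comp (f := fun x => ((s, t), x)) (by fun_prop))
    fun _ => hK.norm_det_kmat_le _ _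

theorem BddKernel.norm_detTerm_le (hK : BddKernel K M) (hg : Integrable g) (n : ℕ) :
    ‖detTerm K g n‖ ≤ √((n : ℝ) ^ n) * M ^ n * (∫ x, ‖g x‖) ^ n := by
  rw [← integral_norm_prod_weight]
  exact norm_integral_weight_mul_le (integrable_prod_weight hg n) fun x => hK.norm_det_kmat_le x x

theorem BddKernel.norm_minorTerm_le (hK : BddKernel K M) (hg : Integrable g) (n : ℕ) (s t : ℝ) :
    ‖minorTerm K g n s t‖ ≤
      √(((n + 1 : ℕ) : ℝ) ^ (n + 1)) * M ^ (n + 1) * (∫ x, ‖g x‖) ^ n := by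
  rw [← integral_norm_prod_weight]
  exact norm_integral_weight_mul_le (integrable_prod_weight hg n) fun x => hK.norm_det_kmat_le _ _

theorem norm_coeff_mul_le (n : ℕ) {z : ℂ} {B : ℝ} (h : ‖z‖ ≤ B) :
    ‖(-1 : ℂ) ^ n / (n.factorial : ℂ) * z‖ ≤ B / n.factorial := by
  rw [norm_mul, norm_div, norm_pow, norm_neg, norm_one, one_pow, Complex.norm_natCast,
    div_mul_eq_mul_div, one_mul]
  gcongr

theorem BddKernel.summable_det (hK : BddKernel K M) (hg : Integrable g) :
    Summable fun n : ℕ => (-1 : ℂ) ^ n / (n.factorial : ℂ) * detTerm K g n := by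
  have h0 := hK.nonneg
  have h1 : 0 ≤ ∫ x, ‖g x‖ := integral_nonneg fun _ => norm_nonneg _
  refine Summable.of_norm_bounded (summable_hadamard (M * ∫ x, ‖g x‖) (by positivity)) fun n => ?_
  refine (norm_coeff_mul_le n (hK.norm_detTerm_le hg n)).trans_eq ?_
  rw [mul_pow]
  ring

/-- The summable majorant of the series of the first Fredholm minor. -/
def minorBound (M L : ℝ) (n : ℕ) : ℝ :=
  √(((n + 1 : ℕ) : ℝ) ^ (n + 1)) * M ^ (n + 1) * L ^ n / n.factorial

theorem summable_minorBound {M L : ℝ} (hM : 0 ≤ M) (hL : 0 ≤ L) : Summable (minorBound M L) := by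
  refine ((summable_hadamard_succ (M * L) (by positivity)).mul_left M).congr fun n => ?_
  rw [minorBound, mul_pow, pow_succ M]
  ring

theorem BddKernel.norm_minor_coeff_le (hK : BddKernel K M) (hg : Integrable g) (n : ℕ) (s t : ℝ) :
    ‖(-1 : ℂ) ^ n / (n.factorial : ℂ) * minorTerm K g n s t‖ ≤ minorBound M (∫ x, ‖g x‖) n :=
  norm_coeff_mul_le n (hK.norm_minorTerm_le hg n s t)

theorem BddKernel.summable_minor (hK : BddKernel K M) (hg : Integrable g) (s t : ℝ) :
    Summable fun n : ℕ => (-1 : ℂ) ^ n / (n.factorial : ℂ) * minorTerm K g n s t :=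
  Summable.of_norm_bounded
    (summable_minorBound hK.nonneg (integral_nonneg fun _ => norm_nonneg _))
    fun n => hK.norm_minor_coeff_le hg n s t

theorem BddKernel.norm_wminor_le (hK : BddKernel K M) (hg : Integrable g) (s t : ℝ) :
    ‖wminor K g s t‖ ≤ ∑' n, minorBound M (∫ x, ‖g x‖) n :=
  tsum_of_norm_bounded
    (summable_minorBound hK.nonneg (integral_nonneg fun _ => norm_nonneg _)).hasSum
    fun n => hK.norm_minor_coeff_le hg n s t

theorem BddKernel.continuous_minorTerm (hK : BddKernel K M) (hg : Integrable g) (n : ℕ) :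
    Continuous fun p : ℝ × ℝ => minorTerm K g n p.1 p.2 := by
  refine continuous_of_dominated
    (bound := fun x => ‖∏ i, g (x i)‖ * (√(((n + 1 : ℕ) : ℝ) ^ (n + 1)) * M ^ (n + 1)))
    (fun p => (hK.integrable_minor hg n p.1 p.2).aestronglyMeasurable)
    (fun p => Eventually.of_forall fun x => ?_)
    ((integrable_prod_weight hg n).norm.mul_const _) (Eventually.of_forall fun x => ?_)
  · rw [norm_mul]
    exact mul_le_mul_of_nonneg_left (hK.norm_det_kmat_le _ _) (norm_nonneg _)
  · exact continuous_const.mul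
      ((hK.continuous_minor n).comp (f := fun p : ℝ × ℝ => (p, x)) (by fun_prop))

theorem BddKernel.continuous_wminor (hK : BddKernel K M) (hg : Integrable g) :
    Continuous fun p : ℝ × ℝ => wminor K g p.1 p.2 :=
  continuous_tsum (fun n => continuous_const.mul (hK.continuous_minorTerm hg n))
    (summable_minorBound hK.nonneg (integral_nonneg fun _ => norm_nonneg _))
    fun n p => hK.norm_minor_coeff_le hg n p.1 p.2

/-! ### Row expansion of the minor and Fredholm's identities -/

theorem integral_insertNth {n : ℕ} (i : Fin (n + 1)) {f : (Fin (n + 1) → ℝ) → ℂ}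
    (hf : Integrable f) :
    ∫ x, f x = ∫ z : ℝ, ∫ x : Fin n → ℝ, f (i.insertNth z x) := by
  have h := (volume_preserving_piFinSuccAbove (fun _ : Fin (n + 1) => ℝ) i).symm
  have h1 := h.integral_comp' (g := f)
  have h2 : Integrable (fun p : ℝ × (Fin n → ℝ) => f (i.insertNth p.1 p.2))
      (volume.prod volume) :=
    (h.integrable_comp_emb (MeasurableEquiv.measurableEmbedding _)).2 hf
  rw [← h1, ← integral_prod _ h2]
  rfl

/-- Row i is brought to the top by the cycle `i.cycleRange`, whose sign is (-1)^i. -/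
theorem det_kmat_insertNth_left (K : ℝ → ℝ → ℂ) {n : ℕ} (i : Fin (n + 1)) (z : ℝ)
    (x : Fin n → ℝ) (t : Fin (n + 1) → ℝ) :
    (kmat K (i.insertNth z x : Fin (n + 1) → ℝ) t).det =
      (-1) ^ (i : ℕ) * (kmat K (Fin.cons z x : Fin (n + 1) → ℝ) t).det := by
  have h : kmat K (i.insertNth z x : Fin (n + 1) → ℝ) t =
      (kmat K (Fin.cons z x : Fin (n + 1) → ℝ) t).submatrix i.cycleRange id := by
    ext a c
    simp [kmat]
  rw [h, Matrix.det_permute]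
  simp

theorem det_kmat_insertNth (K : ℝ → ℝ → ℂ) {n : ℕ} (i : Fin (n + 1)) (z : ℝ) (x : Fin n → ℝ) :
    (kmat K (i.insertNth z x : Fin (n + 1) → ℝ) (i.insertNth z x)).det =
      (kmat K (Fin.cons z x : Fin (n + 1) → ℝ) (Fin.cons z x : Fin (n + 1) → ℝ)).det := by
  have h : kmat K (i.insertNth z x : Fin (n + 1) → ℝ) (i.insertNth z x) =
      (kmat K (Fin.cons z x : Fin (n + 1) → ℝ) (Fin.cons z x : Fin (n + 1) → ℝ)).submatrix
        i.cycleRange i.cycleRange := by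
    ext a c
    simp [kmat]
  rw [h, Matrix.det_submatrix_equiv_self]

theorem prod_insertNth (g : ℝ → ℂ) {n : ℕ} (i : Fin (n + 1)) (z : ℝ) (x : Fin n → ℝ) :
    ∏ j, g ((i.insertNth z x : Fin (n + 1) → ℝ) j) = g z * ∏ j, g (x j) := by
  rw [Fin.prod_univ_succAbove _ i]
  simp

/-- Laplace expansion along the row of s. The entry K(s, t) leaves the full determinant; each entry
K(s, xᵢ) leaves, after integration, minus a minor in which xᵢ has taken the place of s. These n + 1
contributions are equal. -/
theorem BddKernel.minorTerm_succ (hK : BddKernel K M) (hg : Integrable g) (n : ℕ) (s t : ℝ) :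
    minorTerm K g (n + 1) s t = K s t * detTerm K g (n + 1) -
      (n + 1) * ∫ z, K s z * g z * minorTerm K g n z t := by
  have hterm : ∀ i : Fin (n + 1), Integrable fun x : Fin (n + 1) → ℝ =>
      (∏ j, g (x j)) * ((-1) ^ ((i : ℕ) + 1) * K s (x i) *
        (kmat K x (fun j => (Fin.cons t x : Fin (n + 2) → ℝ) (i.succ.succAbove j))).det) := by
    intro i
    refine integrable_weight_mul (C := 1 * M * (√(((n + 1 : ℕ) : ℝ) ^ (n + 1)) * M ^ (n + 1)))
      (integrable_prod_weight hg (n + 1)) ?_ fun x => ?_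
    · refine Continuous.mul (continuous_const.mul
        (hK.cont.comp (f := fun x : Fin (n + 1) → ℝ => (s, x i)) (by fun_prop))) ?_
      refine hK.continuous_det.comp (f := fun x : Fin (n + 1) → ℝ =>
        (x, fun j => (Fin.cons t x : Fin (n + 2) → ℝ) (i.succ.succAbove j))) ?_
      refine continuous_id.prodMk (continuous_pi fun j => ?_)
      exact (continuous_apply _).comp ((continuous_cons (n + 1)).comp
        (f := fun x : Fin (n + 1) → ℝ => (t, x)) (by fun_prop))
    · rw [norm_mul, norm_mul, norm_pow, norm_neg, norm_one, one_pow]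
      have := hK.nonneg
      gcongr
      · exact hK.bound _ _
      · exact hK.norm_det_kmat_le _ _
  have hexp : ∀ x : Fin (n + 1) → ℝ, (∏ j, g (x j)) *
      (kmat K (Fin.cons s x : Fin (n + 2) → ℝ) (Fin.cons t x : Fin (n + 2) → ℝ)).det =
      K s t * ((∏ j, g (x j)) * (kmat K x x).det) + ∑ i : Fin (n + 1),
        (∏ j, g (x j)) * ((-1) ^ ((i : ℕ) + 1) * K s (x i) *
        (kmat K x (fun j => (Fin.cons t x : Fin (n + 2) → ℝ) (i.succ.succAbove j))).det) := by
    intro x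
    rw [Matrix.det_succ_row_zero, Fin.sum_univ_succ, mul_add, Finset.mul_sum]
    congr 1
    · have : (kmat K (Fin.cons s x : Fin (n + 2) → ℝ) (Fin.cons t x : Fin (n + 2) → ℝ)).submatrix
          Fin.succ (Fin.succAbove 0) = kmat K x x := by
        ext a c
        simp [kmat]
      rw [this]
      simp [kmat]
      ring
  have hi : ∀ i : Fin (n + 1), ∫ x : Fin (n + 1) → ℝ,
      (∏ j, g (x j)) * ((-1) ^ ((i : ℕ) + 1) * K s (x i) *
        (kmat K x (fun j => (Fin.cons t x : Fin (n + 2) → ℝ) (i.succ.succAbove j))).det) =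
      -∫ z, K s z * g z * minorTerm K g n z t := by
    intro i
    rw [integral_insertNth i (hterm i), ← integral_neg]
    congr 1
    funext z
    rw [minorTerm, ← integral_const_mul, ← integral_neg]
    congr 1
    funext x
    -- The deleted column i + 1 is that of z = xᵢ, so the columns t, x remain. The row of z sits at
    -- position i and moves to the top with sign (-1)^i, which turns the cofactor sign (-1)^(i+1)
    -- into -1.
    have hcol : (fun j => (Fin.cons t (i.insertNth z x : Fin (n + 1) → ℝ) : Fin (n + 2) → ℝ)
        (i.succ.succAbove j)) = Fin.cons t x := by
      funext j
      refine Fin.cases ?_ (fun k => ?_) j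
      · simp
      · simp [Fin.succ_succAbove_succ]
    rw [hcol, prod_insertNth, det_kmat_insertNth_left, Fin.insertNth_apply_same, pow_succ]
    have : ((-1 : ℂ) ^ (i : ℕ)) * (-1) ^ (i : ℕ) = 1 := by
      rw [← mul_pow]; simp
    linear_combination (-(g z * (∏ j, g (x j)) * K s z *
      (kmat K (Fin.cons z x : Fin (n + 1) → ℝ) (Fin.cons t x : Fin (n + 1) → ℝ)).det)) * this
  rw [minorTerm, integral_congr_ae (Eventually.of_forall hexp),
    integral_add ((hK.integrable_det hg (n + 1)).const_mul _)
      (integrable_finsetSum _ fun i _ => hterm i), integral_finsetSum _ fun i _ => hterm i,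
    integral_const_mul, Finset.sum_congr rfl fun i _ => hi i, Finset.sum_const, Finset.card_univ,
    Fintype.card_fin, nsmul_eq_mul, detTerm]
  push_cast
  ring

/-- The recursion `minorTerm_succ` summed over n: its factor n + 1 turns 1/(n + 1)! into 1/n!, so
that the integrals reassemble the series of the minor. -/
theorem BddKernel.wminor_eq (hK : BddKernel K M) (hg : Integrable g) (s t : ℝ) :
    wminor K g s t = K s t * wdet K g + ∫ z, K s z * g z * wminor K g z t := by
  have h0 := hK.nonneg
  have hKc : Continuous fun z => K s z := hK.cont.comp (f := fun z => (s, z)) (by fun_prop)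
  have hL : 0 ≤ ∫ x, ‖g x‖ := integral_nonneg fun _ => norm_nonneg _
  have hKg : Integrable fun z => K s z * g z :=
    hg.bdd_mul (c := M) hKc.aestronglyMeasurable (Eventually.of_forall fun z => hK.bound s z)
  have hcont : ∀ n, Continuous fun z => minorTerm K g n z t := fun n =>
    (hK.continuous_minorTerm hg n).comp (f := fun z => (z, t)) (by fun_prop)
  have hint : HasSum (fun n : ℕ => ∫ z, (-1 : ℂ) ^ n / (n.factorial : ℂ) *
      (K s z * g z * minorTerm K g n z t)) (∫ z, K s z * g z * wminor K g z t) := by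
    have key := hasSum_integral_of_dominated_convergence (μ := volume)
      (F := fun (n : ℕ) z => (-1 : ℂ) ^ n / (n.factorial : ℂ) * (K s z * g z * minorTerm K g n z t))
      (f := fun z => K s z * g z * wminor K g z t)
      (bound := fun n z => ‖K s z * g z‖ * minorBound M (∫ x, ‖g x‖) n)
      (fun n => (hKg.aestronglyMeasurable.mul (hcont n).aestronglyMeasurable).const_mul _)
      (fun n => Eventually.of_forall fun z => ?_)
      (Eventually.of_forall fun z => (summable_minorBound h0 hL).mul_left _) ?_
      (Eventually.of_forall fun z => ?_)
    · exact key
    · rw [mul_left_comm, norm_mul]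
      exact mul_le_mul_of_nonneg_left (hK.norm_minor_coeff_le hg n z t) (norm_nonneg _)
    · simp_rw [tsum_mul_left]
      exact hKg.norm.mul_const _
    · have := (hK.summable_minor hg z t).hasSum.mul_left (K s z * g z)
      have e : (fun n : ℕ => K s z * g z * ((-1 : ℂ) ^ n / (n.factorial : ℂ) * minorTerm K g n z t))
          = fun n : ℕ => (-1 : ℂ) ^ n / (n.factorial : ℂ) * (K s z * g z * minorTerm K g n z t) := by
        funext n
        ring
      rw [e] at this
      exact this
  have hs := (hK.summable_minor hg s t)
  have hd := (hK.summable_det hg)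
  rw [wminor, hs.tsum_eq_zero_add, wdet, hd.tsum_eq_zero_add]
  have hsucc : ∀ n : ℕ, (-1 : ℂ) ^ (n + 1) / ((n + 1).factorial : ℂ) * minorTerm K g (n + 1) s t =
      K s t * ((-1 : ℂ) ^ (n + 1) / ((n + 1).factorial : ℂ) * detTerm K g (n + 1)) +
      ∫ z, (-1 : ℂ) ^ n / (n.factorial : ℂ) * (K s z * g z * minorTerm K g n z t) := by
    intro n
    rw [hK.minorTerm_succ hg, integral_const_mul, Nat.factorial_succ]
    have : (n.factorial : ℂ) ≠ 0 := by exact_mod_cast n.factorial_ne_zero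
    have h2 : ((n : ℂ) + 1) ≠ 0 := by exact_mod_cast n.succ_ne_zero
    push_cast
    field_simp
    ring
  have hd1 := (summable_nat_add_iff 1).2 hd
  rw [tsum_congr hsucc, (hd1.mul_left (K s t)).tsum_add hint.summable, tsum_mul_left, hint.tsum_eq]
  have e1 : minorTerm K g 0 s t = K s t := by
    simp [minorTerm, kmat, measureReal_def, volume_pi]
  have e2 : detTerm K g 0 = 1 := by simp [detTerm, measureReal_def, volume_pi]
  rw [e1, e2]
  simp
  ring

theorem BddKernel.swap (hK : BddKernel K M) : BddKernel (fun x y => K y x) M :=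
  ⟨hK.cont.comp continuous_swap, fun x y => hK.bound y x⟩

theorem kmat_swap (K : ℝ → ℝ → ℂ) {n : ℕ} (s t : Fin n → ℝ) :
    kmat (fun x y => K y x) s t = (kmat K t s).transpose := rfl

theorem wdet_swap (K : ℝ → ℝ → ℂ) (g : ℝ → ℂ) : wdet (fun x y => K y x) g = wdet K g := by
  simp only [wdet, detTerm, kmat_swap, Matrix.det_transpose]

theorem wminor_swap (K : ℝ → ℝ → ℂ) (g : ℝ → ℂ) (s t : ℝ) :
    wminor (fun x y => K y x) g s t = wminor K g t s := by
  simp only [wminor, minorTerm, kmat_swap, Matrix.det_transpose]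

/-- Transposing the kernel exchanges the arguments of the minor and fixes the determinant, so this
is `wminor_eq` for the transpose. -/
theorem BddKernel.wminor_eq' (hK : BddKernel K M) (hg : Integrable g) (s t : ℝ) :
    wminor K g s t = K s t * wdet K g + ∫ z, wminor K g s z * g z * K z t := by
  have h := hK.swap.wminor_eq hg t s
  simp only [wminor_swap, wdet_swap] at h
  rw [h]
  congr 2
  funext z
  ring

end ExpTW

end

noncomputable section

namespace ExpTW

/-! ### First order perturbation of the Fredholm determinant -/

variable {K : ℝ → ℝ → ℂ} {M : ℝ} {g η : ℝ → ℂ}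

theorem prod_add_eq_sum_ite {R : Type*} [CommSemiring R] {n : ℕ} (a b : Fin n → R) :
    ∏ i, (a i + b i) = ∑ t : Finset (Fin n), ∏ i, if i ∈ t then a i else b i := by
  rw [Finset.prod_add, Finset.powerset_univ]
  refine Finset.sum_congr rfl fun t _ => ?_
  rw [← Finset.prod_sdiff (Finset.subset_univ t), mul_comm]
  congr 1
  · exact Finset.prod_congr rfl fun i hi => by rw [if_neg (Finset.mem_sdiff.1 hi).2]
  · exact Finset.prod_congr rfl fun i hi => by rw [if_pos hi]

/-- The cardinality of t is the order in the perturbation η: orders zero and one are kept exactly,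
the others are estimated. -/
theorem sum_finset_split {n : ℕ} (f : Finset (Fin n) → ℂ) :
    ∑ t, f t = f ∅ + ∑ i, f {i} + ∑ t with 2 ≤ t.card, f t := by
  rw [← Finset.sum_filter_add_sum_filter_not Finset.univ (fun t => 2 ≤ t.card), add_comm]
  congr 1
  have h : (Finset.univ.filter fun t : Finset (Fin n) => ¬ 2 ≤ t.card) =
      insert ∅ (Finset.univ.map ⟨fun i => ({i} : Finset (Fin n)), Finset.singleton_injective⟩) := by
    ext t
    simp only [Finset.mem_filter, Finset.mem_univ, true_and, Finset.mem_insert, Finset.mem_map,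
      Function.Embedding.coeFn_mk, not_le]
    constructor
    · intro h
      have h2 : t.card = 0 ∨ t.card = 1 := by omega
      rcases h2 with h2 | h2
      · exact Or.inl (Finset.card_eq_zero.1 h2)
      · obtain ⟨i, hi⟩ := Finset.card_eq_one.1 h2
        exact Or.inr ⟨i, hi.symm⟩
    · rintro (rfl | ⟨i, rfl⟩) <;> simp
  rw [h, Finset.sum_insert (by simp), Finset.sum_map]
  rfl

/-- The integrand of `detTerm` with the weight `η` in the variables in `t`, and `g` in the others. -/
def mixedTerm (K : ℝ → ℝ → ℂ) (g η : ℝ → ℂ) (n : ℕ) (t : Finset (Fin n)) : ℂ :=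
  ∫ x : Fin n → ℝ, (∏ i, if i ∈ t then η (x i) else g (x i)) * (kmat K x x).det

theorem integrable_mixed_weight (hg : Integrable g) (hη : Integrable η) (n : ℕ)
    (t : Finset (Fin n)) :
    Integrable fun x : Fin n → ℝ => ∏ i, if i ∈ t then η (x i) else g (x i) := by
  have := Integrable.fintype_prod (μ := fun _ : Fin n => (volume : Measure ℝ))
    (f := fun i z => if i ∈ t then η z else g z) (fun i => ?_)
  · exact this
  · by_cases h : i ∈ t
    · simpa [h] using hη
    · simpa [h] using hg

theorem integral_norm_mixed_weight (g η : ℝ → ℂ) (n : ℕ) (t : Finset (Fin n)) :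
    ∫ x : Fin n → ℝ, ‖∏ i, if i ∈ t then η (x i) else g (x i)‖ =
      ∏ i, if i ∈ t then ∫ x, ‖η x‖ else ∫ x, ‖g x‖ := by
  simp_rw [norm_prod]
  have := integral_fintype_prod_volume_eq_prod (ι := Fin n)
    (fun i z => ‖if i ∈ t then η z else g z‖)
  rw [this]
  refine Finset.prod_congr rfl fun i _ => ?_
  by_cases h : i ∈ t <;> simp [h]

theorem BddKernel.integrable_mixed (hK : BddKernel K M) (hg : Integrable g) (hη : Integrable η)
    (n : ℕ) (t : Finset (Fin n)) :
    Integrable fun x : Fin n → ℝ =>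
      (∏ i, if i ∈ t then η (x i) else g (x i)) * (kmat K x x).det :=
  integrable_weight_mul (integrable_mixed_weight hg hη n t)
    (hK.continuous_det.comp (f := fun x => (x, x)) (by fun_prop)) fun x => hK.norm_det_kmat_le x x

theorem BddKernel.detTerm_add (hK : BddKernel K M) (hg : Integrable g) (hη : Integrable η) (n : ℕ) :
    detTerm K (fun x => η x + g x) n = ∑ t, mixedTerm K g η n t := by
  simp only [mixedTerm]
  rw [← integral_finsetSum _ fun t _ => hK.integrable_mixed hg hη n t, detTerm]
  congr 1
  funext x
  rw [prod_add_eq_sum_ite, Finset.sum_mul]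

/-- The variable carrying η is moved to the front; rows and columns are permuted alike, so no sign
appears. -/
theorem BddKernel.mixedTerm_singleton (hK : BddKernel K M) (hg : Integrable g) (hη : Integrable η)
    (n : ℕ) (i : Fin (n + 1)) :
    mixedTerm K g η (n + 1) {i} = ∫ z, η z * minorTerm K g n z z := by
  rw [mixedTerm, integral_insertNth i (hK.integrable_mixed hg hη (n + 1) {i})]
  congr 1
  funext z
  rw [minorTerm, ← integral_const_mul]
  congr 1
  funext x
  rw [Fin.prod_univ_succAbove _ i, det_kmat_insertNth]
  simp [Fin.succAbove_ne, mul_assoc]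

/-- Each variable in t contributes a factor ε, and ε ≤ 1 reduces ε^|t| to ε². What is left, summed
over all subsets, is (1 + L)^n by the binomial expansion. -/
theorem BddKernel.norm_sum_mixedTerm_le (hK : BddKernel K M) (hg : Integrable g)
    (hη : Integrable η) {L ε : ℝ} (hL : ∫ x, ‖g x‖ ≤ L) (hε : ∫ x, ‖η x‖ ≤ ε) (hε1 : ε ≤ 1)
    (n : ℕ) :
    ‖∑ t with 2 ≤ t.card, mixedTerm K g η n t‖ ≤
      ε ^ 2 * (√((n : ℝ) ^ n) * (M * (1 + L)) ^ n) := by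
  have hM := hK.nonneg
  have hε0 : 0 ≤ ε := (integral_nonneg fun _ => norm_nonneg _).trans hε
  have hL0 : 0 ≤ L := (integral_nonneg fun _ => norm_nonneg _).trans hL
  have key : ∀ t ∈ (Finset.univ.filter fun t : Finset (Fin n) => 2 ≤ t.card),
      ‖mixedTerm K g η n t‖ ≤
        √((n : ℝ) ^ n) * M ^ n * (ε ^ 2 * ∏ i, if i ∈ t then 1 else L) := by
    intro t ht
    have h2 : 2 ≤ t.card := (Finset.mem_filter.1 ht).2
    refine (norm_integral_weight_mul_le (integrable_mixed_weight hg hη n t)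
      fun x => hK.norm_det_kmat_le x x).trans ?_
    rw [integral_norm_mixed_weight]
    refine mul_le_mul_of_nonneg_left ?_ (by positivity)
    calc (∏ i, if i ∈ t then ∫ x, ‖η x‖ else ∫ x, ‖g x‖)
        ≤ ∏ i, if i ∈ t then ε else L := by
          refine Finset.prod_le_prod (fun i _ => ?_) fun i _ => ?_
          · split_ifs <;> exact integral_nonneg fun _ => norm_nonneg _
          · split_ifs
            · exact hε
            · exact hL
      _ = ε ^ t.card * ∏ i, if i ∈ t then 1 else L := by
          have : ∀ i, (if i ∈ t then ε else L) =
              (if i ∈ t then ε else 1) * (if i ∈ t then 1 else L) := by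
            intro i; split_ifs <;> simp
          simp_rw [this]
          rw [Finset.prod_mul_distrib, Finset.prod_ite_mem, Finset.univ_inter, Finset.prod_const]
      _ ≤ ε ^ 2 * ∏ i, if i ∈ t then 1 else L := by
          refine mul_le_mul_of_nonneg_right (pow_le_pow_of_le_one hε0 hε1 h2) ?_
          exact Finset.prod_nonneg fun i _ => by split_ifs <;> positivity
  refine (norm_sum_le_of_le _ key).trans ?_
  calc ∑ t : Finset (Fin n) with 2 ≤ t.card, √((n : ℝ) ^ n) * M ^ n * (ε ^ 2 * ∏ i, if i ∈ t then 1 else L)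
      ≤ ∑ t : Finset (Fin n), √((n : ℝ) ^ n) * M ^ n * (ε ^ 2 * ∏ i, if i ∈ t then 1 else L) := by
        refine Finset.sum_le_sum_of_subset_of_nonneg (Finset.filter_subset _ _) fun t _ _ => ?_
        have : 0 ≤ ∏ i, if i ∈ t then 1 else L :=
          Finset.prod_nonneg fun i _ => by split_ifs <;> positivity
        positivity
    _ = ε ^ 2 * (√((n : ℝ) ^ n) * (M * (1 + L)) ^ n) := by
        rw [← Finset.mul_sum, ← Finset.mul_sum, ← prod_add_eq_sum_ite, Finset.prod_const,
          Finset.card_univ, Fintype.card_fin, mul_pow]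
        ring

theorem BddKernel.norm_detTerm_sub_le (hK : BddKernel K M) (hg : Integrable g)
    (hη : Integrable η) {L ε : ℝ} (hL : ∫ x, ‖g x‖ ≤ L) (hε : ∫ x, ‖η x‖ ≤ ε) (hε1 : ε ≤ 1)
    (n : ℕ) :
    ‖detTerm K (fun x => η x + g x) n - detTerm K g n
      - n * ∫ z, η z * minorTerm K g (n - 1) z z‖ ≤
      ε ^ 2 * (√((n : ℝ) ^ n) * (M * (1 + L)) ^ n) := by
  have h0 : mixedTerm K g η n ∅ = detTerm K g n := by simp [mixedTerm, detTerm]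
  have h1 : ∑ i, mixedTerm K g η n {i} = n * ∫ z, η z * minorTerm K g (n - 1) z z := by
    -- For n = 0 there are no singletons, and the truncated `n - 1` is harmless because of the
    -- factor n.
    cases n with
    | zero => simp
    | succ n =>
      rw [Finset.sum_congr rfl fun i _ => hK.mixedTerm_singleton hg hη n i]
      simp
  rw [hK.detTerm_add hg hη, sum_finset_split, h0, h1]
  have e : ∀ a b c : ℂ, a + b + c - a - b = c := fun a b c => by ring
  rw [e]
  exact hK.norm_sum_mixedTerm_le hg hη hL hε hε1 n

/-- The constant in the second order bound for the Fredholm determinant. -/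
def detBound (M L : ℝ) : ℝ := ∑' n : ℕ, √((n : ℝ) ^ n) * (M * (1 + L)) ^ n / n.factorial

theorem BddKernel.hasSum_integral_minor (hK : BddKernel K M) (hg : Integrable g)
    (hη : Integrable η) :
    HasSum (fun n : ℕ => (-1 : ℂ) ^ n / (n.factorial : ℂ) * ∫ z, η z * minorTerm K g n z z)
      (∫ z, η z * wminor K g z z) := by
  have h0 := hK.nonneg
  have hL : 0 ≤ ∫ x, ‖g x‖ := integral_nonneg fun _ => norm_nonneg _
  have hcont : ∀ n, Continuous fun z => minorTerm K g n z z := fun n =>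
    (hK.continuous_minorTerm hg n).comp (f := fun z => (z, z)) (by fun_prop)
  have key := hasSum_integral_of_dominated_convergence (μ := volume)
    (F := fun (n : ℕ) z => (-1 : ℂ) ^ n / (n.factorial : ℂ) * (η z * minorTerm K g n z z))
    (f := fun z => η z * wminor K g z z)
    (bound := fun n z => ‖η z‖ * minorBound M (∫ x, ‖g x‖) n)
    (fun n => (hη.aestronglyMeasurable.mul (hcont n).aestronglyMeasurable).const_mul _)
    (fun n => Eventually.of_forall fun z => ?_)
    (Eventually.of_forall fun z => (summable_minorBound h0 hL).mul_left _) ?_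
    (Eventually.of_forall fun z => ?_)
  · simp_rw [integral_const_mul] at key
    exact key
  · rw [mul_left_comm, norm_mul]
    exact mul_le_mul_of_nonneg_left (hK.norm_minor_coeff_le hg n z z) (norm_nonneg _)
  · simp_rw [tsum_mul_left]
    exact hη.norm.mul_const _
  · have := (hK.summable_minor hg z z).hasSum.mul_left (η z)
    have e : (fun n : ℕ => η z * ((-1 : ℂ) ^ n / (n.factorial : ℂ) * minorTerm K g n z z))
        = fun n : ℕ => (-1 : ℂ) ^ n / (n.factorial : ℂ) * (η z * minorTerm K g n z z) := by
      funext n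
      ring
    rw [e] at this
    exact this

/-- The determinant is differentiable in the weight for the L¹ norm, with derivative minus the
diagonal minor; the quadratic error is what allows differentiation in the endpoints later. -/
theorem BddKernel.norm_wdet_add_sub_le (hK : BddKernel K M) (hg : Integrable g)
    (hη : Integrable η) {L ε : ℝ} (hL : ∫ x, ‖g x‖ ≤ L) (hε : ∫ x, ‖η x‖ ≤ ε) (hε1 : ε ≤ 1) :
    ‖wdet K (fun x => η x + g x) - wdet K g + ∫ z, η z * wminor K g z z‖ ≤
      ε ^ 2 * detBound M L := by
  have hL0 : 0 ≤ L := (integral_nonneg fun _ => norm_nonneg _).trans hL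
  have hM := hK.nonneg
  have h1 := (hK.summable_det (hη.add hg)).hasSum
  have h2 := (hK.summable_det hg).hasSum
  have h3 : HasSum (fun n : ℕ => (-1 : ℂ) ^ n / (n.factorial : ℂ) *
      (n * ∫ z, η z * minorTerm K g (n - 1) z z)) (-∫ z, η z * wminor K g z z) := by
    -- The linear term of order n = 0 vanishes. After the shift its coefficient is (-1)^(n+1)(n +
    -- 1)/(n + 1)! = -(-1)^n/n!, that of the minor up to sign.
    rw [← hasSum_nat_add_iff' 1]
    have := (hK.hasSum_integral_minor hg hη).neg
    simp only [Finset.range_one, Finset.sum_singleton, Nat.cast_zero, zero_mul, mul_zero, sub_zero]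
    convert this using 2 with n
    rw [Nat.factorial_succ, Nat.add_sub_cancel]
    have : (n.factorial : ℂ) ≠ 0 := by exact_mod_cast n.factorial_ne_zero
    have h2 : ((n : ℂ) + 1) ≠ 0 := by exact_mod_cast n.succ_ne_zero
    push_cast
    field_simp
    ring
  have h4 := (h1.sub h2).sub h3
  have hsum := (summable_hadamard (M * (1 + L)) (by positivity)).hasSum.mul_left (ε ^ 2)
  have e : wdet K (fun x => η x + g x) - wdet K g + ∫ z, η z * wminor K g z z =
      wdet K (fun x => η x + g x) - wdet K g - -∫ z, η z * wminor K g z z := by ring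
  rw [e]
  refine (h4.tsum_eq.symm ▸ tsum_of_norm_bounded hsum fun n => ?_)
  rw [← mul_sub, ← mul_sub]
  refine (norm_coeff_mul_le n (hK.norm_detTerm_sub_le hg hη hL hε hε1 n)).trans_eq ?_
  ring

/-! ### The Fredholm determinant as a function of the endpoints -/

/-- The indicator function of `[a₁, a₂]`. -/
def ind (a₁ a₂ : ℝ) : ℝ → ℂ := (Icc a₁ a₂).indicator fun _ => 1

theorem integrable_ind (a₁ a₂ : ℝ) : Integrable (ind a₁ a₂) :=
  (integrable_indicator_iff measurableSet_Icc).2 (integrableOn_const (by simp))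

theorem integral_norm_ind_le (a₁ a₂ : ℝ) : ∫ x, ‖ind a₁ a₂ x‖ ≤ |a₂ - a₁| := by
  have : (fun x => ‖ind a₁ a₂ x‖) = (Icc a₁ a₂).indicator fun _ => (1 : ℝ) := by
    funext x
    rw [ind, norm_indicator_eq_indicator_norm]
    simp
  rw [this, integral_indicator measurableSet_Icc]
  simp [measureReal_def, ENNReal.toReal_ofReal', le_abs_self]

theorem integral_ind_mul (a₁ a₂ : ℝ) (f : ℝ → ℂ) :
    ∫ z, ind a₁ a₂ z * f z = ∫ z in Icc a₁ a₂, f z := by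
  rw [← integral_indicator measurableSet_Icc]
  congr 1
  funext z
  by_cases h : z ∈ Icc a₁ a₂ <;> simp [ind, h]

theorem fredholmDet_eq_wdet (K : ℝ → ℝ → ℂ) (a₁ a₂ : ℝ) :
    fredholmDet K a₁ a₂ = wdet K (ind a₁ a₂) := by
  rw [fredholmDet, wdet]
  refine tsum_congr fun n => ?_
  congr 1
  rw [← integral_indicator (MeasurableSet.univ_pi fun _ => measurableSet_Icc), detTerm]
  congr 1
  funext x
  by_cases h : x ∈ univ.pi fun _ : Fin n => Icc a₁ a₂
  · rw [indicator_of_mem h, Finset.prod_eq_one, one_mul]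
    · rfl
    · intro i _
      rw [ind, indicator_of_mem (h i trivial)]
  · rw [indicator_of_notMem h]
    simp only [Set.mem_pi, mem_univ, true_imp_iff, not_forall] at h
    obtain ⟨i, hi⟩ := h
    rw [Finset.prod_eq_zero (Finset.mem_univ i), zero_mul]
    rw [ind, indicator_of_notMem hi]

/-- The indicators differ at most on the two segments swept by the endpoints, whatever the order of
the four points. -/
theorem integral_norm_ind_sub_le (a₁ a₂ b₁ b₂ : ℝ) :
    ∫ x, ‖ind b₁ b₂ x - ind a₁ a₂ x‖ ≤ |b₁ - a₁| + |b₂ - a₂| := by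
  have h : ∀ x, ‖ind b₁ b₂ x - ind a₁ a₂ x‖ ≤
      (uIcc a₁ b₁).indicator (fun _ => (1 : ℝ)) x + (uIcc a₂ b₂).indicator (fun _ => (1 : ℝ)) x := by
    intro x
    have p1 : 0 ≤ (uIcc a₁ b₁).indicator (fun _ => (1 : ℝ)) x :=
      indicator_nonneg (fun _ _ => zero_le_one) _
    have p2 : 0 ≤ (uIcc a₂ b₂).indicator (fun _ => (1 : ℝ)) x :=
      indicator_nonneg (fun _ _ => zero_le_one) _
    by_cases hb : x ∈ Icc b₁ b₂ <;> by_cases ha : x ∈ Icc a₁ a₂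
    · simp only [ind, indicator_of_mem hb, indicator_of_mem ha, sub_self, norm_zero]
      positivity
    · simp only [ind, indicator_of_mem hb, indicator_of_notMem ha, sub_zero, norm_one]
      by_cases h1 : a₁ ≤ x
      · have : x ∈ uIcc a₂ b₂ := by
          rw [mem_uIcc]
          left
          exact ⟨le_of_not_ge fun h2 => ha ⟨h1, h2⟩, hb.2⟩
        rw [indicator_of_mem this]
        linarith
      · have : x ∈ uIcc a₁ b₁ := by
          rw [mem_uIcc]
          right
          exact ⟨hb.1, (not_le.1 h1).le⟩
        rw [indicator_of_mem this]
        linarith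
    · simp only [ind, indicator_of_notMem hb, indicator_of_mem ha, zero_sub, norm_neg, norm_one]
      by_cases h1 : b₁ ≤ x
      · have : x ∈ uIcc a₂ b₂ := by
          rw [mem_uIcc]
          right
          exact ⟨le_of_not_ge fun h2 => hb ⟨h1, h2⟩, ha.2⟩
        rw [indicator_of_mem this]
        linarith
      · have : x ∈ uIcc a₁ b₁ := by
          rw [mem_uIcc]
          left
          exact ⟨ha.1, (not_le.1 h1).le⟩
        rw [indicator_of_mem this]
        linarith
    · simp only [ind, indicator_of_notMem hb, indicator_of_notMem ha, sub_zero, norm_zero]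
      positivity
  have hi : ∀ a b : ℝ, Integrable ((uIcc a b).indicator fun _ => (1 : ℝ)) := fun a b =>
    (integrable_indicator_iff measurableSet_uIcc).2 (integrableOn_const (by simp [uIcc]))
  have hv : ∀ a b : ℝ, ∫ x, (uIcc a b).indicator (fun _ => (1 : ℝ)) x = |b - a| := by
    intro a b
    rw [integral_indicator measurableSet_uIcc]
    simp [measureReal_def]
  calc ∫ x, ‖ind b₁ b₂ x - ind a₁ a₂ x‖
      ≤ ∫ x, ((uIcc a₁ b₁).indicator (fun _ => (1 : ℝ)) x +
        (uIcc a₂ b₂).indicator (fun _ => (1 : ℝ)) x) :=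
        integral_mono ((integrable_ind _ _).sub (integrable_ind _ _)).norm
          ((hi _ _).add (hi _ _)) h
    _ = |b₁ - a₁| + |b₂ - a₂| := by
        rw [integral_add (hi _ _) (hi _ _), hv, hv]

theorem BddKernel.norm_fredholmDet_sub_le (hK : BddKernel K M) {a₁ a₂ b₁ b₂ : ℝ}
    (h : |b₁ - a₁| + |b₂ - a₂| ≤ 1) :
    ‖fredholmDet K b₁ b₂ - fredholmDet K a₁ a₂ +
      ((∫ z in Icc b₁ b₂, wminor K (ind a₁ a₂) z z) - ∫ z in Icc a₁ a₂, wminor K (ind a₁ a₂) z z)‖ ≤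
      (|b₁ - a₁| + |b₂ - a₂|) ^ 2 * detBound M |a₂ - a₁| := by
  have key := hK.norm_wdet_add_sub_le (integrable_ind a₁ a₂)
    ((integrable_ind b₁ b₂).sub (integrable_ind a₁ a₂)) (integral_norm_ind_le a₁ a₂)
    (integral_norm_ind_sub_le a₁ a₂ b₁ b₂) h
  have hc : Continuous fun z => wminor K (ind a₁ a₂) z z :=
    (hK.continuous_wminor (integrable_ind a₁ a₂)).comp (f := fun z => (z, z)) (by fun_prop)
  have hint : ∀ a b : ℝ, Integrable fun z => ind a b z * wminor K (ind a₁ a₂) z z := fun a b =>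
    (integrable_ind a b).mul_bdd hc.aestronglyMeasurable
      (Eventually.of_forall fun z => hK.norm_wminor_le (integrable_ind a₁ a₂) z z)
  simp only [Pi.sub_apply, sub_add_cancel, sub_mul] at key
  rw [integral_sub (hint _ _) (hint _ _), integral_ind_mul, integral_ind_mul] at key
  simpa only [fredholmDet_eq_wdet] using! key

theorem BddKernel.continuous_fredholmDet (hK : BddKernel K M) :
    Continuous fun a : Fin 2 → ℝ => fredholmDet K (a 0) (a 1) := by
  refine continuous_iff_continuousAt.2 fun a => ?_
  rw [ContinuousAt, tendsto_iff_norm_sub_tendsto_zero]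
  set C₁ := ∑' n, minorBound M (∫ x, ‖ind (a 0) (a 1) x‖) n
  set C₂ := detBound M |a 1 - a 0|
  set ε : (Fin 2 → ℝ) → ℝ := fun b => |b 0 - a 0| + |b 1 - a 1| with hε
  have hεc : Continuous ε := by fun_prop
  have hε0 : Tendsto ε (𝓝 a) (𝓝 0) := by
    have := hεc.tendsto a
    simpa [hε] using this
  have hlim : Tendsto (fun b => ε b ^ 2 * C₂ + C₁ * ε b) (𝓝 a) (𝓝 0) := by
    have := ((hε0.pow 2).mul_const C₂).add (hε0.const_mul C₁)
    simpa using this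
  refine squeeze_zero' (Eventually.of_forall fun _ => norm_nonneg _) ?_ hlim
  filter_upwards [hε0.eventually_le_const zero_lt_one] with b hb
  have h1 := hK.norm_fredholmDet_sub_le hb
  have hg := integrable_ind (a 0) (a 1)
  have hc : Continuous fun z => wminor K (ind (a 0) (a 1)) z z :=
    (hK.continuous_wminor hg).comp (f := fun z => (z, z)) (by fun_prop)
  have hint : ∀ a' b' : ℝ, Integrable fun z => ind a' b' z * wminor K (ind (a 0) (a 1)) z z :=
    fun a b => (integrable_ind a b).mul_bdd hc.aestronglyMeasurable
      (Eventually.of_forall fun z => hK.norm_wminor_le hg z z)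
  have h2 : ‖(∫ z in Icc (b 0) (b 1), wminor K (ind (a 0) (a 1)) z z) -
      ∫ z in Icc (a 0) (a 1), wminor K (ind (a 0) (a 1)) z z‖ ≤ C₁ * ε b := by
    rw [← integral_ind_mul, ← integral_ind_mul, ← integral_sub (hint _ _) (hint _ _)]
    have hC1 : 0 ≤ C₁ := (norm_nonneg _).trans (hK.norm_wminor_le hg 0 0)
    refine le_trans ?_ (mul_le_mul_of_nonneg_left
      (integral_norm_ind_sub_le (a 0) (a 1) (b 0) (b 1)) hC1)
    rw [← integral_const_mul]
    refine norm_integral_le_of_norm_le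
      (((integrable_ind _ _).sub (integrable_ind _ _)).norm.const_mul C₁)
      (Eventually.of_forall fun z => ?_)
    rw [← sub_mul, norm_mul, mul_comm]
    exact mul_le_mul_of_nonneg_right (hK.norm_wminor_le hg z z) (norm_nonneg _)
  have h3 := norm_sub_le (fredholmDet K (b 0) (b 1) - fredholmDet K (a 0) (a 1) +
    ((∫ z in Icc (b 0) (b 1), wminor K (ind (a 0) (a 1)) z z) -
      ∫ z in Icc (a 0) (a 1), wminor K (ind (a 0) (a 1)) z z))
    ((∫ z in Icc (b 0) (b 1), wminor K (ind (a 0) (a 1)) z z) -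
      ∫ z in Icc (a 0) (a 1), wminor K (ind (a 0) (a 1)) z z)
  rw [add_sub_cancel_right] at h3
  exact h3.trans (add_le_add h1 h2)

/-! ### Derivative of the determinant in an endpoint -/

theorem hasDerivAt_of_norm_le_sq {f F : ℝ → ℂ} {s C : ℝ} {σ : ℂ} (hF : Continuous F)
    (h : ∀ᶠ t in 𝓝 s, ‖f t - f s + σ * ∫ z in s..t, F z‖ ≤ C * |t - s| ^ 2) :
    HasDerivAt f (-(σ * F s)) s := by
  have h1 : HasDerivAt (fun t => σ * ∫ z in s..t, F z) (σ * F s) s :=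
    (intervalIntegral.integral_hasDerivAt_right (hF.intervalIntegrable _ _)
      hF.aestronglyMeasurable.stronglyMeasurableAtFilter hF.continuousAt).const_mul σ
  have h2 : HasDerivAt (fun t => f t - f s + σ * ∫ z in s..t, F z) 0 s := by
    rw [hasDerivAt_iff_isLittleO]
    have hO : (fun t => f t - f s + σ * ∫ z in s..t, F z) =O[𝓝 s] fun t => (t - s) ^ 2 := by
      refine Asymptotics.IsBigO.of_bound C ?_
      filter_upwards [h] with t ht
      rwa [norm_pow, Real.norm_eq_abs]
    have ho : (fun t : ℝ => (t - s) ^ 2) =o[𝓝 s] fun t => t - s := by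
      have h3 : Tendsto (fun t : ℝ => t - s) (𝓝 s) (𝓝 0) := by
        have : Continuous fun t : ℝ => t - s := by fun_prop
        simpa using this.tendsto s
      have := (Asymptotics.isLittleO_pow_id (𝕜 := ℝ) one_lt_two).comp_tendsto h3
      exact this
    simpa using hO.trans_isLittleO ho
  have h4 := (h2.sub h1).add_const (f s)
  refine (h4.congr_deriv (by ring)).congr_of_eventuallyEq (Eventually.of_forall fun t => ?_)
  simp only [Pi.sub_apply]
  ring

theorem setIntegral_Icc_eq {a₁ a₂ : ℝ} (h : a₁ ≤ a₂) (f : ℝ → ℂ) :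
    ∫ z in Icc a₁ a₂, f z = ∫ z in a₁..a₂, f z := by
  rw [integral_Icc_eq_integral_Ioc, intervalIntegral.integral_of_le h]

theorem eventually_update_lt {a : Fin 2 → ℝ} (h : a 0 < a 1) (k : Fin 2) :
    ∀ᶠ t in 𝓝 (a k), Function.update a k t 0 < Function.update a k t 1 := by
  have h1 : Continuous fun t : ℝ => Function.update a k t := by fun_prop
  have h2 : IsOpen {a : Fin 2 → ℝ | a 0 < a 1} := isOpen_lt (by fun_prop) (by fun_prop)
  have := h1.tendsto (a k)
  rw [Function.update_eq_self] at this
  exact this.eventually (h2.mem_nhds h)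

/-- Moving one endpoint of an interval changes an integral over it by an integral between the
endpoints. -/
theorem setIntegral_update_sub {a : Fin 2 → ℝ} (h : a 0 < a 1) {k : Fin 2} {t : ℝ}
    (ht : Function.update a k t 0 < Function.update a k t 1) {F : ℝ → ℂ} (hF : Continuous F) :
    (∫ z in Icc (Function.update a k t 0) (Function.update a k t 1), F z) -
      ∫ z in Icc (a 0) (a 1), F z = sgn k * ∫ z in (a k)..t, F z := by
  rw [setIntegral_Icc_eq ht.le, setIntegral_Icc_eq h.le]
  have hi : ∀ x y : ℝ, IntervalIntegrable F volume x y := fun x y => hF.intervalIntegrable x y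
  fin_cases k
  · simp only [Fin.zero_eta, Function.update_self, ne_eq, one_ne_zero, not_false_eq_true,
      Function.update_of_ne, sgn]
    rw [intervalIntegral.integral_interval_sub_interval_comm (hi _ _) (hi _ _) (hi _ _)]
    rw [intervalIntegral.integral_symm]
    simp
  · simp only [Fin.mk_one, Function.update_self, ne_eq, zero_ne_one, not_false_eq_true,
      Function.update_of_ne, sgn]
    rw [intervalIntegral.integral_interval_sub_left (hi _ _) (hi _ _)]
    simp

theorem BddKernel.hasPartial_fredholmDet (hK : BddKernel K M) {a : Fin 2 → ℝ} (h : a 0 < a 1)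
    (k : Fin 2) :
    HasPartial (fun a => fredholmDet K (a 0) (a 1)) k
      (-(sgn k * wminor K (ind (a 0) (a 1)) (a k) (a k))) a := by
  have hc : Continuous fun z => wminor K (ind (a 0) (a 1)) z z :=
    (hK.continuous_wminor (integrable_ind _ _)).comp (f := fun z => (z, z)) (by fun_prop)
  refine hasDerivAt_of_norm_le_sq (F := fun z => wminor K (ind (a 0) (a 1)) z z) (C := detBound M |a 1 - a 0|) hc ?_
  have h1 : ∀ᶠ t in 𝓝 (a k), |t - a k| ≤ 1 := by
    have : Continuous fun t : ℝ => |t - a k| := by fun_prop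
    have := this.tendsto (a k)
    rw [sub_self, abs_zero] at this
    exact this.eventually_le_const zero_lt_one
  filter_upwards [h1, eventually_update_lt h k] with t ht1 ht
  have hs : |Function.update a k t 0 - a 0| + |Function.update a k t 1 - a 1| = |t - a k| := by
    fin_cases k <;> simp
  rw [← setIntegral_update_sub h ht hc, Function.update_eq_self, mul_comm, ← hs]
  exact hK.norm_fredholmDet_sub_le (hs.trans_le ht1)

end ExpTW

end

noncomputable section

namespace ExpTW

/-! ### The resolvent -/

variable {K A B : ℝ → ℝ → ℂ} {M M' : ℝ} {f g h : ℝ → ℂ} {a₁ a₂ : ℝ}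

theorem BddKernel.contKernel (hK : BddKernel K M) (a₁ a₂ : ℝ) : ContKernel K a₁ a₂ :=
  hK.cont.continuousOn

theorem memLp_of_continuous (hg : Continuous g) (a₁ a₂ : ℝ) : MemLp g 2 (vol a₁ a₂) := by
  obtain ⟨C, hC⟩ := isCompact_Icc.exists_bound_of_continuousOn (s := Icc a₁ a₂) hg.continuousOn
  refine MemLp.of_bound hg.aestronglyMeasurable C ?_
  filter_upwards [ae_restrict_mem measurableSet_Icc] with x hx using hC x hx

theorem integrable_of_continuous (hg : Continuous g) (a₁ a₂ : ℝ) : Integrable g (vol a₁ a₂) :=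
  (memLp_of_continuous hg a₁ a₂).integrable (by norm_num)

theorem toL2_coe (hg : Continuous g) (a₁ a₂ : ℝ) :
    (toL2 a₁ a₂ g : ℝ → ℂ) =ᵐ[vol a₁ a₂] g := by
  rw [toL2, dif_pos (memLp_of_continuous hg a₁ a₂)]
  exact MemLp.coeFn_toLp _

theorem intOp_coe (hK : ContKernel K a₁ a₂) (f : L2 a₁ a₂) :
    (intOp K a₁ a₂ f : ℝ → ℂ) =ᵐ[vol a₁ a₂] fun x => ∫ y in Icc a₁ a₂, K x y * f y := by
  rw [intOp, dif_pos hK]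
  exact (hK.memLp f).coeFn_toLp

theorem BddKernel.continuous_left (hK : BddKernel K M) (x : ℝ) : Continuous fun y => K x y :=
  hK.cont.comp (f := fun y => (x, y)) (by fun_prop)

theorem BddKernel.continuous_right (hK : BddKernel K M) (y : ℝ) : Continuous fun x => K x y :=
  hK.cont.comp (f := fun x => (x, y)) (by fun_prop)

theorem BddKernel.integrable_mul (hK : BddKernel K M) (hf : Integrable f (vol a₁ a₂)) (x : ℝ) :
    Integrable (fun y => K x y * f y) (vol a₁ a₂) :=
  hf.bdd_mul (c := M) (hK.continuous_left x).aestronglyMeasurable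
    (Eventually.of_forall fun y => hK.bound x y)

theorem BddKernel.continuous_integral (hK : BddKernel K M) (hf : Integrable f (vol a₁ a₂)) :
    Continuous fun x => ∫ y in Icc a₁ a₂, K x y * f y :=
  continuous_of_dominated (bound := fun y => M * ‖f y‖)
    (fun x => (hK.integrable_mul hf x).aestronglyMeasurable)
    (fun x => Eventually.of_forall fun y => by
      rw [norm_mul]
      exact mul_le_mul_of_nonneg_right (hK.bound x y) (norm_nonneg _))
    (hf.norm.const_mul M)
    (Eventually.of_forall fun y => (hK.continuous_right y).mul continuous_const)

/-- Associativity of the composition of integral operators. -/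
theorem BddKernel.integral_comp (hA : BddKernel A M) (hB : BddKernel B M')
    (hf : Integrable f (vol a₁ a₂)) (x : ℝ) :
    ∫ z in Icc a₁ a₂, A x z * ∫ y in Icc a₁ a₂, B z y * f y =
      ∫ y in Icc a₁ a₂, (∫ z in Icc a₁ a₂, A x z * B z y) * f y := by
  have hint : Integrable (Function.uncurry fun z y => A x z * B z y * f y)
      ((vol a₁ a₂).prod (vol a₁ a₂)) := by
    have h1 : Integrable (fun p : ℝ × ℝ => f p.2) ((vol a₁ a₂).prod (vol a₁ a₂)) := hf.comp_snd _
    refine h1.bdd_mul (c := M * M') (f := fun p : ℝ × ℝ => A x p.1 * B p.1 p.2) ?_ ?_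
    · exact (((hA.continuous_left x).comp continuous_fst).mul hB.cont).aestronglyMeasurable
    · refine Eventually.of_forall fun p => ?_
      rw [norm_mul]
      exact mul_le_mul (hA.bound _ _) (hB.bound _ _) (norm_nonneg _) hA.nonneg
  calc ∫ z in Icc a₁ a₂, A x z * ∫ y in Icc a₁ a₂, B z y * f y
      = ∫ z in Icc a₁ a₂, ∫ y in Icc a₁ a₂, A x z * B z y * f y := by
        congr 1
        funext z
        rw [← integral_const_mul]
        simp only [mul_assoc]
    _ = ∫ y in Icc a₁ a₂, ∫ z in Icc a₁ a₂, A x z * B z y * f y := integral_integral_swap hint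
    _ = _ := by
        congr 1
        funext y
        rw [← integral_mul_const]

/-- The resolvent kernel. -/
def rker (K : ℝ → ℝ → ℂ) (a₁ a₂ x y : ℝ) : ℂ :=
  wminor K (ind a₁ a₂) x y / fredholmDet K a₁ a₂

/-- A bound for the first Fredholm minor. -/
def minorSum (M L : ℝ) : ℝ := ∑' n, minorBound M L n

theorem BddKernel.norm_wminor_ind_le (hK : BddKernel K M) {L : ℝ} (hL : |a₂ - a₁| ≤ L) (x y : ℝ) :
    ‖wminor K (ind a₁ a₂) x y‖ ≤ minorSum M L := by
  have hM := hK.nonneg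
  have h0 : 0 ≤ ∫ x, ‖ind a₁ a₂ x‖ := integral_nonneg fun _ => norm_nonneg _
  have hL0 := (abs_nonneg _).trans hL
  refine (hK.norm_wminor_le (integrable_ind a₁ a₂) x y).trans ?_
  refine (summable_minorBound hM h0).tsum_le_tsum (fun n => ?_) (summable_minorBound hM hL0)
  simp only [minorBound]
  gcongr
  exact (integral_norm_ind_le a₁ a₂).trans hL

theorem BddKernel.bddKernel_rker (hK : BddKernel K M) (a₁ a₂ : ℝ) :
    BddKernel (rker K a₁ a₂) (minorSum M |a₂ - a₁| / ‖fredholmDet K a₁ a₂‖) where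
  cont := (hK.continuous_wminor (integrable_ind a₁ a₂)).div_const _
  bound x y := by
    rw [rker, norm_div]
    have := hK.norm_wminor_ind_le (le_refl |a₂ - a₁|) x y
    gcongr

/-- Fredholm's identity divided by the determinant, that is R = K + KR. Its mirror image `rker_eq'`,
R = K + RK, is needed too, for a two-sided inverse. -/
theorem BddKernel.rker_eq (hK : BddKernel K M) (hD : fredholmDet K a₁ a₂ ≠ 0) (x y : ℝ) :
    rker K a₁ a₂ x y = K x y + ∫ z in Icc a₁ a₂, K x z * rker K a₁ a₂ z y := by
  have h := hK.wminor_eq (integrable_ind a₁ a₂) x y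
  have e : ∫ z, K x z * ind a₁ a₂ z * wminor K (ind a₁ a₂) z y =
      ∫ z in Icc a₁ a₂, K x z * wminor K (ind a₁ a₂) z y := by
    rw [← integral_ind_mul]
    congr 1
    funext z
    ring
  rw [e, ← fredholmDet_eq_wdet] at h
  simp only [rker, mul_div_assoc']
  rw [integral_div, h, add_div, mul_div_cancel_right₀ _ hD]

theorem BddKernel.rker_eq' (hK : BddKernel K M) (hD : fredholmDet K a₁ a₂ ≠ 0) (x y : ℝ) :
    rker K a₁ a₂ x y = K x y + ∫ z in Icc a₁ a₂, rker K a₁ a₂ x z * K z y := by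
  have h := hK.wminor_eq' (integrable_ind a₁ a₂) x y
  have e : ∫ z, wminor K (ind a₁ a₂) x z * ind a₁ a₂ z * K z y =
      ∫ z in Icc a₁ a₂, wminor K (ind a₁ a₂) x z * K z y := by
    rw [← integral_ind_mul]
    congr 1
    funext z
    ring
  rw [e, ← fredholmDet_eq_wdet] at h
  simp only [rker, div_mul_eq_mul_div]
  rw [integral_div, h, add_div, mul_div_cancel_right₀ _ hD]

theorem rker_symm (hs : ∀ x y, K x y = K y x) (x y : ℝ) : rker K a₁ a₂ x y = rker K a₁ a₂ y x := by
  have : (fun x y => K y x) = K := by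
    funext x y
    exact hs y x
  rw [rker, rker, ← wminor_swap, this]

theorem BddKernel.intOp_comp (hA : BddKernel A M) (hB : BddKernel B M') {C : ℝ → ℝ → ℂ}
    (hC : ContKernel C a₁ a₂)
    (h : ∀ x y, C x y = ∫ z in Icc a₁ a₂, A x z * B z y) :
    intOp A a₁ a₂ * intOp B a₁ a₂ = intOp C a₁ a₂ := by
  refine ContinuousLinearMap.ext fun f => Lp.ext ?_
  have h1 := intOp_coe (hA.contKernel a₁ a₂) (intOp B a₁ a₂ f)
  have h2 := intOp_coe (hB.contKernel a₁ a₂) f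
  have h3 := intOp_coe hC f
  refine h1.trans (EventuallyEq.trans (Eventually.of_forall fun x => ?_) h3.symm)
  simp only []
  rw [integral_congr_ae (g := fun z => A x z * ∫ y in Icc a₁ a₂, B z y * f y)
    (by filter_upwards [h2] with z hz; rw [hz]), hA.integral_comp hB (integrable_coe f)]
  simp only [h]

theorem intOp_sub (hA : ContKernel A a₁ a₂) (hB : ContKernel B a₁ a₂) :
    intOp (fun x y => A x y - B x y) a₁ a₂ = intOp A a₁ a₂ - intOp B a₁ a₂ := by
  refine ContinuousLinearMap.ext fun f => Lp.ext ?_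
  have h1 := intOp_coe hA f
  have h2 := intOp_coe hB f
  have h3 := intOp_coe (K := fun x y => A x y - B x y) (ContinuousOn.sub hA hB) f
  rw [sub_apply]
  filter_upwards [h1, h2, h3, Lp.coeFn_sub (intOp A a₁ a₂ f) (intOp B a₁ a₂ f),
    ae_restrict_mem measurableSet_Icc] with x e1 e2 e3 e4 hx
  rw [e3, e4, Pi.sub_apply, e1, e2, ← integral_sub (hA.integrable f hx) (hB.integrable f hx)]
  congr 1
  funext y
  ring

theorem BddKernel.sub_mul_add (hK : BddKernel K M) (hD : fredholmDet K a₁ a₂ ≠ 0) :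
    (1 - intOp K a₁ a₂) * (1 + intOp (rker K a₁ a₂) a₁ a₂) = 1 ∧
      (1 + intOp (rker K a₁ a₂) a₁ a₂) * (1 - intOp K a₁ a₂) = 1 := by
  have hR := hK.bddKernel_rker a₁ a₂
  have hC : ContKernel (fun x y => rker K a₁ a₂ x y - K x y) a₁ a₂ :=
    (hR.cont.sub hK.cont).continuousOn
  have h1 := hK.intOp_comp hR hC fun x y => by rw [hK.rker_eq hD x y]; ring
  have h2 := hR.intOp_comp hK hC fun x y => by rw [hK.rker_eq' hD x y]; ring
  rw [intOp_sub (hR.contKernel _ _) (hK.contKernel _ _)] at h1 h2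
  constructor
  · rw [sub_mul, mul_add, mul_add, h1]
    simp
  · rw [add_mul, mul_sub, mul_sub, h2]
    simp

theorem BddKernel.isUnit_one_sub (hK : BddKernel K M) (hD : fredholmDet K a₁ a₂ ≠ 0) :
    IsUnit (1 - intOp K a₁ a₂) :=
  ⟨⟨_, _, (hK.sub_mul_add hD).1, (hK.sub_mul_add hD).2⟩, rfl⟩

theorem BddKernel.inverse_one_sub (hK : BddKernel K M) (hD : fredholmDet K a₁ a₂ ≠ 0) :
    Ring.inverse (1 - intOp K a₁ a₂) = 1 + intOp (rker K a₁ a₂) a₁ a₂ :=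
  Ring.inverse_unit ⟨_, _, (hK.sub_mul_add hD).1, (hK.sub_mul_add hD).2⟩

/-- The inverse is 1 + R, so `resolve` is g + K(g + Rg), and K + KR = R. The formula holds at every
real x, also outside I, and no longer mentions classes in L². -/
theorem BddKernel.resolve_eq (hK : BddKernel K M) (hD : fredholmDet K a₁ a₂ ≠ 0)
    (hg : Continuous g) (x : ℝ) :
    resolve K a₁ a₂ g x = g x + ∫ y in Icc a₁ a₂, rker K a₁ a₂ x y * g y := by
  have hR := hK.bddKernel_rker a₁ a₂
  have hgi := integrable_of_continuous hg a₁ a₂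
  have hRg : Integrable (fun y => ∫ z in Icc a₁ a₂, rker K a₁ a₂ y z * g z) (vol a₁ a₂) :=
    integrable_of_continuous (hR.continuous_integral hgi) a₁ a₂
  have hae : (Ring.inverse (1 - intOp K a₁ a₂) (toL2 a₁ a₂ g) : ℝ → ℂ) =ᵐ[vol a₁ a₂]
      fun y => g y + ∫ z in Icc a₁ a₂, rker K a₁ a₂ y z * g z := by
    rw [hK.inverse_one_sub hD, add_apply, one_apply_eq_self]
    filter_upwards [Lp.coeFn_add (toL2 a₁ a₂ g) (intOp (rker K a₁ a₂) a₁ a₂ (toL2 a₁ a₂ g)),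
      intOp_coe (hR.contKernel a₁ a₂) (toL2 a₁ a₂ g), toL2_coe hg a₁ a₂] with y h1 h2 h3
    rw [h1, Pi.add_apply, h2, h3]
    congr 1
    refine integral_congr_ae ?_
    filter_upwards [toL2_coe hg a₁ a₂] with z hz
    rw [hz]
  rw [resolve, integral_congr_ae (g := fun y => K x y * g y + K x y *
    ∫ z in Icc a₁ a₂, rker K a₁ a₂ y z * g z)
    (by filter_upwards [hae] with y hy; rw [hy, mul_add]),
    integral_add (hK.integrable_mul hgi x) (hK.integrable_mul hRg x), hK.integral_comp hR hgi,
    ← integral_add (hK.integrable_mul hgi x)]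
  · congr 2
    funext y
    rw [hK.rker_eq hD x y]
    ring
  · have : ∀ y, ∫ z in Icc a₁ a₂, K x z * rker K a₁ a₂ z y =
        rker K a₁ a₂ x y - K x y := fun y => by rw [hK.rker_eq hD x y]; ring
    simp only [this, sub_mul]
    exact (hR.integrable_mul hgi x).sub (hK.integrable_mul hgi x)

theorem BddKernel.continuous_resolve (hK : BddKernel K M) (hD : fredholmDet K a₁ a₂ ≠ 0)
    (hg : Continuous g) : Continuous (resolve K a₁ a₂ g) := by
  have : resolve K a₁ a₂ g = fun x => g x + ∫ y in Icc a₁ a₂, rker K a₁ a₂ x y * g y :=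
    funext fun x => hK.resolve_eq hD hg x
  rw [this]
  exact hg.add ((hK.bddKernel_rker a₁ a₂).continuous_integral (integrable_of_continuous hg a₁ a₂))

/-- A solution of `h = g + 𝕂_I h` on `I` is `(𝕀 - 𝕂_I)⁻¹ g`. -/
theorem BddKernel.resolve_eq_of_fixed (hK : BddKernel K M) (hD : fredholmDet K a₁ a₂ ≠ 0)
    (hg : Continuous g) (hh : Continuous h)
    (he : ∀ x ∈ Icc a₁ a₂, h x = g x + ∫ y in Icc a₁ a₂, K x y * h y) (x : ℝ) :
    resolve K a₁ a₂ g x = g x + ∫ y in Icc a₁ a₂, K x y * h y := by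
  have hR := hK.bddKernel_rker a₁ a₂
  have hhi := integrable_of_continuous hh a₁ a₂
  have hKh : Integrable (fun y => ∫ z in Icc a₁ a₂, K y z * h z) (vol a₁ a₂) :=
    integrable_of_continuous (hK.continuous_integral hhi) a₁ a₂
  rw [hK.resolve_eq hD hg]
  congr 1
  -- On I one has g = h - Kh, so Rg = (R - RK)h = Kh. The fixed point equation is known on I only
  -- while x is arbitrary; hence the value g(x) + (Kh)(x) instead of h(x).
  have h1 : ∫ y in Icc a₁ a₂, rker K a₁ a₂ x y * g y =
      ∫ y in Icc a₁ a₂, (rker K a₁ a₂ x y * h y - rker K a₁ a₂ x y *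
        ∫ z in Icc a₁ a₂, K y z * h z) := by
    refine setIntegral_congr_fun measurableSet_Icc fun y hy => ?_
    rw [← mul_sub, he y hy, add_sub_cancel_right]
  have h2 : ∀ y, ∫ z in Icc a₁ a₂, rker K a₁ a₂ x z * K z y =
      rker K a₁ a₂ x y - K x y := fun y => by rw [hK.rker_eq' hD x y]; ring
  rw [h1, integral_sub (hR.integrable_mul hhi x) (hR.integrable_mul hKh x),
    hR.integral_comp hK hhi]
  simp only [h2, sub_mul]
  rw [integral_sub (hR.integrable_mul hhi x) (hK.integrable_mul hhi x)]
  ring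

theorem BddKernel.resolve_fixed (hK : BddKernel K M) (hD : fredholmDet K a₁ a₂ ≠ 0)
    (hg : Continuous g) (x : ℝ) :
    resolve K a₁ a₂ g x = g x + ∫ y in Icc a₁ a₂, K x y * resolve K a₁ a₂ g y := by
  have hR := hK.bddKernel_rker a₁ a₂
  have hgi := integrable_of_continuous hg a₁ a₂
  have hRg : Integrable (fun y => ∫ z in Icc a₁ a₂, rker K a₁ a₂ y z * g z) (vol a₁ a₂) :=
    integrable_of_continuous (hR.continuous_integral hgi) a₁ a₂
  have h2 : ∀ y, ∫ z in Icc a₁ a₂, K x z * rker K a₁ a₂ z y =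
      rker K a₁ a₂ x y - K x y := fun y => by rw [hK.rker_eq hD x y]; ring
  simp only [hK.resolve_eq hD hg, mul_add]
  rw [integral_add (hK.integrable_mul hgi x) (hK.integrable_mul hRg x), hK.integral_comp hR hgi]
  simp only [h2, sub_mul]
  rw [integral_sub (hR.integrable_mul hgi x) (hK.integrable_mul hgi x)]
  ring

theorem BddKernel.resolve_kernel (hK : BddKernel K M) (hD : fredholmDet K a₁ a₂ ≠ 0) (x y : ℝ) :
    resolve K a₁ a₂ (fun z => K z y) x = rker K a₁ a₂ x y := by
  rw [hK.resolve_eq hD (hK.continuous_right y), hK.rker_eq' hD x y]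

theorem BddKernel.resolve_add (hK : BddKernel K M) (hD : fredholmDet K a₁ a₂ ≠ 0)
    (hf : Continuous f) (hg : Continuous g) (x : ℝ) :
    resolve K a₁ a₂ (fun x => f x + g x) x = resolve K a₁ a₂ f x + resolve K a₁ a₂ g x := by
  have hR := hK.bddKernel_rker a₁ a₂
  rw [hK.resolve_eq hD (hf.fun_add hg), hK.resolve_eq hD hf, hK.resolve_eq hD hg]
  simp only [mul_add]
  rw [integral_add (hR.integrable_mul (integrable_of_continuous hf a₁ a₂) x)
    (hR.integrable_mul (integrable_of_continuous hg a₁ a₂) x)]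
  ring

theorem BddKernel.resolve_const_mul (hK : BddKernel K M) (hD : fredholmDet K a₁ a₂ ≠ 0)
    (c : ℂ) (hg : Continuous g) (x : ℝ) :
    resolve K a₁ a₂ (fun x => c * g x) x = c * resolve K a₁ a₂ g x := by
  rw [hK.resolve_eq hD (continuous_const.fun_mul hg), hK.resolve_eq hD hg]
  simp only [mul_left_comm _ c]
  rw [integral_const_mul]
  ring

theorem BddKernel.resolve_sum (hK : BddKernel K M) (hD : fredholmDet K a₁ a₂ ≠ 0)
    {ι : Type*} (s : Finset ι) (c : ι → ℂ) {F : ι → ℝ → ℂ} (hF : ∀ i, Continuous (F i)) (x : ℝ) :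
    resolve K a₁ a₂ (fun x => ∑ i ∈ s, c i * F i x) x =
      ∑ i ∈ s, c i * resolve K a₁ a₂ (F i) x := by
  classical
  induction s using Finset.induction_on with
  | empty =>
    simp only [Finset.sum_empty]
    rw [hK.resolve_eq hD continuous_const]
    simp
  | insert i s hi ih =>
    simp only [Finset.sum_insert hi]
    rw [hK.resolve_add hD (continuous_const.fun_mul (hF i))
      (continuous_finsetSum _ fun j _ => continuous_const.fun_mul (hF j)),
      hK.resolve_const_mul hD _ (hF i), ih]

/-- The resolvent of a symmetric kernel is symmetric. -/
theorem BddKernel.integral_mul_resolve (hK : BddKernel K M) (hD : fredholmDet K a₁ a₂ ≠ 0)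
    (hs : ∀ x y, K x y = K y x) (hf : Continuous f) (hg : Continuous g) :
    ∫ x in Icc a₁ a₂, f x * resolve K a₁ a₂ g x = ∫ x in Icc a₁ a₂, g x * resolve K a₁ a₂ f x := by
  have hR := hK.bddKernel_rker a₁ a₂
  have hfi := integrable_of_continuous hf a₁ a₂
  have hgi := integrable_of_continuous hg a₁ a₂
  have hprod : Integrable (Function.uncurry fun x y => f x * (rker K a₁ a₂ x y * g y))
      ((vol a₁ a₂).prod (vol a₁ a₂)) := by
    have h1 : Integrable (fun p : ℝ × ℝ => f p.1 * g p.2) ((vol a₁ a₂).prod (vol a₁ a₂)) :=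
      hfi.mul_prod hgi
    refine (h1.bdd_mul hR.cont.aestronglyMeasurable
      (Eventually.of_forall fun p => hR.bound p.1 p.2)).congr (Eventually.of_forall fun p => ?_)
    simp only [Function.uncurry]
    ring
  have hRc : ∀ {u : ℝ → ℂ}, Continuous u →
      Continuous fun x => ∫ y in Icc a₁ a₂, rker K a₁ a₂ x y * u y :=
    fun hu => hR.continuous_integral (integrable_of_continuous hu a₁ a₂)
  simp only [hK.resolve_eq hD hf, hK.resolve_eq hD hg, mul_add]
  rw [integral_add (integrable_of_continuous (hf.fun_mul hg) a₁ a₂)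
    (integrable_of_continuous (hf.fun_mul (hRc hg)) a₁ a₂),
    integral_add (integrable_of_continuous (hg.fun_mul hf) a₁ a₂)
    (integrable_of_continuous (hg.fun_mul (hRc hf)) a₁ a₂)]
  congr 1
  · simp only [mul_comm]
  · simp only [← integral_const_mul]
    rw [integral_integral_swap hprod]
    congr 1
    funext y
    congr 1
    funext x
    rw [rker_symm hs x y]
    ring

end ExpTW

end

noncomputable section

namespace ExpTW

/-! ### The resolvent as a function of the endpoints -/

variable {K : ℝ → ℝ → ℂ} {M G : ℝ} {f g : ℝ → ℂ} {a₁ a₂ : ℝ} {a : Fin 2 → ℝ} {k : Fin 2}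

theorem integral_intervalIntegral_swap {F : ℝ → ℝ → ℂ} (hF : Continuous (Function.uncurry F))
    (a₁ a₂ s t : ℝ) :
    ∫ y in Icc a₁ a₂, ∫ z in s..t, F y z = ∫ z in s..t, ∫ y in Icc a₁ a₂, F y z := by
  simp only [intervalIntegral.intervalIntegral_eq_integral_uIoc]
  rw [integral_smul]
  congr 1
  refine integral_integral_swap ?_
  rw [Measure.prod_restrict]
  refine IntegrableOn.mono_set ?_ (prod_mono_right (t₂ := uIcc s t) uIoc_subset_uIcc)
  exact hF.continuousOn.integrableOn_compact (isCompact_Icc.prod isCompact_uIcc)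

theorem continuous_uncurry_mul {A : ℝ → ℝ → ℂ} (hA : Continuous (Function.uncurry A))
    (hf : Continuous f) : Continuous (Function.uncurry fun y z => A y z * f z) :=
  hA.mul (hf.comp continuous_snd)

/-- The solution H for the moved interval solves an equation on the old one, with the integral of KH
over the sliver added to g. Applying 1 + R to this extra term replaces K by K + RK = R under the
integral. -/
theorem BddKernel.resolve_update_sub (hK : BddKernel K M) (ha : a 0 < a 1) {t : ℝ}
    (ht : Function.update a k t 0 < Function.update a k t 1)
    (hD : fredholmDet K (a 0) (a 1) ≠ 0)
    (hDt : fredholmDet K (Function.update a k t 0) (Function.update a k t 1) ≠ 0)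
    (hg : Continuous g) (x : ℝ) :
    resolve K (Function.update a k t 0) (Function.update a k t 1) g x -
      resolve K (a 0) (a 1) g x = sgn k * ∫ y in (a k)..t, rker K (a 0) (a 1) x y *
        resolve K (Function.update a k t 0) (Function.update a k t 1) g y := by
  set H := resolve K (Function.update a k t 0) (Function.update a k t 1) g with hH
  have hHc : Continuous H := hK.continuous_resolve hDt hg
  have hR := hK.bddKernel_rker (a 0) (a 1)
  have hKH : Continuous (Function.uncurry fun y z => K y z * H z) :=
    continuous_uncurry_mul hK.cont hHc
  set c : ℝ → ℂ := fun x => ∫ y in (a k)..t, K x y * H y with hc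
  have hcc : Continuous c :=
    intervalIntegral.continuous_parametric_intervalIntegral_of_continuous' hKH _ _
  have hsplit : ∀ x, H x = (g x + sgn k * c x) + ∫ y in Icc (a 0) (a 1), K x y * H y := by
    intro x
    have h1 : H x = g x + ∫ y in Icc (Function.update a k t 0) (Function.update a k t 1),
        K x y * H y := hK.resolve_fixed hDt hg x
    have h2 := setIntegral_update_sub ha ht ((hK.continuous_left x).fun_mul hHc)
    rw [h1, hc]
    linear_combination h2
  have h1 := hK.resolve_eq_of_fixed hD (hg.fun_add (continuous_const.fun_mul hcc)) hHc
    (fun x _ => hsplit x) x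
  have h2 : H x = resolve K (a 0) (a 1) (fun x => g x + sgn k * c x) x := by rw [h1, ← hsplit]
  have h3 : ∫ y in Icc (a 0) (a 1), rker K (a 0) (a 1) x y * c y =
      ∫ z in (a k)..t, (∫ y in Icc (a 0) (a 1), rker K (a 0) (a 1) x y * K y z) * H z := by
    have hF : Continuous (Function.uncurry fun y z => rker K (a 0) (a 1) x y * (K y z * H z)) :=
      ((hR.continuous_left x).comp continuous_fst).mul hKH
    have := integral_intervalIntegral_swap hF (a 0) (a 1) (a k) t
    simp only [intervalIntegral.integral_const_mul] at this
    rw [hc, this]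
    congr 1
    funext z
    rw [← integral_mul_const]
    simp only [mul_assoc]
  have h4 : ∀ z, ∫ y in Icc (a 0) (a 1), rker K (a 0) (a 1) x y * K y z =
      rker K (a 0) (a 1) x z - K x z := fun z => by rw [hK.rker_eq' hD x z]; ring
  rw [h2, hK.resolve_add hD hg (continuous_const.fun_mul hcc), hK.resolve_const_mul hD _ hcc,
    hK.resolve_eq hD hcc, h3]
  simp only [h4, sub_mul, hc]
  rw [intervalIntegral.integral_sub
    (((hR.continuous_left x).fun_mul hHc).intervalIntegrable _ _)
    (((hK.continuous_left x).fun_mul hHc).intervalIntegrable _ _)]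
  ring

/-- The integrand depends on t too, but over [s, t] it is within ε of its limit at (s, s); no
differentiability in t is required. -/
theorem hasDerivAt_intervalIntegral_diag {F : ℝ → ℝ → ℂ} {s : ℝ} {c : ℂ}
    (hF : ∀ᶠ t in 𝓝 s, Continuous (F t))
    (hlim : Tendsto (fun p : ℝ × ℝ => F p.1 p.2) (𝓝 (s, s)) (𝓝 c)) :
    HasDerivAt (fun t => ∫ y in s..t, F t y) c s := by
  rw [hasDerivAt_iff_isLittleO, Asymptotics.isLittleO_iff]
  intro ε hε
  obtain ⟨δ, hδ, hball⟩ := Metric.mem_nhds_iff.1 (hlim (Metric.closedBall_mem_nhds c hε))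
  filter_upwards [hF, Metric.ball_mem_nhds s hδ] with t htc ht
  have h1 : (∫ y in s..t, F t y) - (∫ y in s..s, F s y) - (t - s) • c =
      ∫ y in s..t, (F t y - c) := by
    rw [intervalIntegral.integral_sub (htc.intervalIntegrable _ _)
      (continuous_const.intervalIntegrable _ _), intervalIntegral.integral_const]
    simp
  rw [h1, Real.norm_eq_abs]
  refine intervalIntegral.norm_integral_le_of_norm_le_const fun y hy => ?_
  have hy1 : |y - s| ≤ |t - s| := abs_sub_left_of_mem_uIcc (uIoc_subset_uIcc hy)
  have hmem : (t, y) ∈ Metric.ball (s, s) δ := by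
    rw [Metric.mem_ball, Prod.dist_eq]
    rw [Metric.mem_ball, Real.dist_eq] at ht
    exact max_lt ht (lt_of_le_of_lt hy1 ht)
  have := hball hmem
  rwa [mem_preimage, mem_closedBall_iff_norm] at this

theorem BddKernel.eventually_fredholmDet_ne_zero (hK : BddKernel K M) (k : Fin 2)
    (hD : fredholmDet K (a 0) (a 1) ≠ 0) :
    ∀ᶠ t in 𝓝 (a k), ‖fredholmDet K (a 0) (a 1)‖ / 2 <
      ‖fredholmDet K (Function.update a k t 0) (Function.update a k t 1)‖ := by
  have h1 : Continuous fun t : ℝ => Function.update a k t := by fun_prop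
  have h2 := ((hK.continuous_fredholmDet.comp h1).norm).tendsto (a k)
  simp only [Function.comp_apply, Function.update_eq_self] at h2
  exact h2.eventually_const_lt (half_lt_self (norm_pos_iff.2 hD))

theorem BddKernel.exists_bound_resolve (hK : BddKernel K M) (ha : a 0 < a 1) (k : Fin 2)
    (hD : fredholmDet K (a 0) (a 1) ≠ 0) (hg : Continuous g) (hG : ∀ x, ‖g x‖ ≤ G) :
    ∃ C : ℝ, ∀ᶠ t in 𝓝 (a k), ∀ x,
      ‖resolve K (Function.update a k t 0) (Function.update a k t 1) g x‖ ≤ C := by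
  have hG0 : 0 ≤ G := (norm_nonneg _).trans (hG 0)
  -- For t near a_k the length of the interval is below L and the determinant exceeds half its value
  -- at a, so B bounds the resolvent kernel uniformly.
  set L := |a 1 - a 0| + 1 with hL
  set B := minorSum M L / (‖fredholmDet K (a 0) (a 1)‖ / 2) with hB
  refine ⟨G + B * G * L, ?_⟩
  have h1 : ∀ᶠ t in 𝓝 (a k), |Function.update a k t 1 - Function.update a k t 0| < L := by
    have h1 : Continuous fun t : ℝ => Function.update a k t := by fun_prop
    have h2 : Continuous fun b : Fin 2 → ℝ => |b 1 - b 0| := by fun_prop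
    have h3 := (h2.comp h1).tendsto (a k)
    simp only [Function.comp_apply, Function.update_eq_self] at h3
    exact h3.eventually_lt_const (lt_add_one _)
  filter_upwards [h1, hK.eventually_fredholmDet_ne_zero k hD, eventually_update_lt ha k]
    with t ht1 ht2 ht3 x
  have hDt : fredholmDet K (Function.update a k t 0) (Function.update a k t 1) ≠ 0 := by
    have : 0 < ‖fredholmDet K (a 0) (a 1)‖ := norm_pos_iff.2 hD
    exact norm_pos_iff.1 (by linarith)
  have hS : 0 ≤ minorSum M L := (norm_nonneg _).trans (hK.norm_wminor_ind_le ht1.le 0 0)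
  have hB0 : 0 ≤ B := by positivity
  have hRb : ∀ y, ‖rker K (Function.update a k t 0) (Function.update a k t 1) x y‖ ≤ B := by
    intro y
    rw [rker, norm_div, hB]
    have : 0 < ‖fredholmDet K (a 0) (a 1)‖ := norm_pos_iff.2 hD
    exact div_le_div₀ hS (hK.norm_wminor_ind_le ht1.le x y) (by positivity) ht2.le
  rw [hK.resolve_eq hDt hg]
  refine (norm_add_le _ _).trans (add_le_add (hG x) ?_)
  rw [setIntegral_Icc_eq ht3.le]
  refine (intervalIntegral.norm_integral_le_of_norm_le_const (C := B * G) fun y _ => ?_).trans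
    (mul_le_mul_of_nonneg_left ht1.le (by positivity))
  rw [norm_mul]
  exact mul_le_mul (hRb y) (hG y) (norm_nonneg _) hB0

/-- Joint convergence is needed because the endpoint and the evaluation point move together. The
sliver formula with the uniform bound gives a difference of order |t - a_k|, uniformly in the
evaluation point. -/
theorem BddKernel.tendsto_resolve_update (hK : BddKernel K M) (ha : a 0 < a 1) (k : Fin 2)
    (hD : fredholmDet K (a 0) (a 1) ≠ 0) (hg : Continuous g) (hG : ∀ x, ‖g x‖ ≤ G) :
    Tendsto (fun p : ℝ × ℝ =>
      resolve K (Function.update a k p.1 0) (Function.update a k p.1 1) g p.2)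
      (𝓝 (a k, a k)) (𝓝 (resolve K (a 0) (a 1) g (a k))) := by
  obtain ⟨C, hC⟩ := hK.exists_bound_resolve ha k hD hg hG
  have hR := hK.bddKernel_rker (a 0) (a 1)
  set B := minorSum M |a 1 - a 0| / ‖fredholmDet K (a 0) (a 1)‖
  have hev : ∀ᶠ t in 𝓝 (a k), ∀ x,
      ‖resolve K (Function.update a k t 0) (Function.update a k t 1) g x -
        resolve K (a 0) (a 1) g x‖ ≤ B * C * |t - a k| := by
    filter_upwards [hC, hK.eventually_fredholmDet_ne_zero k hD, eventually_update_lt ha k]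
      with t ht1 ht2 ht3 x
    have hDt : fredholmDet K (Function.update a k t 0) (Function.update a k t 1) ≠ 0 := by
      have : 0 < ‖fredholmDet K (a 0) (a 1)‖ := norm_pos_iff.2 hD
      exact norm_pos_iff.1 (by linarith)
    rw [hK.resolve_update_sub ha ht3 hD hDt hg, norm_mul]
    have hs : ‖sgn k‖ = 1 := by simp [sgn]
    rw [hs, one_mul]
    refine intervalIntegral.norm_integral_le_of_norm_le_const fun y _ => ?_
    rw [norm_mul]
    exact mul_le_mul (hR.bound _ _) (ht1 y) (norm_nonneg _) hR.nonneg
  have h1 : Tendsto (fun p : ℝ × ℝ => resolve K (a 0) (a 1) g p.2) (𝓝 (a k, a k))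
      (𝓝 (resolve K (a 0) (a 1) g (a k))) :=
    ((hK.continuous_resolve hD hg).comp continuous_snd).tendsto (a k, a k)
  have h2 : Tendsto (fun p : ℝ × ℝ =>
      resolve K (Function.update a k p.1 0) (Function.update a k p.1 1) g p.2 -
        resolve K (a 0) (a 1) g p.2) (𝓝 (a k, a k)) (𝓝 0) := by
    rw [tendsto_zero_iff_norm_tendsto_zero]
    refine squeeze_zero' (g := fun p : ℝ × ℝ => B * C * |p.1 - a k|)
      (Eventually.of_forall fun _ => norm_nonneg _) ?_ ?_
    · have : Tendsto Prod.fst (𝓝 (a k, a k)) (𝓝 (a k)) := continuous_fst.tendsto (a k, a k)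
      filter_upwards [this.eventually hev] with p hp using hp p.2
    · have : Continuous fun p : ℝ × ℝ => B * C * |p.1 - a k| := by fun_prop
      have := this.tendsto (a k, a k)
      simpa using this
  simpa using h2.add h1

theorem BddKernel.eventually_good (hK : BddKernel K M) (ha : a 0 < a 1) (k : Fin 2)
    (hD : fredholmDet K (a 0) (a 1) ≠ 0) :
    ∀ᶠ t in 𝓝 (a k), Function.update a k t 0 < Function.update a k t 1 ∧
      fredholmDet K (Function.update a k t 0) (Function.update a k t 1) ≠ 0 := by
  filter_upwards [hK.eventually_fredholmDet_ne_zero k hD, eventually_update_lt ha k]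
    with t ht2 ht3
  refine ⟨ht3, norm_pos_iff.1 ?_⟩
  have : 0 < ‖fredholmDet K (a 0) (a 1)‖ := norm_pos_iff.2 hD
  linarith

/-- The curve x(t) lets one computation serve both a fixed evaluation point and the moving endpoint
itself. -/
theorem BddKernel.hasDerivAt_resolve_sub (hK : BddKernel K M) (ha : a 0 < a 1) (k : Fin 2)
    (hD : fredholmDet K (a 0) (a 1) ≠ 0) (hg : Continuous g) (hG : ∀ x, ‖g x‖ ≤ G)
    {x : ℝ → ℝ} (hx : Continuous x) :
    HasDerivAt (fun t => resolve K (Function.update a k t 0) (Function.update a k t 1) g (x t) -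
      resolve K (a 0) (a 1) g (x t))
      (sgn k * (rker K (a 0) (a 1) (x (a k)) (a k) * resolve K (a 0) (a 1) g (a k))) (a k) := by
  have hR := hK.bddKernel_rker (a 0) (a 1)
  have hev := hK.eventually_good ha k hD
  have h1 := hasDerivAt_intervalIntegral_diag (s := a k)
    (F := fun t y => rker K (a 0) (a 1) (x t) y *
      resolve K (Function.update a k t 0) (Function.update a k t 1) g y)
    (c := rker K (a 0) (a 1) (x (a k)) (a k) * resolve K (a 0) (a 1) g (a k)) ?_ ?_
  · refine (h1.const_mul (sgn k)).congr_of_eventuallyEq ?_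
    filter_upwards [hev] with t ht
    exact hK.resolve_update_sub ha ht.1 hD ht.2 hg (x t)
  · filter_upwards [hev] with t ht
    exact (hR.continuous_left _).mul (hK.continuous_resolve ht.2 hg)
  · refine Tendsto.mul ?_ (hK.tendsto_resolve_update ha k hD hg hG)
    exact (hR.cont.comp ((hx.comp continuous_fst).prodMk continuous_snd)).tendsto (a k, a k)

/-- The derivative of `(𝕀 - 𝕂_I)⁻¹ g` at a fixed point with respect to an endpoint. -/
theorem BddKernel.hasPartial_resolve (hK : BddKernel K M) (ha : a 0 < a 1) (k : Fin 2)
    (hD : fredholmDet K (a 0) (a 1) ≠ 0) (hg : Continuous g) (hG : ∀ x, ‖g x‖ ≤ G) (x : ℝ) :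
    HasPartial (fun a => resolve K (a 0) (a 1) g x) k
      (sgn k * (rker K (a 0) (a 1) x (a k) * resolve K (a 0) (a 1) g (a k))) a := by
  have h := (hK.hasDerivAt_resolve_sub ha k hD hg hG (x := fun _ => x) continuous_const).add_const
    (resolve K (a 0) (a 1) g x)
  simpa only [sub_add_cancel] using! h

/-- The derivative of `(𝕀 - 𝕂_I)⁻¹ g` at an endpoint with respect to the same endpoint. -/
theorem BddKernel.hasDerivAt_resolve_endpoint (hK : BddKernel K M) (ha : a 0 < a 1) (k : Fin 2)
    (hD : fredholmDet K (a 0) (a 1) ≠ 0) (hg : Continuous g) (hG : ∀ x, ‖g x‖ ≤ G) {c : ℂ}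
    (hc : HasDerivAt (resolve K (a 0) (a 1) g) c (a k)) :
    HasDerivAt (fun t => resolve K (Function.update a k t 0) (Function.update a k t 1) g t)
      (sgn k * (rker K (a 0) (a 1) (a k) (a k) * resolve K (a 0) (a 1) g (a k)) + c) (a k) := by
  have h := (hK.hasDerivAt_resolve_sub ha k hD hg hG (x := fun t => t) continuous_id).add hc
  refine h.congr_of_eventuallyEq (Eventually.of_forall fun t => ?_)
  simp

/-- The derivative of `∫_I f (𝕀 - 𝕂_I)⁻¹ g` with respect to an endpoint. -/
theorem BddKernel.hasPartial_pairing (hK : BddKernel K M) (hs : ∀ x y, K x y = K y x)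
    (ha : a 0 < a 1) (k : Fin 2)
    (hD : fredholmDet K (a 0) (a 1) ≠ 0) (hf : Continuous f)
    (hg : Continuous g) (hG : ∀ x, ‖g x‖ ≤ G) :
    HasPartial (fun a => ∫ x in Icc (a 0) (a 1), f x * resolve K (a 0) (a 1) g x) k
      (sgn k * (resolve K (a 0) (a 1) f (a k) * resolve K (a 0) (a 1) g (a k))) a := by
  have hR := hK.bddKernel_rker (a 0) (a 1)
  have hev := hK.eventually_good ha k hD
  have hfr := hK.continuous_resolve hD hf
  have hgr := hK.continuous_resolve hD hg
  have h1 := hasDerivAt_intervalIntegral_diag (s := a k)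
    (F := fun t y => resolve K (a 0) (a 1) f y *
      resolve K (Function.update a k t 0) (Function.update a k t 1) g y)
    (c := resolve K (a 0) (a 1) f (a k) * resolve K (a 0) (a 1) g (a k)) ?_ ?_
  · refine ((h1.const_mul (sgn k)).add_const
      (∫ x in Icc (a 0) (a 1), f x * resolve K (a 0) (a 1) g x)).congr_of_eventuallyEq ?_
    filter_upwards [hev] with t ht
    set H := resolve K (Function.update a k t 0) (Function.update a k t 1) g with hH
    have hHc : Continuous H := hK.continuous_resolve ht.2 hg
    have e1 := setIntegral_update_sub ha ht.1 (hf.fun_mul hHc)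
    -- `e1` accounts for the change of the domain, `e2` for the change of the resolvent. By symmetry
    -- of R they add up to the integral over the sliver of (f + Rf)H, and f + Rf = (1 - 𝕂)⁻¹f.
    have e2 : ∫ x in Icc (a 0) (a 1), f x * H x =
        (∫ x in Icc (a 0) (a 1), f x * resolve K (a 0) (a 1) g x) + sgn k *
          ∫ y in (a k)..t, (∫ x in Icc (a 0) (a 1), f x * rker K (a 0) (a 1) x y) * H y := by
      have hRH : Continuous (Function.uncurry fun x y => rker K (a 0) (a 1) x y * H y) :=
        continuous_uncurry_mul hR.cont hHc
      have hF : Continuous (Function.uncurry fun x y => f x * (rker K (a 0) (a 1) x y * H y)) :=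
        (hf.comp continuous_fst).mul hRH
      have hI : Continuous fun x => ∫ y in (a k)..t, rker K (a 0) (a 1) x y * H y :=
        intervalIntegral.continuous_parametric_intervalIntegral_of_continuous' hRH _ _
      have hsub : ∀ x, f x * H x = f x * resolve K (a 0) (a 1) g x +
          sgn k * (f x * ∫ y in (a k)..t, rker K (a 0) (a 1) x y * H y) := by
        intro x
        have := hK.resolve_update_sub ha ht.1 hD ht.2 hg x
        linear_combination f x * this
      have hswap := integral_intervalIntegral_swap hF (a 0) (a 1) (a k) t
      simp only [intervalIntegral.integral_const_mul] at hswap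
      simp only [hsub]
      rw [integral_add (integrable_of_continuous (hf.fun_mul hgr) _ _)
        ((integrable_of_continuous (hf.fun_mul hI) _ _).const_mul _), integral_const_mul, hswap]
      congr 3
      funext y
      rw [← integral_mul_const]
      simp only [mul_assoc]
    have hRf : ∀ y, ∫ x in Icc (a 0) (a 1), f x * rker K (a 0) (a 1) x y =
        resolve K (a 0) (a 1) f y - f y := by
      intro y
      rw [hK.resolve_eq hD hf]
      simp only [rker_symm hs _ y, mul_comm (f _)]
      ring
    have e3 : ∫ y in (a k)..t, resolve K (a 0) (a 1) f y * H y = (∫ y in (a k)..t, f y * H y) +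
        ∫ y in (a k)..t, (∫ x in Icc (a 0) (a 1), f x * rker K (a 0) (a 1) x y) * H y := by
      simp only [hRf, sub_mul]
      rw [intervalIntegral.integral_sub ((hfr.fun_mul hHc).intervalIntegrable _ _)
        ((hf.fun_mul hHc).intervalIntegrable _ _)]
      ring
    rw [e3]
    linear_combination e1 + e2
  · filter_upwards [hev] with t ht
    exact hfr.mul (hK.continuous_resolve ht.2 hg)
  · exact ((hfr.comp continuous_snd).tendsto (a k, a k)).mul
      (hK.tendsto_resolve_update ha k hD hg hG)

end ExpTW

end

noncomputable section

namespace ExpTW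

/-! ### Algebraic relations for a fixed interval -/

variable {b : ℂ} {Φ : ℝ → Fin 2 → ℂ} {K₁ : ℝ → ℝ → ℂ} {M : ℝ} {a₁ a₂ : ℝ}

theorem integrable_fun_sub {μ : Measure ℝ} {f g : ℝ → ℂ} (hf : Integrable f μ)
    (hg : Integrable g μ) : Integrable (fun x => f x - g x) μ :=
  hf.sub hg

theorem hasDerivAt_ex (b : ℂ) (x : ℝ) : HasDerivAt (ex b) (b * ex b x) x := by
  have h : HasDerivAt (fun x : ℝ => b * (x : ℂ)) b x := by
    simpa using (Complex.ofRealCLM.hasDerivAt (x := x)).const_mul b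
  have h2 := h.cexp
  rw [mul_comm] at h2
  exact h2

theorem continuous_ex (b : ℂ) : Continuous (ex b) :=
  Complex.continuous_exp.comp (continuous_const.mul Complex.continuous_ofReal)

theorem ex_ne_zero (b : ℂ) (x : ℝ) : ex b x ≠ 0 := Complex.exp_ne_zero _

/-- The numerator `ᵗΦ(x) J Φ(y)` of the kernel. -/
def wronskian (Φ : ℝ → Fin 2 → ℂ) (x y : ℝ) : ℂ := Φ x 0 * Φ y 1 - Φ x 1 * Φ y 0

/-- A solution which is `C²` and compactly supported, such that the associated kernel is
of class `C¹` in the first variable; the partial derivative is `K₁`. -/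
structure RegularKernel (b : ℂ) (Φ : ℝ → Fin 2 → ℂ) (M : ℝ) (K₁ : ℝ → ℝ → ℂ) : Prop
    extends BddKernel (kernel b Φ) M where
  contDiff : ContDiff ℝ 1 Φ
  compactSupport : HasCompactSupport Φ
  comm : ∀ x y, (ex b x - ex b y) * kernel b Φ x y = wronskian Φ x y
  continuous_deriv : Continuous (Function.uncurry K₁)
  hasDerivAt : ∀ x y, HasDerivAt (fun x => kernel b Φ x y) (K₁ x y) x

open scoped Matrix in
theorem dotProduct_J (u v : Fin 2 → ℂ) : u ⬝ᵥ (J *ᵥ v) = u 0 * v 1 - u 1 * v 0 := by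
  simp [J, dotProduct, Matrix.mulVec, Fin.sum_univ_two]
  ring

theorem kernel_symm (b : ℂ) (Φ : ℝ → Fin 2 → ℂ) (x y : ℝ) : kernel b Φ x y = kernel b Φ y x := by
  by_cases h : x = y
  · rw [h]
  · rw [kernel, kernel, if_neg h, if_neg (Ne.symm h), dotProduct_J, dotProduct_J, ← neg_div_neg_eq]
    congr 1 <;> ring

namespace RegularKernel

variable (hK : RegularKernel b Φ M K₁)

include hK

theorem continuous_coord (i : Fin 2) : Continuous fun x => Φ x i :=
  (continuous_apply i).comp hK.contDiff.continuous

theorem continuous_twist (i : Fin 2) (l : ℕ) : Continuous (twist b Φ i l) :=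
  ((continuous_ex b).pow l).mul (hK.continuous_coord i)

theorem exists_bound_twist (i : Fin 2) (l : ℕ) : ∃ G, ∀ x, ‖twist b Φ i l x‖ ≤ G := by
  have h : HasCompactSupport (twist b Φ i l) := by
    have h1 : HasCompactSupport fun x => Φ x i :=
      hK.compactSupport.comp_left (g := fun v : Fin 2 → ℂ => v i) rfl
    exact h1.mul_left (f := fun x => ex b x ^ l)
  exact h.exists_bound_of_continuous (hK.continuous_twist i l)

variable (hD : fredholmDet (kernel b Φ) a₁ a₂ ≠ 0)

include hD

/-- The resolvent kernel in terms of `(𝕀 - 𝕂_I)⁻¹ φ` and `(𝕀 - 𝕂_I)⁻¹ ψ`. -/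
theorem sub_mul_rker (x y : ℝ) :
    (ex b x - ex b y) * rker (kernel b Φ) a₁ a₂ x y =
      resolve (kernel b Φ) a₁ a₂ (twist b Φ 0 0) x * resolve (kernel b Φ) a₁ a₂ (twist b Φ 1 0) y -
      resolve (kernel b Φ) a₁ a₂ (twist b Φ 1 0) x *
        resolve (kernel b Φ) a₁ a₂ (twist b Φ 0 0) y := by
  have hKb := hK.toBddKernel
  set K := kernel b Φ
  have hR := hKb.bddKernel_rker a₁ a₂
  have hrc := hR.continuous_right y
  have hτ := fun i => hK.continuous_twist i 0
  have hr : ∀ i, ∫ z in Icc a₁ a₂, twist b Φ i 0 z * rker K a₁ a₂ z y =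
      resolve K a₁ a₂ (twist b Φ i 0) y - twist b Φ i 0 y := by
    intro i
    rw [hKb.resolve_eq hD (hτ i)]
    simp only [rker_symm (kernel_symm b Φ) y, mul_comm (twist b Φ i 0 _), K]
    ring
  set Q := resolve K a₁ a₂ (twist b Φ 0 0)
  set P := resolve K a₁ a₂ (twist b Φ 1 0)
  have hex := continuous_ex b
  have hhc : Continuous fun x => (ex b x - ex b y) * rker K a₁ a₂ x y :=
    (hex.sub continuous_const).mul hrc
  -- From R = K + KR: writing e^{bx} - e^{by} as (e^{bx} - e^{bz}) + (e^{bz} - e^{by}) under the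
  -- integral, the first difference cancels the denominator of K(x, z) and leaves φ and ψ at x with
  -- coefficients depending on y.
  have hfix : ∀ x, (ex b x - ex b y) * rker K a₁ a₂ x y =
      (P y * twist b Φ 0 0 x + -Q y * twist b Φ 1 0 x) +
        ∫ z in Icc a₁ a₂, K x z * ((ex b z - ex b y) * rker K a₁ a₂ z y) := by
    intro x
    have e1 : ∀ z, K x z * ((ex b z - ex b y) * rker K a₁ a₂ z y) =
        (ex b x - ex b y) * (K x z * rker K a₁ a₂ z y) -
          (twist b Φ 0 0 x * (twist b Φ 1 0 z * rker K a₁ a₂ z y) -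
            twist b Φ 1 0 x * (twist b Φ 0 0 z * rker K a₁ a₂ z y)) := by
      intro z
      have := hK.comm x z
      simp only [wronskian] at this
      simp only [twist, pow_zero, one_mul]
      linear_combination (-rker K a₁ a₂ z y) * this
    have i1 : Integrable (fun z => K x z * rker K a₁ a₂ z y) (vol a₁ a₂) :=
      integrable_of_continuous ((hKb.continuous_left x).mul hrc) _ _
    have i2 : ∀ i, Integrable (fun z => twist b Φ i 0 z * rker K a₁ a₂ z y) (vol a₁ a₂) :=
      fun i => integrable_of_continuous ((hτ i).mul hrc) _ _
    simp only [e1]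
    rw [integral_sub (i1.const_mul _) (integrable_fun_sub ((i2 1).const_mul _) ((i2 0).const_mul _)),
      integral_sub ((i2 1).const_mul _) ((i2 0).const_mul _), integral_const_mul,
      integral_const_mul, integral_const_mul, hr, hr]
    have h1 := hKb.rker_eq hD x y
    have h2 := hK.comm x y
    simp only [wronskian] at h2
    simp only [twist, pow_zero, one_mul]
    linear_combination (ex b x - ex b y) * h1 + h2
  have h1 := hKb.resolve_eq_of_fixed hD
    ((continuous_const.fun_mul (hτ 0)).fun_add (continuous_const.fun_mul (hτ 1))) hhc
    (fun x _ => hfix x) x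
  rw [← hfix, hKb.resolve_add hD (continuous_const.fun_mul (hτ 0))
    (continuous_const.fun_mul (hτ 1)), hKb.resolve_const_mul hD _ (hτ 0),
    hKb.resolve_const_mul hD _ (hτ 1)] at h1
  rw [← h1]
  ring

theorem integrable_twist_mul_resolve (i i' : Fin 2) (n l : ℕ) :
    Integrable (fun y => twist b Φ i n y * resolve (kernel b Φ) a₁ a₂ (twist b Φ i' l) y)
      (vol a₁ a₂) :=
  integrable_of_continuous ((hK.continuous_twist i n).mul
    (hK.toBddKernel.continuous_resolve hD (hK.continuous_twist i' l))) _ _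

/-- Commutation of `(𝕀 - 𝕂_I)⁻¹` with the multiplication by `e^{ℓbx}`. -/
theorem pow_mul_resolve (i : Fin 2) (l : ℕ) (x : ℝ) :
    ex b x ^ l * resolve (kernel b Φ) a₁ a₂ (twist b Φ i 0) x -
      resolve (kernel b Φ) a₁ a₂ (twist b Φ i l) x =
    ∑ n ∈ Finset.range l,
      ((∫ y in Icc a₁ a₂, twist b Φ 1 n y * resolve (kernel b Φ) a₁ a₂ (twist b Φ i 0) y) *
          resolve (kernel b Φ) a₁ a₂ (twist b Φ 0 (l - 1 - n)) x -
        (∫ y in Icc a₁ a₂, twist b Φ 0 n y * resolve (kernel b Φ) a₁ a₂ (twist b Φ i 0) y) *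
          resolve (kernel b Φ) a₁ a₂ (twist b Φ 1 (l - 1 - n)) x) := by
  have hKb := hK.toBddKernel
  have hint := fun j n => hK.integrable_twist_mul_resolve hD j i n 0
  set K := kernel b Φ
  have hτ := hK.continuous_twist
  set F := resolve K a₁ a₂ (twist b Φ i 0)
  have hF : Continuous F := hKb.continuous_resolve hD (hτ i 0)
  set V : Fin 2 → ℕ → ℂ := fun j n => ∫ y in Icc a₁ a₂, twist b Φ j n y * F y with hV
  have hpow : Continuous fun x => ex b x ^ l * F x := ((continuous_ex b).pow l).mul hF
  -- e^{ℓbx} - e^{ℓby} is e^{bx} - e^{by} times a geometric sum, and the first factor cancels the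
  -- denominator of K. So the commutator of 𝕂 with e^{ℓbx} is a sum of products of twists.
  have hfix : ∀ x, ex b x ^ l * F x = (twist b Φ i l x +
      ((∑ n ∈ Finset.range l, V 1 n * twist b Φ 0 (l - 1 - n) x) +
        (∑ n ∈ Finset.range l, -V 0 n * twist b Φ 1 (l - 1 - n) x))) +
      ∫ y in Icc a₁ a₂, K x y * (ex b y ^ l * F y) := by
    intro x
    have h1 : F x = twist b Φ i 0 x + ∫ y in Icc a₁ a₂, K x y * F y :=
      hKb.resolve_fixed hD (hτ i 0) x
    have e1 : ∀ y, K x y * (ex b y ^ l * F y) = ex b x ^ l * (K x y * F y) -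
        ∑ n ∈ Finset.range l, (twist b Φ 0 (l - 1 - n) x * (twist b Φ 1 n y * F y) -
          twist b Φ 1 (l - 1 - n) x * (twist b Φ 0 n y * F y)) := by
      intro y
      have h2 := hK.comm x y
      have h3 : ∑ n ∈ Finset.range l, (twist b Φ 0 (l - 1 - n) x * (twist b Φ 1 n y * F y) -
          twist b Φ 1 (l - 1 - n) x * (twist b Φ 0 n y * F y)) =
          (∑ n ∈ Finset.range l, ex b y ^ n * ex b x ^ (l - 1 - n)) * (wronskian Φ x y * F y) := by
        rw [Finset.sum_mul]
        refine Finset.sum_congr rfl fun n _ => ?_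
        simp only [twist, wronskian]
        ring
      have h4 := geom_sum₂_mul (ex b y) (ex b x) l
      rw [h3, ← h2]
      linear_combination (-K x y * F y) * h4
    simp only [e1]
    rw [integral_sub ((hKb.integrable_mul (integrable_of_continuous hF _ _) x).const_mul _)
      (integrable_finsetSum _ fun n _ => integrable_fun_sub ((hint 1 n).const_mul _) ((hint 0 n).const_mul _)),
      integral_finsetSum _ fun n _ => integrable_fun_sub ((hint 1 n).const_mul _) ((hint 0 n).const_mul _),
      integral_const_mul]
    have e2 : ∀ n, ∫ y in Icc a₁ a₂, (twist b Φ 0 (l - 1 - n) x * (twist b Φ 1 n y * F y) -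
          twist b Φ 1 (l - 1 - n) x * (twist b Φ 0 n y * F y)) =
        V 1 n * twist b Φ 0 (l - 1 - n) x + -V 0 n * twist b Φ 1 (l - 1 - n) x := by
      intro n
      rw [integral_sub ((hint 1 n).const_mul _) ((hint 0 n).const_mul _), integral_const_mul,
        integral_const_mul]
      ring
    simp only [e2]
    rw [Finset.sum_add_distrib]
    have e3 : twist b Φ i l x = ex b x ^ l * twist b Φ i 0 x := by simp [twist]
    rw [e3]
    linear_combination ex b x ^ l * h1
  have hS0 : Continuous fun x => ∑ n ∈ Finset.range l, V 1 n * twist b Φ 0 (l - 1 - n) x :=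
    continuous_finsetSum _ fun n _ => continuous_const.mul (hτ 0 _)
  have hS1 : Continuous fun x => ∑ n ∈ Finset.range l, -V 0 n * twist b Φ 1 (l - 1 - n) x :=
    continuous_finsetSum _ fun n _ => continuous_const.mul (hτ 1 _)
  have h1 := hKb.resolve_eq_of_fixed hD ((hτ i l).fun_add (hS0.fun_add hS1)) hpow
    (fun x _ => hfix x) x
  rw [← hfix, hKb.resolve_add hD (hτ i l) (hS0.fun_add hS1), hKb.resolve_add hD hS0 hS1,
    hKb.resolve_sum hD _ _ fun n => hτ 0 (l - 1 - n),
    hKb.resolve_sum hD _ _ fun n => hτ 1 (l - 1 - n)] at h1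
  rw [← h1, Finset.sum_sub_distrib]
  simp only [neg_mul, Finset.sum_neg_distrib]
  ring

end RegularKernel

end ExpTW

end

noncomputable section

namespace ExpTW

/-! ### Regularity of the kernel and localization -/

theorem contDiff_one_intervalIntegral {G : ℝ × ℝ → ℝ → ℂ}
    (hG : ContDiff ℝ 1 (Function.uncurry G)) :
    ContDiff ℝ 1 fun p => ∫ s in (0 : ℝ)..1, G p s := by
  have hd : ∀ p s, HasFDerivAt (fun p => G p s) ((fderiv ℝ (Function.uncurry G) (p, s)).comp
      (ContinuousLinearMap.inl ℝ (ℝ × ℝ) ℝ)) p := fun p s =>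
    ((hG.differentiable one_ne_zero) (p, s)).hasFDerivAt.comp (f := fun p => (p, s)) p
      (hasFDerivAt_prodMk_left p s)
  set G' : ℝ × ℝ → ℝ → (ℝ × ℝ →L[ℝ] ℂ) := fun p s =>
    (fderiv ℝ (Function.uncurry G) (p, s)).comp (ContinuousLinearMap.inl ℝ (ℝ × ℝ) ℝ) with hG'
  have hc : Continuous (Function.uncurry G') :=
    (hG.continuous_fderiv one_ne_zero).clm_comp continuous_const
  refine contDiff_one_iff_hasFDerivAt.2 ⟨fun p => ∫ s in (0 : ℝ)..1, G' p s,
    intervalIntegral.continuous_parametric_intervalIntegral_of_continuous' hc _ _, fun p => ?_⟩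
  obtain ⟨C, hC⟩ := ((isCompact_closedBall p 1).prod (isCompact_uIcc (a := (0 : ℝ)) (b := 1))
    ).exists_bound_of_continuousOn hc.continuousOn
  have hGc : ∀ p, Continuous (G p) := fun p =>
    hG.continuous.comp (f := fun s => (p, s)) (by fun_prop)
  refine intervalIntegral.hasFDerivAt_integral_of_dominated_of_fderiv_le (bound := fun _ => C)
    (Metric.ball_mem_nhds p one_pos)
    (Eventually.of_forall fun q => (hGc q).aestronglyMeasurable)
    ((hGc p).intervalIntegrable _ _)
    (hc.comp (f := fun s => (p, s)) (by fun_prop)).aestronglyMeasurable ?_ (by simp) ?_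
  · refine Eventually.of_forall fun s hs q hq => hC (q, s) ⟨Metric.ball_subset_closedBall hq,
      uIoc_subset_uIcc hs⟩
  · exact Eventually.of_forall fun s _ q _ => hd q s

/-! ### Divided differences of e^{bx} and of the kernel -/

/-- The divided difference of a function with derivative `g`. -/
def divDiff (g : ℝ → ℂ) (x y : ℝ) : ℂ := ∫ s in (0 : ℝ)..1, g (y + s * (x - y))

theorem contDiff_divDiff {g : ℝ → ℂ} (hg : ContDiff ℝ 1 g) :
    ContDiff ℝ 1 fun p : ℝ × ℝ => divDiff g p.1 p.2 := by
  refine contDiff_one_intervalIntegral (G := fun p s => g (p.2 + s * (p.1 - p.2))) ?_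
  exact hg.comp (f := fun q : (ℝ × ℝ) × ℝ => q.1.2 + q.2 * (q.1.1 - q.1.2)) (by fun_prop)

theorem divDiff_self (g : ℝ → ℂ) (x : ℝ) : divDiff g x x = g x := by simp [divDiff]

theorem sub_mul_divDiff {f g : ℝ → ℂ} (hf : ∀ x, HasDerivAt f (g x) x) (hg : Continuous g)
    (x y : ℝ) : ((x : ℂ) - y) * divDiff g x y = f x - f y := by
  have h : ∀ s : ℝ, HasDerivAt (fun s : ℝ => f (y + s * (x - y)))
      (((x : ℂ) - y) * g (y + s * (x - y))) s := by
    intro s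
    have h1 : HasDerivAt (fun s : ℝ => y + s * (x - y)) (x - y) s := by
      simpa using ((hasDerivAt_id s).mul_const (x - y)).const_add y
    have h2 := (hf (y + s * (x - y))).scomp s h1
    refine h2.congr_deriv ?_
    rw [Complex.real_smul]
    push_cast
    rfl
  have hc : Continuous fun s : ℝ => ((x : ℂ) - y) * g (y + s * (x - y)) := by fun_prop
  have := intervalIntegral.integral_eq_sub_of_hasDerivAt (a := 0) (b := 1) (fun s _ => h s)
    (hc.intervalIntegrable _ _)
  rw [intervalIntegral.integral_const_mul] at this
  rw [divDiff, this]
  simp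

theorem contDiff_ex (b : ℂ) : ContDiff ℝ 1 (ex b) := by
  have h : ContDiff ℝ 1 fun x : ℝ => (x : ℂ) := Complex.ofRealCLM.contDiff
  exact (contDiff_const.mul h).cexp

/-- The divided difference of `e^{bx}`. -/
def exDiff (b : ℂ) (x y : ℝ) : ℂ := divDiff (fun x => b * ex b x) x y

theorem contDiff_exDiff (b : ℂ) : ContDiff ℝ 1 fun p : ℝ × ℝ => exDiff b p.1 p.2 :=
  contDiff_divDiff (contDiff_const.mul (contDiff_ex b))

theorem sub_mul_exDiff (b : ℂ) (x y : ℝ) : ((x : ℂ) - y) * exDiff b x y = ex b x - ex b y :=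
  sub_mul_divDiff (hasDerivAt_ex b) (continuous_const.mul (continuous_ex b)) x y

theorem ne_zero_of_injOn {b : ℂ} {a₁ a₂ : ℝ} (h : a₁ < a₂) (hinj : InjOn (ex b) (Icc a₁ a₂)) :
    b ≠ 0 := by
  rintro rfl
  have := hinj (left_mem_Icc.2 h.le) (right_mem_Icc.2 h.le) (by simp [ex])
  exact h.ne this

/-- With its converse `injOn_of_exDiff_ne_zero`, this trades injectivity for the nonvanishing of a
continuous function on a square, which persists on neighbourhoods of compact sets. -/
theorem exDiff_ne_zero {b : ℂ} (hb : b ≠ 0) {s : Set ℝ} (hinj : InjOn (ex b) s) {x y : ℝ}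
    (hx : x ∈ s) (hy : y ∈ s) : exDiff b x y ≠ 0 := by
  rcases eq_or_ne x y with rfl | hxy
  · rw [exDiff, divDiff_self]
    exact mul_ne_zero hb (ex_ne_zero b x)
  · intro h0
    have h1 := sub_mul_exDiff b x y
    rw [h0, mul_zero] at h1
    exact hxy (hinj hx hy (sub_eq_zero.1 h1.symm))

theorem injOn_of_exDiff_ne_zero {b : ℂ} {s : Set ℝ} (h : ∀ x ∈ s, ∀ y ∈ s, exDiff b x y ≠ 0) :
    InjOn (ex b) s := by
  intro x hx y hy hxy
  by_contra hne
  have h1 := sub_mul_exDiff b x y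
  rw [hxy, sub_self] at h1
  have h2 : (x : ℂ) - y ≠ 0 := sub_ne_zero.2 (by exact_mod_cast hne)
  exact (mul_ne_zero h2 (h x hx y hy)) h1

theorem kernel_eq_zero (b : ℂ) {Φ : ℝ → Fin 2 → ℂ} {x y : ℝ} (h : Φ x = 0 ∨ Φ y = 0) :
    kernel b Φ x y = 0 := by
  rw [kernel]
  by_cases hxy : x = y
  · subst hxy
    have h0 : Φ x = 0 := by tauto
    rw [if_pos rfl, dotProduct_J, h0]
    simp
  · rw [if_neg hxy, dotProduct_J]
    rcases h with h | h <;> rw [h] <;> simp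

/-- Since ᵗΦ(y)JΦ(y) = 0, the numerator is ᵗ(Φ(x) - Φ(y))JΦ(y), and x - y cancels from the quotient.
The resulting formula does not single out the diagonal, and it shows that K is C¹ when Φ is C². -/
theorem kernel_eq_divDiff {b : ℂ} {Φ : ℝ → Fin 2 → ℂ} (hΦ : ContDiff ℝ 1 Φ) {x y : ℝ}
    (h : exDiff b x y ≠ 0) :
    kernel b Φ x y = (divDiff (fun x => deriv Φ x 0) x y * Φ y 1 -
      divDiff (fun x => deriv Φ x 1) x y * Φ y 0) / exDiff b x y := by
  have hd : ∀ i x, HasDerivAt (fun x => Φ x i) (deriv Φ x i) x := fun i x =>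
    hasDerivAt_pi.1 ((hΦ.differentiable one_ne_zero) x).hasDerivAt i
  have hc : ∀ i, Continuous fun x => deriv Φ x i := fun i =>
    (continuous_apply i).comp (hΦ.continuous_deriv le_rfl)
  rw [kernel]
  by_cases hxy : x = y
  · subst hxy
    rw [if_pos rfl, dotProduct_J, divDiff_self, divDiff_self, exDiff, divDiff_self]
  · rw [if_neg hxy, dotProduct_J]
    have hne : (x : ℂ) - y ≠ 0 := sub_ne_zero.2 (by exact_mod_cast hxy)
    have h0 := sub_mul_divDiff (hd 0) (hc 0) x y
    have h1 := sub_mul_divDiff (hd 1) (hc 1) x y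
    rw [← sub_mul_exDiff, div_eq_div_iff (mul_ne_zero hne h) h]
    linear_combination exDiff b x y * (-(Φ y 1) * h0 + Φ y 0 * h1)

theorem contDiff_kernel {b : ℂ} {Φ : ℝ → Fin 2 → ℂ} (hΦ : ContDiff ℝ 2 Φ) {V : Set ℝ}
    (hV : IsOpen V) (hV0 : ∀ x ∈ V, ∀ y ∈ V, exDiff b x y ≠ 0) (hsupp : tsupport Φ ⊆ V) :
    ContDiff ℝ 1 (Function.uncurry (kernel b Φ)) := by
  have hΦ1 : ContDiff ℝ 1 Φ := hΦ.of_le one_le_two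
  have hder : ContDiff ℝ 1 (deriv Φ) := by
    have : ContDiff ℝ (1 + 1) Φ := by simpa [one_add_one_eq_two] using hΦ
    exact (contDiff_succ_iff_deriv.1 this).2.2
  have hdi : ∀ i, ContDiff ℝ 1 fun x => deriv Φ x i := fun i => contDiff_pi.1 hder i
  have hΦi : ∀ i, ContDiff ℝ 1 fun x => Φ x i := fun i => contDiff_pi.1 hΦ1 i
  refine contDiff_iff_contDiffAt.2 fun p => ?_
  by_cases hp : p.1 ∈ V ∧ p.2 ∈ V
  · have hmem : V ×ˢ V ∈ 𝓝 p := (hV.prod hV).mem_nhds hp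
    have hexpr : ContDiffAt ℝ 1 (fun p : ℝ × ℝ => (divDiff (fun x => deriv Φ x 0) p.1 p.2 *
        Φ p.2 1 - divDiff (fun x => deriv Φ x 1) p.1 p.2 * Φ p.2 0) / exDiff b p.1 p.2) p := by
      simp only [div_eq_mul_inv]
      refine ContDiffAt.mul (ContDiff.contDiffAt ?_)
        ((contDiff_exDiff b).contDiffAt.inv (hV0 _ hp.1 _ hp.2))
      exact ((contDiff_divDiff (hdi 0)).mul ((hΦi 1).comp contDiff_snd)).sub
        ((contDiff_divDiff (hdi 1)).mul ((hΦi 0).comp contDiff_snd))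
    refine hexpr.congr_of_eventuallyEq ?_
    filter_upwards [hmem] with q hq
    exact kernel_eq_divDiff hΦ1 (hV0 _ hq.1 _ hq.2)
  · have hev : Function.uncurry (kernel b Φ) =ᶠ[𝓝 p] fun _ => 0 := by
      rw [not_and_or] at hp
      rcases hp with hp | hp
      · have h1 : Φ =ᶠ[𝓝 p.1] 0 := notMem_tsupport_iff_eventuallyEq.1 fun h => hp (hsupp h)
        filter_upwards [(continuous_fst.tendsto p).eventually h1] with q hq
        exact kernel_eq_zero b (Or.inl hq)
      · have h1 : Φ =ᶠ[𝓝 p.2] 0 := notMem_tsupport_iff_eventuallyEq.1 fun h => hp (hsupp h)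
        filter_upwards [(continuous_snd.tendsto p).eventually h1] with q hq
        exact kernel_eq_zero b (Or.inr hq)
    exact contDiffAt_const.congr_of_eventuallyEq hev

theorem exists_regularKernel {b : ℂ} {Φ : ℝ → Fin 2 → ℂ} (hΦ : ContDiff ℝ 2 Φ) {V : Set ℝ}
    (hV : IsOpen V) (hV0 : ∀ x ∈ V, ∀ y ∈ V, exDiff b x y ≠ 0) (hsupp : tsupport Φ ⊆ V)
    (hc : HasCompactSupport Φ) : ∃ M K₁, RegularKernel b Φ M K₁ := by
  have hK := contDiff_kernel hΦ hV hV0 hsupp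
  have hzero : ∀ p : ℝ × ℝ, p ∉ tsupport Φ ×ˢ tsupport Φ → Function.uncurry (kernel b Φ) p = 0 := by
    intro p hp
    rw [mem_prod, not_and_or] at hp
    exact kernel_eq_zero b (hp.imp image_eq_zero_of_notMem_tsupport
      image_eq_zero_of_notMem_tsupport)
  have hcK : HasCompactSupport (Function.uncurry (kernel b Φ)) :=
    HasCompactSupport.intro (IsCompact.prod hc hc) hzero
  obtain ⟨M, hM⟩ := hcK.exists_bound_of_continuous hK.continuous
  refine ⟨M, fun x y => fderiv ℝ (Function.uncurry (kernel b Φ)) (x, y) (1, 0),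
    ⟨⟨hK.continuous, fun x y => hM (x, y)⟩, hΦ.of_le one_le_two, hc, ?_, ?_, ?_⟩⟩
  · intro x y
    by_cases hxy : x = y
    · subst hxy
      simp [wronskian, mul_comm]
    -- If e^{bx} = e^{by} with x ≠ y, the two points cannot both lie in V, where e^{bx} is
    -- injective; so Φ vanishes at one of them, and so do both sides.
    by_cases hex : ex b x = ex b y
    · have h1 : Φ x = 0 ∨ Φ y = 0 := by
        by_contra! hne
        refine hxy (injOn_of_exDiff_ne_zero hV0 (hsupp ?_) (hsupp ?_) hex)
        · by_contra h
          exact hne.1 (image_eq_zero_of_notMem_tsupport h)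
        · by_contra h
          exact hne.2 (image_eq_zero_of_notMem_tsupport h)
      rw [kernel_eq_zero b h1, wronskian]
      rcases h1 with h1 | h1 <;> rw [h1] <;> simp
    · rw [kernel, if_neg hxy, dotProduct_J, wronskian, mul_div_cancel₀ _ (sub_ne_zero.2 hex)]
  · exact (hK.continuous_fderiv one_ne_zero).clm_apply continuous_const
  · intro x y
    have h1 := ((hK.differentiable one_ne_zero) (x, y)).hasFDerivAt
    have h2 : HasDerivAt (fun x : ℝ => (x, y)) ((1 : ℝ), (0 : ℝ)) x :=
      (hasDerivAt_id x).prodMk (hasDerivAt_const x y)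
    exact h1.comp_hasDerivAt x h2

/-! ### Cutting off Φ near the interval -/

theorem exists_Ioo_subset {a₁ a₂ : ℝ} (ha : a₁ < a₂) {U : Set ℝ} (hU : IsOpen U)
    (hI : Icc a₁ a₂ ⊆ U) : ∃ δ > 0, Ioo (a₁ - δ) (a₂ + δ) ⊆ U := by
  obtain ⟨δ, hδ, hW⟩ := (isCompact_Icc (a := a₁) (b := a₂)).exists_thickening_subset_open hU hI
  refine ⟨δ, hδ, fun x hx => hW ?_⟩
  rw [Metric.mem_thickening_iff]
  -- The point of the interval nearest to x.
  refine ⟨max a₁ (min x a₂), ⟨le_max_left _ _, max_le ha.le (min_le_right _ _)⟩, ?_⟩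
  obtain ⟨hx1, hx2⟩ := hx
  rw [Real.dist_eq, abs_lt]
  rcases le_total x a₂ with h1 | h1
  · rw [min_eq_left h1]
    rcases le_total a₁ x with h2 | h2
    · rw [max_eq_right h2]
      constructor <;> linarith
    · rw [max_eq_left h2]
      constructor <;> linarith
  · rw [min_eq_right h1, max_eq_right ha.le]
    constructor <;> linarith

theorem exists_bump {a₁ a₂ δ : ℝ} (ha : a₁ < a₂) (hδ : 0 < δ) :
    ∃ χ : ℝ → ℝ, ContDiff ℝ 2 χ ∧ HasCompactSupport χ ∧
      tsupport χ ⊆ Ioo (a₁ - δ) (a₂ + δ) ∧ ∀ x ∈ Ioo (a₁ - δ / 3) (a₂ + δ / 3), χ x = 1 := by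
  -- Centred at the midpoint: equal to 1 up to δ/3 beyond the endpoints and supported within 2δ/3,
  -- so that the closed support stays inside the δ-neighbourhood.
  let χ : ContDiffBump ((a₁ + a₂) / 2) :=
    ⟨(a₂ - a₁) / 2 + δ / 3, (a₂ - a₁) / 2 + 2 * δ / 3, by linarith, by linarith⟩
  refine ⟨χ, χ.contDiff, χ.hasCompactSupport, ?_, fun x hx => χ.one_of_mem_closedBall ?_⟩
  · rw [χ.tsupport_eq, Real.closedBall_eq_Icc]
    rintro x ⟨h1, h2⟩
    change _ - ((a₂ - a₁) / 2 + 2 * δ / 3) ≤ _ at h1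
    change _ ≤ _ + ((a₂ - a₁) / 2 + 2 * δ / 3) at h2
    constructor <;> linarith
  · rw [Real.closedBall_eq_Icc]
    obtain ⟨h1, h2⟩ := hx
    constructor
    · change _ - ((a₂ - a₁) / 2 + δ / 3) ≤ _
      linarith
    · change _ ≤ _ + ((a₂ - a₁) / 2 + δ / 3)
      linarith

/-- Near an interval, a solution can be replaced by a compactly supported one with a regular
kernel. -/
theorem exists_localization {b : ℂ} {Φ : ℝ → Fin 2 → ℂ} {S : Set ℝ} (hS : IsOpen S)
    (hΦ : ContDiffOn ℝ 2 Φ S) {a₁ a₂ : ℝ} (ha : a₁ < a₂) (hsub : Icc a₁ a₂ ⊆ S)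
    (hinj : InjOn (ex b) (Icc a₁ a₂)) :
    ∃ c d, c < a₁ ∧ a₂ < d ∧ Ioo c d ⊆ S ∧ InjOn (ex b) (Ioo c d) ∧
      ∃ Φ' M K₁, RegularKernel b Φ' M K₁ ∧ EqOn Φ Φ' (Ioo c d) := by
  have hb := ne_zero_of_injOn ha hinj
  have hopen : IsOpen {p : ℝ × ℝ | exDiff b p.1 p.2 ≠ 0} :=
    isOpen_ne.preimage (contDiff_exDiff b).continuous
  -- The divided difference of e^{bx} has no zero on the compact square I × I, hence none on a
  -- product neighbourhood.
  obtain ⟨u, v, hu, hv, hIu, hIv, huv⟩ := generalized_tube_lemma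
    (isCompact_Icc (a := a₁) (b := a₂)) (isCompact_Icc (a := a₁) (b := a₂)) hopen
    fun p hp => exDiff_ne_zero hb hinj hp.1 hp.2
  obtain ⟨δ, hδ, hW⟩ := exists_Ioo_subset ha ((hu.inter hv).inter hS)
    fun x hx => ⟨⟨hIu hx, hIv hx⟩, hsub hx⟩
  have hV0 : ∀ x ∈ Ioo (a₁ - δ) (a₂ + δ), ∀ y ∈ Ioo (a₁ - δ) (a₂ + δ), exDiff b x y ≠ 0 :=
    fun x hx y hy => huv (show (x, y) ∈ u ×ˢ v from ⟨(hW hx).1.1, (hW hy).1.2⟩)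
  obtain ⟨χ, hχ, hχc, hχV, hχ1⟩ := exists_bump ha hδ
  have htsupp : tsupport (fun x => χ x • Φ x) ⊆ tsupport χ := tsupport_smul_subset_left χ Φ
  have hsmooth : ContDiff ℝ 2 (fun x => χ x • Φ x) := by
    refine contDiff_iff_contDiffAt.2 fun x => ?_
    by_cases hx : x ∈ tsupport χ
    · exact hχ.contDiffAt.smul (hΦ.contDiffAt (hS.mem_nhds (hW (hχV hx)).2))
    · have h0 : (fun x => χ x • Φ x) =ᶠ[𝓝 x] fun _ => 0 :=
        notMem_tsupport_iff_eventuallyEq.1 fun h => hx (htsupp h)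
      exact contDiffAt_const.congr_of_eventuallyEq h0
  have hcs : HasCompactSupport (fun x => χ x • Φ x) :=
    hχc.mono' ((subset_tsupport _).trans htsupp)
  have htV : tsupport (fun x => χ x • Φ x) ⊆ Ioo (a₁ - δ) (a₂ + δ) := htsupp.trans hχV
  obtain ⟨M, K₁, hreg⟩ := exists_regularKernel hsmooth isOpen_Ioo hV0 htV hcs
  have hsubV : Ioo (a₁ - δ / 3) (a₂ + δ / 3) ⊆ Ioo (a₁ - δ) (a₂ + δ) :=
    Ioo_subset_Ioo (by linarith) (by linarith)
  have hEq : EqOn Φ (fun x => χ x • Φ x) (Ioo (a₁ - δ / 3) (a₂ + δ / 3)) := by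
    intro x hx
    simp only [hχ1 x hx, one_smul]
  exact ⟨a₁ - δ / 3, a₂ + δ / 3, by linarith, by linarith,
    fun x hx => (hW (hsubV hx)).2, (injOn_of_exDiff_ne_zero hV0).mono hsubV,
    fun x => χ x • Φ x, M, K₁, hreg, hEq⟩

/-! ### Locality of the determinant and of the resolvent -/

/-- U is open because the value of the kernel on the diagonal involves a derivative. -/
theorem kernel_congr {b : ℂ} {Φ Φ' : ℝ → Fin 2 → ℂ} {U : Set ℝ} (hU : IsOpen U)
    (h : EqOn Φ Φ' U) {x y : ℝ} (hx : x ∈ U) (hy : y ∈ U) : kernel b Φ x y = kernel b Φ' x y := by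
  have hd : deriv Φ x = deriv Φ' x :=
    Filter.EventuallyEq.deriv_eq (h.eventuallyEq_of_mem (hU.mem_nhds hx))
  rw [kernel, kernel, hd, h hx, h hy]

theorem contKernel_congr {K K' : ℝ → ℝ → ℂ} {a₁ a₂ : ℝ}
    (h : ∀ x ∈ Icc a₁ a₂, ∀ y ∈ Icc a₁ a₂, K x y = K' x y) (hK : ContKernel K' a₁ a₂) :
    ContKernel K a₁ a₂ :=
  ContinuousOn.congr hK fun p hp => h p.1 hp.1 p.2 hp.2

theorem intOp_congr {K K' : ℝ → ℝ → ℂ} {a₁ a₂ : ℝ}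
    (h : ∀ x ∈ Icc a₁ a₂, ∀ y ∈ Icc a₁ a₂, K x y = K' x y) (hK : ContKernel K' a₁ a₂) :
    intOp K a₁ a₂ = intOp K' a₁ a₂ := by
  refine ContinuousLinearMap.ext fun f => Lp.ext ?_
  filter_upwards [intOp_coe (contKernel_congr h hK) f, intOp_coe hK f,
    ae_restrict_mem measurableSet_Icc] with x h1 h2 hx
  rw [h1, h2]
  exact setIntegral_congr_fun measurableSet_Icc fun y hy => by simp only [h x hx y hy]

theorem toL2_congr {g g' : ℝ → ℂ} {a₁ a₂ : ℝ} (h : EqOn g g' (Icc a₁ a₂)) :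
    toL2 a₁ a₂ g = toL2 a₁ a₂ g' := by
  have hae : g =ᵐ[vol a₁ a₂] g' := by
    filter_upwards [ae_restrict_mem measurableSet_Icc] with x hx using h hx
  by_cases hg : MemLp g 2 (vol a₁ a₂)
  · have hg' := (memLp_congr_ae hae).1 hg
    rw [toL2, toL2, dif_pos hg, dif_pos hg', MemLp.toLp_eq_toLp_iff]
    exact hae
  · have hg' : ¬ MemLp g' 2 (vol a₁ a₂) := fun h => hg ((memLp_congr_ae hae).2 h)
    rw [toL2, toL2, dif_neg hg, dif_neg hg']

theorem resolve_congr {K K' : ℝ → ℝ → ℂ} {g g' : ℝ → ℂ} {a₁ a₂ : ℝ} {U : Set ℝ}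
    (hU : Icc a₁ a₂ ⊆ U) (h : ∀ x ∈ U, ∀ y ∈ U, K x y = K' x y) (hg : EqOn g g' U)
    (hK : ContKernel K' a₁ a₂) {x : ℝ} (hx : x ∈ U) :
    resolve K a₁ a₂ g x = resolve K' a₁ a₂ g' x := by
  rw [resolve, resolve, hg hx, intOp_congr (fun x hx y hy => h x (hU hx) y (hU hy)) hK,
    toL2_congr (hg.mono hU)]
  congr 1
  exact setIntegral_congr_fun measurableSet_Icc fun y hy => by simp only [h x hx y (hU hy)]

theorem fredholmDet_congr {K K' : ℝ → ℝ → ℂ} {a₁ a₂ : ℝ}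
    (h : ∀ x ∈ Icc a₁ a₂, ∀ y ∈ Icc a₁ a₂, K x y = K' x y) :
    fredholmDet K a₁ a₂ = fredholmDet K' a₁ a₂ := by
  rw [fredholmDet, fredholmDet]
  refine tsum_congr fun n => ?_
  congr 1
  refine setIntegral_congr_fun (MeasurableSet.univ_pi fun _ => measurableSet_Icc) fun x hx => ?_
  refine congrArg Matrix.det ?_
  ext i j
  exact h _ (hx i trivial) _ (hx j trivial)

end ExpTW

end

noncomputable section

namespace ExpTW

/-! ### Polynomials in the exponential -/

/-- Multiplication by x shifts l and multiplication by y shifts l'. Both products equal the double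
sum of c(l + l')x^l y^l' without one edge, and the two edges are the sums on the right. The terms
shifted past N vanish by `hc`. -/
theorem sum_range_shift_sub (c : ℕ → ℂ) (N : ℕ) (hc : ∀ k, N ≤ k → c k = 0) (x y : ℂ) :
    (x - y) * ∑ l ∈ Finset.range N, ∑ l' ∈ Finset.range N, c (l + l' + 1) * x ^ l * y ^ l' =
      ∑ k ∈ Finset.range N, c k * x ^ k - ∑ k ∈ Finset.range N, c k * y ^ k := by
  have h1 : x * ∑ l ∈ Finset.range N, ∑ l' ∈ Finset.range N, c (l + l' + 1) * x ^ l * y ^ l' =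
      ∑ l' ∈ Finset.range N, ∑ l ∈ Finset.range N, c ((l + 1) + l') * x ^ (l + 1) * y ^ l' := by
    rw [Finset.sum_comm, Finset.mul_sum]
    refine Finset.sum_congr rfl fun l' _ => ?_
    rw [Finset.mul_sum]
    refine Finset.sum_congr rfl fun l _ => ?_
    rw [show l + 1 + l' = l + l' + 1 by ring]
    ring
  have h2 : y * ∑ l ∈ Finset.range N, ∑ l' ∈ Finset.range N, c (l + l' + 1) * x ^ l * y ^ l' =
      ∑ l ∈ Finset.range N, ∑ l' ∈ Finset.range N, c (l + (l' + 1)) * x ^ l * y ^ (l' + 1) := by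
    rw [Finset.mul_sum]
    refine Finset.sum_congr rfl fun l _ => ?_
    rw [Finset.mul_sum]
    refine Finset.sum_congr rfl fun l' _ => ?_
    rw [show l + (l' + 1) = l + l' + 1 by ring]
    ring
  have h3 : ∀ l', ∑ l ∈ Finset.range N, c ((l + 1) + l') * x ^ (l + 1) * y ^ l' =
      (∑ l ∈ Finset.range N, c (l + l') * x ^ l * y ^ l') - c l' * y ^ l' := by
    intro l'
    have := Finset.sum_range_succ' (fun l => c (l + l') * x ^ l * y ^ l') N
    rw [Finset.sum_range_succ, hc (N + l') (by omega)] at this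
    simp only [zero_add, pow_zero, mul_one, zero_mul, add_zero] at this
    rw [this]
    ring
  have h4 : ∀ l, ∑ l' ∈ Finset.range N, c (l + (l' + 1)) * x ^ l * y ^ (l' + 1) =
      (∑ l' ∈ Finset.range N, c (l + l') * x ^ l * y ^ l') - c l * x ^ l := by
    intro l
    have := Finset.sum_range_succ' (fun l' => c (l + l') * x ^ l * y ^ l') N
    rw [Finset.sum_range_succ, hc (l + N) (by omega)] at this
    simp only [add_zero, pow_zero, mul_one, zero_mul] at this
    rw [this]
    ring
  rw [sub_mul, h1, h2]
  simp only [h3, h4, Finset.sum_sub_distrib]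
  rw [Finset.sum_comm]
  ring

/-- The divided difference of a polynomial, as a polynomial in two variables. -/
def polyDiff (p : ℂ[X]) (N : ℕ) (x y : ℂ) : ℂ :=
  ∑ l ∈ Finset.range N, ∑ l' ∈ Finset.range N, p.coeff (l + l' + 1) * x ^ l * y ^ l'

theorem sub_mul_polyDiff {p : ℂ[X]} {N : ℕ} (hp : p.natDegree < N) (x y : ℂ) :
    (x - y) * polyDiff p N x y = p.eval x - p.eval y := by
  rw [polyDiff, sum_range_shift_sub p.coeff N
    fun k hk => coeff_eq_zero_of_natDegree_lt (hp.trans_le hk), eval_eq_sum_range' hp,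
    eval_eq_sum_range' hp]

theorem eval_of_natDegree_le_one {m : ℂ[X]} (hdeg : m.natDegree ≤ 1) (z : ℂ) :
    m.eval z = m.coeff 0 + m.coeff 1 * z := by
  rw [eval_eq_sum_range' (Nat.lt_succ_of_le hdeg)]
  simp [Finset.sum_range_succ]

theorem hasDerivAt_eval_ex {m : ℂ[X]} (hdeg : m.natDegree ≤ 1) (b : ℂ) (y : ℝ) :
    HasDerivAt (fun y => m.eval (ex b y)) (m.coeff 1 * (b * ex b y)) y := by
  simp only [eval_of_natDegree_le_one hdeg]
  exact ((hasDerivAt_ex b y).const_mul _).const_add _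

theorem sum_delta_mul {N : ℕ} (hN : 0 < N) (c : ℂ) (f : ℕ → ℂ) :
    ∑ l ∈ Finset.range N, c * delta l * f l = c * f 0 := by
  rw [Finset.sum_eq_single_of_mem 0 (Finset.mem_range.2 hN)]
  · simp [delta]
  · intro l _ hl
    simp [delta, hl]

/-! ### The differential equations in the spatial variable -/

variable {b : ℂ} {Φ : ℝ → Fin 2 → ℂ} {K₁ : ℝ → ℝ → ℂ} {M : ℝ} {a₁ a₂ : ℝ} {m A B C : ℂ[X]}

/-- The differential equation on a set, without denominators. -/
structure SolvesOn (b : ℂ) (m A B C : ℂ[X]) (Φ : ℝ → Fin 2 → ℂ) (s : Set ℝ) : Prop where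
  eq0 : ∀ x ∈ s, m.eval (ex b x) * deriv Φ x 0 =
    (b / 2 * m.eval (ex b x) + A.eval (ex b x)) * Φ x 0 + B.eval (ex b x) * Φ x 1
  eq1 : ∀ x ∈ s, m.eval (ex b x) * deriv Φ x 1 =
    -C.eval (ex b x) * Φ x 0 + (b / 2 * m.eval (ex b x) - A.eval (ex b x)) * Φ x 1

namespace RegularKernel

variable (hK : RegularKernel b Φ M K₁)

include hK

theorem hasDerivAt_coord (i : Fin 2) (x : ℝ) : HasDerivAt (fun x => Φ x i) (deriv Φ x i) x :=
  hasDerivAt_pi.1 ((hK.contDiff.differentiable one_ne_zero) x).hasDerivAt i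

theorem continuous_deriv_coord (i : Fin 2) : Continuous fun x => deriv Φ x i :=
  (continuous_apply i).comp (hK.contDiff.continuous_deriv le_rfl)

theorem deriv_comm (x y : ℝ) : b * ex b x * kernel b Φ x y + (ex b x - ex b y) * K₁ x y =
    deriv Φ x 0 * Φ y 1 - deriv Φ x 1 * Φ y 0 := by
  have h1 : HasDerivAt (fun x => (ex b x - ex b y) * kernel b Φ x y)
      (b * ex b x * kernel b Φ x y + (ex b x - ex b y) * K₁ x y) x :=
    ((hasDerivAt_ex b x).sub_const _).mul (hK.hasDerivAt x y)
  have h2 : HasDerivAt (fun x => wronskian Φ x y)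
      (deriv Φ x 0 * Φ y 1 - deriv Φ x 1 * Φ y 0) x :=
    ((hK.hasDerivAt_coord 0 x).mul_const _).sub ((hK.hasDerivAt_coord 1 x).mul_const _)
  refine h1.unique (h2.congr_of_eventuallyEq (Eventually.of_forall fun z => hK.comm z y))

/-- The derivative of the kernel along `m(x)∂ₓ + ∂_y m(y)` has finite rank. -/
theorem derivation_kernel (hdeg : m.natDegree ≤ 1) {s : Set ℝ} (hode : SolvesOn b m A B C Φ s)
    {N : ℕ} (hA : A.natDegree < N) (hB : B.natDegree < N) (hC : C.natDegree < N)
    {x y : ℝ} (hx : x ∈ s) (hy : y ∈ s) (hxy : ex b x ≠ ex b y) :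
    m.eval (ex b x) * K₁ x y +
      (m.eval (ex b y) * K₁ y x + m.coeff 1 * (b * ex b y) * kernel b Φ x y) =
      -(b / 2 * m.coeff 1 * wronskian Φ x y) +
        (polyDiff A N (ex b x) (ex b y) * (Φ x 0 * Φ y 1 + Φ x 1 * Φ y 0) +
          polyDiff B N (ex b x) (ex b y) * (Φ x 1 * Φ y 1) +
          polyDiff C N (ex b x) (ex b y) * (Φ x 0 * Φ y 0)) := by
  have hne : ex b x - ex b y ≠ 0 := sub_ne_zero.2 hxy
  refine mul_left_cancel₀ hne ?_
  have d1 := hK.deriv_comm x y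
  have d2 := hK.deriv_comm y x
  rw [kernel_symm b Φ y x] at d2
  have hc := hK.comm x y
  have pA := sub_mul_polyDiff hA (ex b x) (ex b y)
  have pB := sub_mul_polyDiff hB (ex b x) (ex b y)
  have pC := sub_mul_polyDiff hC (ex b x) (ex b y)
  have x0 := hode.eq0 x hx
  have x1 := hode.eq1 x hx
  have y0 := hode.eq0 y hy
  have y1 := hode.eq1 y hy
  have hmx := eval_of_natDegree_le_one hdeg (ex b x)
  have hmy := eval_of_natDegree_le_one hdeg (ex b y)
  simp only [wronskian] at hc ⊢
  -- With X = e^{bx}, Y = e^{by}, W = ᵗΦ(x)JΦ(y): as m has degree at most 1, the scalar terms add up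
  -- to -b m(X)W + (b/2)(m(X) + m(Y))W = -(b/2)μ₁(X - Y)W. The terms in A, B, C are differences of
  -- values at X and Y, divisible by X - Y.
  linear_combination m.eval (ex b x) * d1 - m.eval (ex b y) * d2
    - (Φ x 0 * Φ y 1 + Φ x 1 * Φ y 0) * pA - (Φ x 1 * Φ y 1) * pB - (Φ x 0 * Φ y 0) * pC
    + Φ y 1 * x0 - Φ y 0 * x1 - Φ x 1 * y0 + Φ x 0 * y1
    - b * m.eval (ex b x) * hc
    + (-(b * ex b y * kernel b Φ x y) - b / 2 * (Φ x 0 * Φ y 1 - Φ x 1 * Φ y 0)) * (hmx - hmy)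

variable (hD : fredholmDet (kernel b Φ) a₁ a₂ ≠ 0)

include hD

omit hD in
theorem continuous_integral_deriv (ha : a₁ ≤ a₂) {F : ℝ → ℂ} (hF : Continuous F) :
    Continuous fun x => ∫ y in Icc a₁ a₂, K₁ x y * F y := by
  simp only [setIntegral_Icc_eq ha]
  exact intervalIntegral.continuous_parametric_intervalIntegral_of_continuous'
    (continuous_uncurry_mul hK.continuous_deriv hF) _ _

omit hD in
theorem hasDerivAt_integral {F : ℝ → ℂ} (hF : Continuous F) (x : ℝ) :
    HasDerivAt (fun x => ∫ y in Icc a₁ a₂, kernel b Φ x y * F y)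
      (∫ y in Icc a₁ a₂, K₁ x y * F y) x := by
  obtain ⟨c, hc⟩ := ((isCompact_closedBall x 1).prod (isCompact_Icc (a := a₁) (b := a₂))
    ).exists_bound_of_continuousOn (continuous_uncurry_mul hK.continuous_deriv hF).continuousOn
  have hKF : ∀ x, Continuous fun y => kernel b Φ x y * F y := fun x =>
    (hK.toBddKernel.continuous_left x).mul hF
  have hK₁F : Continuous fun y => K₁ x y * F y :=
    (continuous_uncurry_mul hK.continuous_deriv hF).comp (f := fun y => (x, y)) (by fun_prop)
  refine (hasDerivAt_integral_of_dominated_loc_of_deriv_le (bound := fun _ => c)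
    (F' := fun x y => K₁ x y * F y)
    (Metric.ball_mem_nhds x one_pos) (Eventually.of_forall fun z => (hKF z).aestronglyMeasurable)
    (integrable_of_continuous (hKF x) _ _) hK₁F.aestronglyMeasurable ?_
    (integrable_const _) ?_).2
  · filter_upwards [ae_restrict_mem measurableSet_Icc] with y hy z hz
    exact hc (z, y) ⟨Metric.ball_subset_closedBall hz, hy⟩
  · exact Eventually.of_forall fun y z _ => (hK.hasDerivAt z y).mul_const _

/-- The derivative of `(𝕀 - 𝕂_I)⁻¹ Φᵢ`. -/
def derivResolve (b : ℂ) (Φ : ℝ → Fin 2 → ℂ) (K₁ : ℝ → ℝ → ℂ) (a₁ a₂ : ℝ) (i : Fin 2) (x : ℝ) : ℂ :=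
  deriv Φ x i + ∫ y in Icc a₁ a₂, K₁ x y * resolve (kernel b Φ) a₁ a₂ (twist b Φ i 0) y

theorem hasDerivAt_resolve (i : Fin 2) (x : ℝ) :
    HasDerivAt (resolve (kernel b Φ) a₁ a₂ (twist b Φ i 0))
      (derivResolve b Φ K₁ a₁ a₂ i x) x := by
  have h1 : HasDerivAt (twist b Φ i 0) (deriv Φ x i) x :=
    (hK.hasDerivAt_coord i x).congr_of_eventuallyEq
      (Eventually.of_forall fun x => by simp [twist])
  have h2 := hK.hasDerivAt_integral (a₁ := a₁) (a₂ := a₂)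
    (hK.toBddKernel.continuous_resolve hD (hK.continuous_twist i 0)) x
  exact (h1.add h2).congr_of_eventuallyEq
    (Eventually.of_forall fun x => hK.toBddKernel.resolve_fixed hD (hK.continuous_twist i 0) x)

theorem continuous_derivResolve (ha : a₁ ≤ a₂) (i : Fin 2) :
    Continuous (derivResolve b Φ K₁ a₁ a₂ i) :=
  (hK.continuous_deriv_coord i).add (hK.continuous_integral_deriv ha
    (hK.toBddKernel.continuous_resolve hD (hK.continuous_twist i 0)))

omit hK hD in
-- Separates the variables, so that integration in y turns the functions of y into pairings.
theorem finiteRank_mul_eq (b : ℂ) (Φ : ℝ → Fin 2 → ℂ) (A B C : ℂ[X]) (c : ℂ) (N : ℕ) (x y : ℝ)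
    (f : ℂ) :
    (-(c * wronskian Φ x y) +
        (polyDiff A N (ex b x) (ex b y) * (Φ x 0 * Φ y 1 + Φ x 1 * Φ y 0) +
          polyDiff B N (ex b x) (ex b y) * (Φ x 1 * Φ y 1) +
          polyDiff C N (ex b x) (ex b y) * (Φ x 0 * Φ y 0))) * f =
      (c * twist b Φ 1 0 x * (twist b Φ 0 0 y * f) -
        c * twist b Φ 0 0 x * (twist b Φ 1 0 y * f)) +
      ∑ l ∈ Finset.range N, ∑ l' ∈ Finset.range N,
        ((C.coeff (l + l' + 1) * twist b Φ 0 l x + A.coeff (l + l' + 1) * twist b Φ 1 l x) *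
          (twist b Φ 0 l' y * f) +
        (A.coeff (l + l' + 1) * twist b Φ 0 l x + B.coeff (l + l' + 1) * twist b Φ 1 l x) *
          (twist b Φ 1 l' y * f)) := by
  have h : ∀ l l', ((C.coeff (l + l' + 1) * twist b Φ 0 l x +
      A.coeff (l + l' + 1) * twist b Φ 1 l x) * (twist b Φ 0 l' y * f) +
      (A.coeff (l + l' + 1) * twist b Φ 0 l x + B.coeff (l + l' + 1) * twist b Φ 1 l x) *
        (twist b Φ 1 l' y * f)) =
      A.coeff (l + l' + 1) * ex b x ^ l * ex b y ^ l' * ((Φ x 0 * Φ y 1 + Φ x 1 * Φ y 0) * f) +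
      B.coeff (l + l' + 1) * ex b x ^ l * ex b y ^ l' * ((Φ x 1 * Φ y 1) * f) +
      C.coeff (l + l' + 1) * ex b x ^ l * ex b y ^ l' * ((Φ x 0 * Φ y 0) * f) := by
    intro l l'
    simp only [twist]
    ring
  simp only [h, Finset.sum_add_distrib, ← Finset.sum_mul]
  simp only [polyDiff, wronskian, twist, pow_zero]
  ring

/-- The integral of a finite rank kernel against `F = (𝕀 - 𝕂_I)⁻¹ Φᵢ`. -/
theorem integral_finiteRank (A B C : ℂ[X]) (c : ℂ) {N : ℕ} (hN : 0 < N) (i : Fin 2) (x : ℝ)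
    {W : Fin 2 → ℕ → ℂ} (hW : ∀ j l, W j l =
      ∫ y in Icc a₁ a₂, twist b Φ j l y * resolve (kernel b Φ) a₁ a₂ (twist b Φ i 0) y) :
    ∫ y in Icc a₁ a₂, (-(c * wronskian Φ x y) +
        (polyDiff A N (ex b x) (ex b y) * (Φ x 0 * Φ y 1 + Φ x 1 * Φ y 0) +
          polyDiff B N (ex b x) (ex b y) * (Φ x 1 * Φ y 1) +
          polyDiff C N (ex b x) (ex b y) * (Φ x 0 * Φ y 0))) *
        resolve (kernel b Φ) a₁ a₂ (twist b Φ i 0) y =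
      ∑ l ∈ Finset.range N, ((∑ l' ∈ Finset.range N,
          (A.coeff (l + l' + 1) * W 1 l' + C.coeff (l + l' + 1) * W 0 l'))
          - c * W 1 0 * delta l) * twist b Φ 0 l x +
      ∑ l ∈ Finset.range N, ((∑ l' ∈ Finset.range N,
          (A.coeff (l + l' + 1) * W 0 l' + B.coeff (l + l' + 1) * W 1 l'))
          + c * W 0 0 * delta l) * twist b Φ 1 l x := by
  have hint := fun j n => hK.integrable_twist_mul_resolve hD j i n 0
  simp only [finiteRank_mul_eq]
  have i2 : ∀ l l', Integrable (fun y => (C.coeff (l + l' + 1) * twist b Φ 0 l x +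
      A.coeff (l + l' + 1) * twist b Φ 1 l x) * (twist b Φ 0 l' y *
        resolve (kernel b Φ) a₁ a₂ (twist b Φ i 0) y) +
      (A.coeff (l + l' + 1) * twist b Φ 0 l x + B.coeff (l + l' + 1) * twist b Φ 1 l x) *
        (twist b Φ 1 l' y * resolve (kernel b Φ) a₁ a₂ (twist b Φ i 0) y)) (vol a₁ a₂) :=
    fun l l' => ((hint 0 l').const_mul _).add ((hint 1 l').const_mul _)
  rw [integral_add (integrable_fun_sub ((hint 0 0).const_mul _) ((hint 1 0).const_mul _))
    (integrable_finsetSum _ fun l _ => integrable_finsetSum _ fun l' _ => i2 l l'),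
    integral_sub ((hint 0 0).const_mul _) ((hint 1 0).const_mul _), integral_const_mul,
    integral_const_mul,
    integral_finsetSum _ fun l _ => integrable_finsetSum _ fun l' _ => i2 l l']
  have e1 : ∀ l, ∫ y in Icc a₁ a₂, ∑ l' ∈ Finset.range N,
      ((C.coeff (l + l' + 1) * twist b Φ 0 l x +
      A.coeff (l + l' + 1) * twist b Φ 1 l x) * (twist b Φ 0 l' y *
        resolve (kernel b Φ) a₁ a₂ (twist b Φ i 0) y) +
      (A.coeff (l + l' + 1) * twist b Φ 0 l x + B.coeff (l + l' + 1) * twist b Φ 1 l x) *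
        (twist b Φ 1 l' y * resolve (kernel b Φ) a₁ a₂ (twist b Φ i 0) y)) =
      (∑ l' ∈ Finset.range N, (A.coeff (l + l' + 1) * W 1 l' + C.coeff (l + l' + 1) * W 0 l')) *
        twist b Φ 0 l x +
      (∑ l' ∈ Finset.range N, (A.coeff (l + l' + 1) * W 0 l' + B.coeff (l + l' + 1) * W 1 l')) *
        twist b Φ 1 l x := by
    intro l
    rw [integral_finsetSum _ fun l' _ => i2 l l', Finset.sum_mul, Finset.sum_mul,
      ← Finset.sum_add_distrib]
    refine Finset.sum_congr rfl fun l' _ => ?_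
    rw [integral_add ((hint 0 l').const_mul _) ((hint 1 l').const_mul _), integral_const_mul,
      integral_const_mul, ← hW, ← hW]
    ring
  simp only [e1, ← hW]
  simp only [Finset.sum_add_distrib, sub_mul, add_mul, Finset.sum_sub_distrib]
  rw [sum_delta_mul hN, sum_delta_mul hN]
  simp only [Finset.sum_mul]
  ring

/-- The differential equation satisfied by `(𝕀 - 𝕂_I)⁻¹ Φᵢ` inside the interval. -/
theorem eval_mul_derivResolve (ha : a₁ < a₂) (hdeg : m.natDegree ≤ 1)
    (hinj : InjOn (ex b) (Icc a₁ a₂)) (hode : SolvesOn b m A B C Φ (Icc a₁ a₂))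
    {N : ℕ} (hA : A.natDegree < N) (hB : B.natDegree < N) (hC : C.natDegree < N) (i : Fin 2)
    {e₀ e₁ : ℕ → ℂ} (he : ∀ x ∈ Icc a₁ a₂, m.eval (ex b x) * deriv Φ x i =
      ∑ l ∈ Finset.range N, e₀ l * twist b Φ 0 l x + ∑ l ∈ Finset.range N, e₁ l * twist b Φ 1 l x)
    {W : Fin 2 → ℕ → ℂ} (hW : ∀ j l, W j l =
      ∫ y in Icc a₁ a₂, twist b Φ j l y * resolve (kernel b Φ) a₁ a₂ (twist b Φ i 0) y)
    {x : ℝ} (hx : x ∈ Icc a₁ a₂) :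
    m.eval (ex b x) * derivResolve b Φ K₁ a₁ a₂ i x =
      ∑ l ∈ Finset.range N, (e₀ l + (∑ l' ∈ Finset.range N,
          (A.coeff (l + l' + 1) * W 1 l' + C.coeff (l + l' + 1) * W 0 l'))
          - b / 2 * m.coeff 1 * W 1 0 * delta l) * resolve (kernel b Φ) a₁ a₂ (twist b Φ 0 l) x +
      ∑ l ∈ Finset.range N, (e₁ l + (∑ l' ∈ Finset.range N,
          (A.coeff (l + l' + 1) * W 0 l' + B.coeff (l + l' + 1) * W 1 l'))
          + b / 2 * m.coeff 1 * W 0 0 * delta l) * resolve (kernel b Φ) a₁ a₂ (twist b Φ 1 l) x -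
      m.eval (ex b a₂) * resolve (kernel b Φ) a₁ a₂ (twist b Φ i 0) a₂ *
        rker (kernel b Φ) a₁ a₂ x a₂ +
      m.eval (ex b a₁) * resolve (kernel b Φ) a₁ a₂ (twist b Φ i 0) a₁ *
        rker (kernel b Φ) a₁ a₂ x a₁ := by
  have hKb := hK.toBddKernel
  have hτ := hK.continuous_twist
  have hN : 0 < N := (Nat.zero_le _).trans_lt hA
  set F := resolve (kernel b Φ) a₁ a₂ (twist b Φ i 0) with hFdef
  set F' := derivResolve b Φ K₁ a₁ a₂ i with hF'def
  have hF : Continuous F := hKb.continuous_resolve hD (hτ i 0)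
  have hF' : Continuous F' := hK.continuous_derivResolve hD ha.le i
  have hFd : ∀ x, HasDerivAt F (F' x) x := hK.hasDerivAt_resolve hD i
  have hmc : Continuous fun x => m.eval (ex b x) := m.continuous.comp (continuous_ex b)
  have hex := continuous_ex b
  -- the inhomogeneous term
  set c₀ : ℕ → ℂ := fun l => e₀ l + (∑ l' ∈ Finset.range N,
    (A.coeff (l + l' + 1) * W 1 l' + C.coeff (l + l' + 1) * W 0 l'))
    - b / 2 * m.coeff 1 * W 1 0 * delta l with hc₀
  set c₁ : ℕ → ℂ := fun l => e₁ l + (∑ l' ∈ Finset.range N,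
    (A.coeff (l + l' + 1) * W 0 l' + B.coeff (l + l' + 1) * W 1 l'))
    + b / 2 * m.coeff 1 * W 0 0 * delta l with hc₁
  have hg₀ : Continuous fun x => ∑ l ∈ Finset.range N, c₀ l * twist b Φ 0 l x :=
    continuous_finsetSum _ fun l _ => continuous_const.mul (hτ 0 l)
  have hg₁ : Continuous fun x => ∑ l ∈ Finset.range N, c₁ l * twist b Φ 1 l x :=
    continuous_finsetSum _ fun l _ => continuous_const.mul (hτ 1 l)
  have hg₂ : Continuous fun x => -(m.eval (ex b a₂) * F a₂) * kernel b Φ x a₂ :=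
    continuous_const.mul (hKb.continuous_right a₂)
  have hg₃ : Continuous fun x => m.eval (ex b a₁) * F a₁ * kernel b Φ x a₁ :=
    continuous_const.mul (hKb.continuous_right a₁)
  -- mF' is mΦᵢ' plus the integral of m(x)∂ₓK against F. Up to the finite rank kernel, m(x)∂ₓK is
  -- -∂_y(m(y)K); integrating by parts moves the derivative to F and gives 𝕂(mF') together with
  -- boundary terms, negative at a₂ and positive at a₁.
  have hfix : ∀ x ∈ Icc a₁ a₂, m.eval (ex b x) * F' x =
      ((∑ l ∈ Finset.range N, c₀ l * twist b Φ 0 l x) +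
        ((∑ l ∈ Finset.range N, c₁ l * twist b Φ 1 l x) +
          (-(m.eval (ex b a₂) * F a₂) * kernel b Φ x a₂ +
            m.eval (ex b a₁) * F a₁ * kernel b Φ x a₁))) +
      ∫ y in Icc a₁ a₂, kernel b Φ x y * (m.eval (ex b y) * F' y) := by
    intro x hx
    have hK₁x : Continuous fun y => K₁ x y :=
      hK.continuous_deriv.comp (f := fun y => (x, y)) (by fun_prop)
    have hK₁x' : Continuous fun y => K₁ y x :=
      hK.continuous_deriv.comp (f := fun y => (y, x)) (by fun_prop)
    have hKx := hKb.continuous_left x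
    -- integration by parts
    set w : ℝ → ℂ := fun y => m.eval (ex b y) * kernel b Φ x y with hw
    set w' : ℝ → ℂ := fun y =>
      m.eval (ex b y) * K₁ y x + m.coeff 1 * (b * ex b y) * kernel b Φ x y with hw'
    have hwd : ∀ y, HasDerivAt w (w' y) y := by
      intro y
      have h1 : HasDerivAt (fun y => kernel b Φ x y) (K₁ y x) y :=
        (hK.hasDerivAt y x).congr_of_eventuallyEq
          (Eventually.of_forall fun z => kernel_symm b Φ x z)
      exact ((hasDerivAt_eval_ex hdeg b y).mul h1).congr_deriv (by rw [hw']; ring)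
    have hw'c : Continuous w' := by rw [hw']; fun_prop
    have hparts := intervalIntegral.integral_mul_deriv_eq_deriv_mul (a := a₁) (b := a₂)
      (fun y _ => hwd y) (fun y _ => hFd y) (hw'c.intervalIntegrable _ _)
      (hF'.intervalIntegrable _ _)
    rw [← setIntegral_Icc_eq ha.le, ← setIntegral_Icc_eq ha.le] at hparts
    -- the finite rank identity
    have hT := hK.integral_finiteRank hD A B C (b / 2 * m.coeff 1) hN i x hW
    have hae : ∀ᵐ y ∂(vol a₁ a₂), (-(b / 2 * m.coeff 1 * wronskian Φ x y) +
        (polyDiff A N (ex b x) (ex b y) * (Φ x 0 * Φ y 1 + Φ x 1 * Φ y 0) +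
          polyDiff B N (ex b x) (ex b y) * (Φ x 1 * Φ y 1) +
          polyDiff C N (ex b x) (ex b y) * (Φ x 0 * Φ y 0))) * F y =
        m.eval (ex b x) * (K₁ x y * F y) + w' y * F y := by
      -- `derivation_kernel` was obtained by dividing by e^{bx} - e^{by}; the excluded point y = x
      -- has measure zero.
      have hne : ∀ᵐ y ∂(vol a₁ a₂), y ≠ x := by
        refine ae_restrict_of_ae ?_
        exact compl_mem_ae_iff.2 (measure_singleton x)
      filter_upwards [hne, ae_restrict_mem measurableSet_Icc] with y hy1 hy2
      rw [← hK.derivation_kernel hdeg hode hA hB hC hx hy2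
        fun h => hy1 (hinj hy2 hx h.symm), hw']
      ring
    rw [integral_congr_ae hae, integral_add
      ((integrable_of_continuous (hK₁x.fun_mul hF) _ _).const_mul _)
      (integrable_of_continuous (hw'c.fun_mul hF) _ _), integral_const_mul] at hT
    have hF'x : F' x = deriv Φ x i + ∫ y in Icc a₁ a₂, K₁ x y * F y := rfl
    have hcomm : ∫ y in Icc a₁ a₂, kernel b Φ x y * (m.eval (ex b y) * F' y) =
        ∫ y in Icc a₁ a₂, w y * F' y := by
      congr 1
      funext y
      rw [hw]
      ring
    have hsplit₀ : ∑ l ∈ Finset.range N, c₀ l * twist b Φ 0 l x =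
        ∑ l ∈ Finset.range N, e₀ l * twist b Φ 0 l x +
        ∑ l ∈ Finset.range N, ((∑ l' ∈ Finset.range N,
          (A.coeff (l + l' + 1) * W 1 l' + C.coeff (l + l' + 1) * W 0 l'))
          - b / 2 * m.coeff 1 * W 1 0 * delta l) * twist b Φ 0 l x := by
      rw [← Finset.sum_add_distrib]
      refine Finset.sum_congr rfl fun l _ => ?_
      rw [hc₀]
      ring
    have hsplit₁ : ∑ l ∈ Finset.range N, c₁ l * twist b Φ 1 l x =
        ∑ l ∈ Finset.range N, e₁ l * twist b Φ 1 l x +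
        ∑ l ∈ Finset.range N, ((∑ l' ∈ Finset.range N,
          (A.coeff (l + l' + 1) * W 0 l' + B.coeff (l + l' + 1) * W 1 l'))
          + b / 2 * m.coeff 1 * W 0 0 * delta l) * twist b Φ 1 l x := by
      rw [← Finset.sum_add_distrib]
      refine Finset.sum_congr rfl fun l _ => ?_
      rw [hc₁]
      ring
    rw [hcomm, hparts, hsplit₀, hsplit₁, hF'x, mul_add, he x hx, hw]
    linear_combination hT
  have hmF' : Continuous fun x => m.eval (ex b x) * F' x := hmc.mul hF'
  have h1 := hKb.resolve_eq_of_fixed hD (hg₀.fun_add (hg₁.fun_add (hg₂.fun_add hg₃))) hmF' hfix x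
  rw [← hfix x hx, hKb.resolve_add hD hg₀ (hg₁.fun_add (hg₂.fun_add hg₃)),
    hKb.resolve_add hD hg₁ (hg₂.fun_add hg₃), hKb.resolve_add hD hg₂ hg₃,
    hKb.resolve_const_mul hD _ (hKb.continuous_right a₂),
    hKb.resolve_const_mul hD _ (hKb.continuous_right a₁), hKb.resolve_sum hD _ _ (hτ 0),
    hKb.resolve_sum hD _ _ (hτ 1), hKb.resolve_kernel hD, hKb.resolve_kernel hD] at h1
  rw [← h1]
  ring

end RegularKernel

end ExpTW

end

noncomputable section

namespace ExpTW

/-! ### The system for a regular kernel -/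

/-- The derivative of a continuous branch of a logarithm. -/
theorem hasDerivAt_of_exp_eq {g f : ℝ → ℂ} {f' : ℂ} {t₀ : ℝ} (hg : ContinuousAt g t₀)
    (h : ∀ᶠ t in 𝓝 t₀, Complex.exp (g t) = f t) (hf : HasDerivAt f f' t₀) :
    HasDerivAt g (f' / f t₀) t₀ := by
  have h0 : f t₀ ≠ 0 := h.self_of_nhds ▸ Complex.exp_ne_zero _
  have h1 : HasDerivAt (fun t => Complex.log (f t / f t₀)) (f' / f t₀) t₀ := by
    have := (hf.div_const (f t₀)).clog_real (by rw [div_self h0]; exact Complex.one_mem_slitPlane)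
    rwa [div_self h0, div_one] at this
  refine (h1.const_add (g t₀)).congr_of_eventuallyEq ?_
  -- Since 1 < π, the principal logarithm of f(t)/f(t₀) recovers g(t) - g(t₀) and not another
  -- branch.
  have hnear : ∀ᶠ t in 𝓝 t₀, ‖g t - g t₀‖ < 1 := by
    have : Tendsto (fun t => ‖g t - g t₀‖) (𝓝 t₀) (𝓝 0) := by
      simpa using (hg.tendsto.sub_const (g t₀)).norm
    exact this.eventually (gt_mem_nhds one_pos)
  filter_upwards [h, hnear] with t ht hn
  have him := (Complex.abs_im_le_norm (g t - g t₀)).trans_lt hn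
  rw [abs_lt] at him
  rw [← ht, ← h.self_of_nhds, ← Complex.exp_sub, Complex.log_exp (by linarith [Real.pi_gt_three])
    (by linarith [Real.pi_gt_three])]
  ring

theorem natDegree_lt_bdeg (A B C : ℂ[X]) : 1 < bdeg A B C + 1 ∧ A.natDegree < bdeg A B C + 1 ∧
    B.natDegree < bdeg A B C + 1 ∧ C.natDegree < bdeg A B C + 1 := by
  unfold bdeg
  omega

theorem pairing_eq (b : ℂ) (Φ : ℝ → Fin 2 → ℂ) (i i' : Fin 2) (l : ℕ) (a : Fin 2 → ℝ) :
    pairing b Φ i i' l a = ∫ x in Icc (a 0) (a 1),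
      twist b Φ i 0 x * resolve (kernel b Φ) (a 0) (a 1) (twist b Φ i' l) x := by
  simp [pairing, twist]

variable {b : ℂ} {Φ : ℝ → Fin 2 → ℂ} {K₁ : ℝ → ℝ → ℂ} {M : ℝ} {a : Fin 2 → ℝ} {m A B C : ℂ[X]}

theorem SolvesOn.expand {s : Set ℝ} (h : SolvesOn b m A B C Φ s) (hdeg : m.natDegree ≤ 1)
    {N : ℕ} (h1 : 1 < N) (hA : A.natDegree < N) (hB : B.natDegree < N) (hC : C.natDegree < N)
    {x : ℝ} (hx : x ∈ s) :
    m.eval (ex b x) * deriv Φ x 0 =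
      ∑ l ∈ Finset.range N, (A.coeff l + b / 2 * m.coeff l) * twist b Φ 0 l x +
        ∑ l ∈ Finset.range N, B.coeff l * twist b Φ 1 l x ∧
    m.eval (ex b x) * deriv Φ x 1 =
      ∑ l ∈ Finset.range N, -C.coeff l * twist b Φ 0 l x +
        ∑ l ∈ Finset.range N, (-A.coeff l + b / 2 * m.coeff l) * twist b Φ 1 l x := by
  rw [h.eq0 x hx, h.eq1 x hx, eval_eq_sum_range' hA, eval_eq_sum_range' hB, eval_eq_sum_range' hC,
    eval_eq_sum_range' (hdeg.trans_lt h1)]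
  constructor <;>
    simp only [twist, add_mul, sub_mul, neg_mul, Finset.sum_add_distrib, Finset.sum_neg_distrib,
      Finset.sum_mul, Finset.mul_sum, mul_assoc] <;>
    ring

namespace RegularKernel

variable (hK : RegularKernel b Φ M K₁) (hD : fredholmDet (kernel b Φ) (a 0) (a 1) ≠ 0)

include hK hD

/-- By symmetry of K the power e^{ℓbx} may stand outside the resolvent, the form in which the
pairings come out of the integral equations. -/
theorem pairing_symm (i i' : Fin 2) (l : ℕ) :
    pairing b Φ i i' l a = ∫ x in Icc (a 0) (a 1),
      twist b Φ i' l x * resolve (kernel b Φ) (a 0) (a 1) (twist b Φ i 0) x := by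
  rw [pairing_eq, hK.toBddKernel.integral_mul_resolve hD (kernel_symm b Φ)
    (hK.continuous_twist i 0) (hK.continuous_twist i' l)]

theorem hasPartial_pairing (ha : a 0 < a 1) (i i' : Fin 2) (l : ℕ) (k : Fin 2) :
    HasPartial (pairing b Φ i i' l) k
      (sgn k * resolve (kernel b Φ) (a 0) (a 1) (twist b Φ i' l) (a k) *
        resolve (kernel b Φ) (a 0) (a 1) (twist b Φ i 0) (a k)) a := by
  obtain ⟨G, hG⟩ := hK.exists_bound_twist i' l
  have h := hK.toBddKernel.hasPartial_pairing (kernel_symm b Φ) ha k hD (hK.continuous_twist i 0)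
    (hK.continuous_twist i' l) hG
  rw [HasPartial] at h ⊢
  simp only [pairing_eq]
  exact h.congr_deriv (by ring)

theorem hasPartial_resolve_of_ne (ha : a 0 < a 1) (i j k : Fin 2) (hjk : j ≠ k) :
    HasPartial (fun a => resolve (kernel b Φ) (a 0) (a 1) (twist b Φ i 0) (a j)) k
      (sgn k * rker (kernel b Φ) (a 0) (a 1) (a j) (a k) *
        resolve (kernel b Φ) (a 0) (a 1) (twist b Φ i 0) (a k)) a := by
  obtain ⟨G, hG⟩ := hK.exists_bound_twist i 0
  have h := hK.toBddKernel.hasPartial_resolve ha k hD (hK.continuous_twist i 0) hG (a j)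
  rw [HasPartial] at h ⊢
  simp only [Function.update_of_ne hjk]
  exact h.congr_deriv (by ring)

theorem hasPartial_resolve_self (ha : a 0 < a 1) (i j : Fin 2) :
    HasPartial (fun a => resolve (kernel b Φ) (a 0) (a 1) (twist b Φ i 0) (a j)) j
      (sgn j * (rker (kernel b Φ) (a 0) (a 1) (a j) (a j) *
        resolve (kernel b Φ) (a 0) (a 1) (twist b Φ i 0) (a j)) +
        derivResolve b Φ K₁ (a 0) (a 1) i (a j)) a := by
  obtain ⟨G, hG⟩ := hK.exists_bound_twist i 0
  have h := hK.toBddKernel.hasDerivAt_resolve_endpoint ha j hD (hK.continuous_twist i 0) hG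
    (hK.hasDerivAt_resolve hD i (a j))
  rw [HasPartial]
  simpa only [Function.update_self] using h

/-- The resolvent kernel on the diagonal. -/
theorem rker_diag (x : ℝ) : b * ex b x * rker (kernel b Φ) (a 0) (a 1) x x =
    derivResolve b Φ K₁ (a 0) (a 1) 0 x *
      resolve (kernel b Φ) (a 0) (a 1) (twist b Φ 1 0) x -
    derivResolve b Φ K₁ (a 0) (a 1) 1 x *
      resolve (kernel b Φ) (a 0) (a 1) (twist b Φ 0 0) x := by
  have h1 : HasDerivAt (fun z => (ex b z - ex b x) * rker (kernel b Φ) (a 0) (a 1) z x)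
      (b * ex b x * rker (kernel b Φ) (a 0) (a 1) x x) x := by
    have hc : ContinuousAt (fun z => rker (kernel b Φ) (a 0) (a 1) z x) x :=
      ((hK.toBddKernel.bddKernel_rker (a 0) (a 1)).continuous_right x).continuousAt
    -- Continuity of R suffices: e^{bz} - e^{bx} vanishes at z = x, so the slope of the product is
    -- the slope of e^{bz} times R(z, x).
    rw [hasDerivAt_iff_tendsto_slope]
    have hs := hasDerivAt_iff_tendsto_slope.1 (hasDerivAt_ex b x)
    refine (hs.mul (hc.tendsto.mono_left nhdsWithin_le_nhds)).congr fun z => ?_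
    simp only [slope, vsub_eq_sub, sub_self, zero_mul, sub_zero, smul_mul_assoc]
  have h2 := ((hK.hasDerivAt_resolve hD 0 x).mul_const
    (resolve (kernel b Φ) (a 0) (a 1) (twist b Φ 1 0) x)).sub
    ((hK.hasDerivAt_resolve hD 1 x).mul_const
      (resolve (kernel b Φ) (a 0) (a 1) (twist b Φ 0 0) x))
  exact h1.unique (h2.congr_of_eventuallyEq
    (Eventually.of_forall fun z => hK.sub_mul_rker hD z x))

/-- The differential equation in the moving endpoint. -/
theorem eval_mul_hasPartial (ha : a 0 < a 1) (hdeg : m.natDegree ≤ 1)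
    (hinj : InjOn (ex b) (Icc (a 0) (a 1)))
    (hode : SolvesOn b m A B C Φ (Icc (a 0) (a 1))) {N : ℕ} (hA : A.natDegree < N)
    (hB : B.natDegree < N) (hC : C.natDegree < N) (i : Fin 2) {e₀ e₁ : ℕ → ℂ}
    (he : ∀ x ∈ Icc (a 0) (a 1), m.eval (ex b x) * deriv Φ x i =
      ∑ l ∈ Finset.range N, e₀ l * twist b Φ 0 l x + ∑ l ∈ Finset.range N, e₁ l * twist b Φ 1 l x)
    (j k : Fin 2) (hjk : j ≠ k) :
    m.eval (ex b (a j)) * (sgn j * (rker (kernel b Φ) (a 0) (a 1) (a j) (a j) *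
        resolve (kernel b Φ) (a 0) (a 1) (twist b Φ i 0) (a j)) +
        derivResolve b Φ K₁ (a 0) (a 1) i (a j)) =
      ∑ l ∈ Finset.range N, (e₀ l + (∑ l' ∈ Finset.range N,
          (A.coeff (l + l' + 1) * pairing b Φ i 1 l' a + C.coeff (l + l' + 1) *
            pairing b Φ i 0 l' a))
          - b / 2 * m.coeff 1 * pairing b Φ i 1 0 a * delta l) *
            resolve (kernel b Φ) (a 0) (a 1) (twist b Φ 0 l) (a j) +
      ∑ l ∈ Finset.range N, (e₁ l + (∑ l' ∈ Finset.range N,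
          (A.coeff (l + l' + 1) * pairing b Φ i 0 l' a + B.coeff (l + l' + 1) *
            pairing b Φ i 1 l' a))
          + b / 2 * m.coeff 1 * pairing b Φ i 0 0 a * delta l) *
            resolve (kernel b Φ) (a 0) (a 1) (twist b Φ 1 l) (a j) -
      sgn k * m.eval (ex b (a k)) * rker (kernel b Φ) (a 0) (a 1) (a j) (a k) *
        resolve (kernel b Φ) (a 0) (a 1) (twist b Φ i 0) (a k) := by
  have hj : a j ∈ Icc (a 0) (a 1) := by
    fin_cases j
    · exact left_mem_Icc.2 ha.le
    · exact right_mem_Icc.2 ha.le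
  have h := hK.eval_mul_derivResolve hD ha hdeg hinj hode hA hB hC i he
    (W := fun j l => pairing b Φ i j l a) (fun j l => hK.pairing_symm hD i j l) hj
  -- The term with R_jj from moving the interval is opposite to the boundary term at a_j, so only
  -- the boundary term at a_k remains.
  rw [mul_add, h]
  fin_cases j <;> fin_cases k
  · exact absurd rfl hjk
  · simp only [sgn, Fin.zero_eta, Fin.mk_one]
    norm_num
    ring
  · simp only [sgn, Fin.zero_eta, Fin.mk_one]
    norm_num
    ring
  · exact absurd rfl hjk

theorem systemAt (ha : a 0 < a 1) (hdeg : m.natDegree ≤ 1)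
    (hinj : InjOn (ex b) (Icc (a 0) (a 1)))
    (hode : SolvesOn b m A B C Φ (Icc (a 0) (a 1))) {L : (Fin 2 → ℝ) → ℂ}
    (hL : IsLogBranchAt L (fun a' => fredholmDet (kernel b Φ) (a' 0) (a' 1)) a) :
    SystemAt b m A B C (actual b Φ L) a := by
  have hKb := hK.toBddKernel
  have hR : ∀ j k, (actual b Φ L).R j k a = rker (kernel b Φ) (a 0) (a 1) (a j) (a k) :=
    fun j k => hKb.resolve_kernel hD _ _
  have hpd : ∀ i j, pd (fun a => resolve (kernel b Φ) (a 0) (a 1) (twist b Φ i 0) (a j)) j a =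
      _ := fun i j => (hK.hasPartial_resolve_self hD ha i j).deriv
  have hq : ∀ l j, (actual b Φ L).q l j = fun a =>
    resolve (kernel b Φ) (a 0) (a 1) (twist b Φ 0 l) (a j) := fun _ _ => rfl
  have hp : ∀ l j, (actual b Φ L).p l j = fun a =>
    resolve (kernel b Φ) (a 0) (a 1) (twist b Φ 1 l) (a j) := fun _ _ => rfl
  have hb := ne_zero_of_injOn ha hinj
  obtain ⟨h1, hA, hB, hC⟩ := natDegree_lt_bdeg A B C
  have hex : ∀ j k, j ≠ k → ex b (a j) - ex b (a k) ≠ 0 := by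
    have h01 : ex b (a 0) ≠ ex b (a 1) := fun h =>
      ha.ne (hinj (left_mem_Icc.2 ha.le) (right_mem_Icc.2 ha.le) h)
    intro j k hjk
    fin_cases j <;> fin_cases k
    · exact absurd rfl hjk
    · exact sub_ne_zero.2 h01
    · exact sub_ne_zero.2 h01.symm
    · exact absurd rfl hjk
  refine ⟨?_, ?_, ?_, ?_, ?_, ?_, ?_, ?_, ?_, ?_, ?_, ?_, ?_, ?_, ?_⟩
  · intro k
    have hc : Tendsto (fun t => Function.update a k t) (𝓝 (a k)) (𝓝 a) := by
      have : Continuous fun t => Function.update a k t := by fun_prop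
      simpa using this.tendsto (a k)
    have h := hasDerivAt_of_exp_eq (g := fun t => L (Function.update a k t))
      (by
        have := hL.1.tendsto.comp hc
        rwa [ContinuousAt, Function.update_eq_self]) (hc.eventually hL.2)
      (hKb.hasPartial_fredholmDet ha k)
    refine h.congr_deriv ?_
    rw [hR, rker, Function.update_eq_self]
    ring
  · intro j k hjk
    rw [hR]
    exact hK.hasPartial_resolve_of_ne hD ha 0 j k hjk
  · intro j k hjk
    rw [hR]
    exact hK.hasPartial_resolve_of_ne hD ha 1 j k hjk
  · exact fun l k => hK.hasPartial_pairing hD ha 0 0 l k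
  · exact fun l k => hK.hasPartial_pairing hD ha 1 1 l k
  · exact fun l k => hK.hasPartial_pairing hD ha 0 1 l k
  · exact fun l k => hK.hasPartial_pairing hD ha 1 0 l k
  · intro j k hjk
    rw [hR, eq_div_iff (hex j k hjk), mul_comm]
    exact hK.sub_mul_rker hD _ _
  · intro j
    rw [hR, hq, hp, hpd, hpd, div_mul_eq_mul_div, eq_div_iff (mul_ne_zero hb (ex_ne_zero b _))]
    linear_combination hK.rker_diag hD (a j)
  · intro l j
    refine (hK.pow_mul_resolve hD 0 l (a j)).trans (Finset.sum_congr rfl fun n _ => ?_)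
    rw [← hK.pairing_symm hD, ← hK.pairing_symm hD]
    rfl
  · intro l j
    refine (hK.pow_mul_resolve hD 1 l (a j)).trans (Finset.sum_congr rfl fun n _ => ?_)
    rw [← hK.pairing_symm hD, ← hK.pairing_symm hD]
    rfl
  · exact fun j => (hK.hasPartial_resolve_self hD ha 0 j).differentiableAt
  · exact fun j => (hK.hasPartial_resolve_self hD ha 1 j).differentiableAt
  · intro j k hjk
    rw [hR, hq, hpd]
    exact hK.eval_mul_hasPartial hD ha hdeg hinj hode hA hB hC 0
      (fun x hx => (hode.expand hdeg h1 hA hB hC hx).1) j k hjk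
  · intro j k hjk
    -- The general formula produces ṽ₀ where the equation for p_j has v; they coincide by symmetry
    -- of K.
    have hv : pairing b Φ 0 1 0 a = pairing b Φ 1 0 0 a := by
      rw [hK.pairing_symm hD, pairing_eq]
    rw [hR, hp, hpd]
    have h := hK.eval_mul_hasPartial hD ha hdeg hinj hode hA hB hC 1
      (fun x hx => (hode.expand hdeg h1 hA hB hC hx).2) j k hjk
    rw [← hv] at h
    exact h

end RegularKernel

end ExpTW

end

noncomputable section

namespace ExpTW

/-! ### Locality of the system -/

theorem tendsto_update (a : Fin 2 → ℝ) (k : Fin 2) :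
    Tendsto (fun t => Function.update a k t) (𝓝 (a k)) (𝓝 a) := by
  have : Continuous fun t => Function.update a k t := by fun_prop
  simpa using this.tendsto (a k)

theorem HasPartial.congr_of_eventuallyEq {F G : (Fin 2 → ℝ) → ℂ} {k : Fin 2} {c : ℂ}
    {a : Fin 2 → ℝ} (h : HasPartial G k c a) (he : F =ᶠ[𝓝 a] G) : HasPartial F k c a :=
  HasDerivAt.congr_of_eventuallyEq h ((tendsto_update a k).eventually he)

theorem pd_congr {F G : (Fin 2 → ℝ) → ℂ} {a : Fin 2 → ℝ} (he : F =ᶠ[𝓝 a] G) (k : Fin 2) :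
    pd F k a = pd G k a :=
  Filter.EventuallyEq.deriv_eq ((tendsto_update a k).eventually he)

/-- The functions R_jk are never differentiated, so equality at a is enough for them; the others are
compared as germs. -/
theorem SystemAt.congr_of_eventuallyEq {b : ℂ} {m A B C : ℂ[X]} {F G : Unknowns} {a : Fin 2 → ℝ}
    (h : SystemAt b m A B C G a) (hL : F.L =ᶠ[𝓝 a] G.L) (hR : ∀ j k, F.R j k a = G.R j k a)
    (hq : ∀ l j, F.q l j =ᶠ[𝓝 a] G.q l j) (hp : ∀ l j, F.p l j =ᶠ[𝓝 a] G.p l j)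
    (hu : ∀ l, F.u l =ᶠ[𝓝 a] G.u l) (hw : ∀ l, F.w l =ᶠ[𝓝 a] G.w l)
    (hv : ∀ l, F.v l =ᶠ[𝓝 a] G.v l) (hvt : ∀ l, F.vt l =ᶠ[𝓝 a] G.vt l) :
    SystemAt b m A B C F a := by
  have hq' := fun l j => (hq l j).self_of_nhds
  have hp' := fun l j => (hp l j).self_of_nhds
  have hu' := fun l => (hu l).self_of_nhds
  have hw' := fun l => (hw l).self_of_nhds
  have hv' := fun l => (hv l).self_of_nhds
  have hvt' := fun l => (hvt l).self_of_nhds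
  have hpq := fun j => pd_congr (hq 0 j) j
  have hpp := fun j => pd_congr (hp 0 j) j
  refine ⟨?_, ?_, ?_, ?_, ?_, ?_, ?_, ?_, ?_, ?_, ?_, ?_, ?_, ?_, ?_⟩ <;>
    try simp only [hR, hq', hp', hu', hw', hv', hvt', hpq, hpp]
  · exact fun k => (h.logdet k).congr_of_eventuallyEq hL
  · exact fun j k hjk => (h.dq j k hjk).congr_of_eventuallyEq (hq 0 j)
  · exact fun j k hjk => (h.dp j k hjk).congr_of_eventuallyEq (hp 0 j)
  · exact fun l k => (h.du l k).congr_of_eventuallyEq (hu l)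
  · exact fun l k => (h.dw l k).congr_of_eventuallyEq (hw l)
  · exact fun l k => (h.dv l k).congr_of_eventuallyEq (hv l)
  · exact fun l k => (h.dvt l k).congr_of_eventuallyEq (hvt l)
  · exact h.Rjk
  · exact h.Rjj
  · exact h.qlj
  · exact h.plj
  · exact fun j => (h.diff_q j).congr_of_eventuallyEq ((tendsto_update a j).eventually (hq 0 j))
  · exact fun j => (h.diff_p j).congr_of_eventuallyEq ((tendsto_update a j).eventually (hp 0 j))
  · exact h.nu1
  · exact h.nu2

/-- The differential equation extends to the zeros of `m`. -/
theorem SolvesODE.solvesOn {b : ℂ} {m A B C : ℂ[X]} {S : Set ℝ} {Φ Φ' : ℝ → Fin 2 → ℂ}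
    (h : SolvesODE b m A B C S Φ) (hm : m ≠ 0) (hdeg : m.natDegree ≤ 1) {U : Set ℝ}
    (hU : IsOpen U) (hUS : U ⊆ S) (hinj : InjOn (ex b) U) (hΦ' : ContDiff ℝ 1 Φ')
    (hEq : EqOn Φ Φ' U) : SolvesOn b m A B C Φ' U := by
  have hd : ∀ x ∈ U, deriv Φ x = deriv Φ' x := fun x hx =>
    Filter.EventuallyEq.deriv_eq (hEq.eventuallyEq_of_mem (hU.mem_nhds hx))
  have key : ∀ x ∈ U, m.eval (ex b x) ≠ 0 →
      m.eval (ex b x) * deriv Φ' x 0 =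
        (b / 2 * m.eval (ex b x) + A.eval (ex b x)) * Φ' x 0 + B.eval (ex b x) * Φ' x 1 ∧
      m.eval (ex b x) * deriv Φ' x 1 =
        -C.eval (ex b x) * Φ' x 0 + (b / 2 * m.eval (ex b x) - A.eval (ex b x)) * Φ' x 1 := by
    intro x hx hmx
    have h1 := h.eq x (hUS hx) hmx
    rw [hd x hx, hEq hx] at h1
    have h2 := congrFun h1 0
    have h3 := congrFun h1 1
    simp only [Omega, Matrix.smul_apply, Matrix.mulVec, dotProduct, Fin.sum_univ_two,
      Pi.sub_apply, Pi.smul_apply, smul_eq_mul, Matrix.of_apply, Matrix.cons_val_zero,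
      Matrix.cons_val_one] at h2 h3
    field_simp at h2 h3
    constructor
    · linear_combination h2 / 2
    · linear_combination h3 / 2
  -- Two zeros of m(e^{bx}) in U would be two distinct zeros of a polynomial of degree at most 1,
  -- forcing m = 0. So zeros are isolated and the equation reaches them by continuity.
  have hne : ∀ x₀ ∈ U, ∀ᶠ x in 𝓝[≠] x₀, x ∈ U ∧ m.eval (ex b x) ≠ 0 ∨ m.eval (ex b x₀) ≠ 0 := by
    intro x₀ hx₀
    filter_upwards [self_mem_nhdsWithin, nhdsWithin_le_nhds (hU.mem_nhds hx₀)] with x hx hxU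
    by_contra! hcon
    obtain ⟨h1, h2⟩ := hcon
    have h1 := h1 hxU
    rw [eval_of_natDegree_le_one hdeg] at h1 h2
    have h3 : m.coeff 1 = 0 := by
      have : m.coeff 1 * (ex b x - ex b x₀) = 0 := by linear_combination h1 - h2
      exact (mul_eq_zero.1 this).resolve_right
        (sub_ne_zero.2 fun h => hx (hinj hxU hx₀ h))
    refine hm (ext fun n => ?_)
    rcases n with _ | _ | n
    · simpa [h3] using h1
    · simpa using h3
    · exact coeff_eq_zero_of_natDegree_lt (by omega)
  have hcΦ : ∀ i, Continuous fun x => Φ' x i := fun i =>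
    (continuous_apply i).comp hΦ'.continuous
  have hcd : ∀ i, Continuous fun x => deriv Φ' x i := fun i =>
    (continuous_apply i).comp (hΦ'.continuous_deriv le_rfl)
  have hcp : ∀ p : ℂ[X], Continuous fun x => p.eval (ex b x) := fun p =>
    p.continuous.comp (continuous_ex b)
  have extend : ∀ f g : ℝ → ℂ, Continuous f → Continuous g →
      (∀ x ∈ U, m.eval (ex b x) ≠ 0 → f x = g x) → ∀ x ∈ U, f x = g x := by
    intro f g hf hg hfg x₀ hx₀
    by_cases h0 : m.eval (ex b x₀) ≠ 0
    · exact hfg x₀ hx₀ h0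
    · refine tendsto_nhds_unique (f := f) (l := 𝓝[≠] x₀)
        (hf.continuousAt.tendsto.mono_left nhdsWithin_le_nhds)
        ((hg.continuousAt.tendsto.mono_left nhdsWithin_le_nhds).congr' ?_)
      filter_upwards [hne x₀ hx₀] with x hx
      have := hx.resolve_right h0
      exact (hfg x this.1 this.2).symm
  have := hcp m
  have := hcp A
  have := hcp B
  have := hcp C
  have := hcΦ 0
  have := hcΦ 1
  have := hcd 0
  have := hcd 1
  exact ⟨extend _ _ (by fun_prop) (by fun_prop) fun x hx h0 => (key x hx h0).1,
    extend _ _ (by fun_prop) (by fun_prop) fun x hx h0 => (key x hx h0).2⟩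

theorem exists_isLogBranchAt {D : (Fin 2 → ℝ) → ℂ} {a : Fin 2 → ℝ} (hD : ContinuousAt D a)
    (h0 : D a ≠ 0) : ∃ L, IsLogBranchAt L D a := by
  -- The quotient is near 1, away from the cut of the principal logarithm.
  refine ⟨fun a' => Complex.log (D a' / D a) + Complex.log (D a), ?_, ?_⟩
  · refine ContinuousAt.add (ContinuousAt.clog (hD.div_const _) ?_) continuousAt_const
    rw [div_self h0]
    exact Complex.one_mem_slitPlane
  · filter_upwards [hD.eventually_ne h0] with a' ha'
    rw [Complex.exp_add, Complex.exp_log (div_ne_zero ha' h0), Complex.exp_log h0,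
      div_mul_cancel₀ _ h0]

/-- Admissibility is an open condition, and the quantities attached to an admissible pair of
endpoints satisfy the system. -/
theorem Admissible.system {b : ℂ} {m A B C : ℂ[X]} (hm : m ≠ 0) (hdeg : m.natDegree ≤ 1)
    {S : Set ℝ} {Φ : ℝ → Fin 2 → ℂ} (hS : IsOpen S) (hΦ : SolvesODE b m A B C S Φ)
    {a : Fin 2 → ℝ} (ha : Admissible b Φ S a) :
    (∀ᶠ a' in 𝓝 a, Admissible b Φ S a') ∧ ContKernel (kernel b Φ) (a 0) (a 1) ∧
      IsUnit (1 - intOp (kernel b Φ) (a 0) (a 1)) ∧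
      (∃ L, IsLogBranchAt L (fun a' => fredholmDet (kernel b Φ) (a' 0) (a' 1)) a) ∧
      ∀ L, IsLogBranchAt L (fun a' => fredholmDet (kernel b Φ) (a' 0) (a' 1)) a →
        SystemAt b m A B C (actual b Φ L) a := by
  -- A single Φ' serves all endpoints near a, so determinant, resolvents and pairings have the same
  -- germs at a for Φ and for Φ'.
  obtain ⟨c, d, hc, hd, hUS, hinj, Φ', M, K₁, hreg, hEq⟩ :=
    exists_localization hS hΦ.contDiffOn ha.lt ha.subset ha.injOn
  have hKb := hreg.toBddKernel
  have hnear : ∀ᶠ a' in 𝓝 a, a' 0 < a' 1 ∧ c < a' 0 ∧ a' 1 < d := by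
    have c0 : Continuous fun a' : Fin 2 → ℝ => a' 0 := continuous_apply 0
    have c1 : Continuous fun a' : Fin 2 → ℝ => a' 1 := continuous_apply 1
    exact ((isOpen_lt c0 c1).eventually_mem ha.lt).and
      (((isOpen_lt continuous_const c0).eventually_mem hc).and
        ((isOpen_lt c1 continuous_const).eventually_mem hd))
  have hIcc : ∀ {a' : Fin 2 → ℝ}, c < a' 0 → a' 1 < d → Icc (a' 0) (a' 1) ⊆ Ioo c d :=
    fun h1 h2 x hx => ⟨h1.trans_le hx.1, hx.2.trans_lt h2⟩
  have hker : ∀ x ∈ Ioo c d, ∀ y ∈ Ioo c d, kernel b Φ x y = kernel b Φ' x y :=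
    fun x hx y hy => kernel_congr isOpen_Ioo hEq hx hy
  have hdet : ∀ᶠ a' in 𝓝 a, fredholmDet (kernel b Φ) (a' 0) (a' 1) =
      fredholmDet (kernel b Φ') (a' 0) (a' 1) := by
    filter_upwards [hnear] with a' h
    exact fredholmDet_congr fun x hx y hy =>
      hker x (hIcc h.2.1 h.2.2 hx) y (hIcc h.2.1 h.2.2 hy)
  have hker' : ∀ x ∈ Icc (a 0) (a 1), ∀ y ∈ Icc (a 0) (a 1), kernel b Φ x y = kernel b Φ' x y :=
    fun x hx y hy => hker x (hIcc hc hd hx) y (hIcc hc hd hy)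
  have hD : fredholmDet (kernel b Φ') (a 0) (a 1) ≠ 0 := hdet.self_of_nhds ▸ ha.det_ne_zero
  have htw : ∀ i l, EqOn (twist b Φ i l) (twist b Φ' i l) (Ioo c d) := fun i l x hx => by
    rw [twist, twist, hEq hx]
  have hres : ∀ᶠ a' in 𝓝 a, ∀ x ∈ Ioo c d, ∀ i l,
      resolve (kernel b Φ) (a' 0) (a' 1) (twist b Φ i l) x =
        resolve (kernel b Φ') (a' 0) (a' 1) (twist b Φ' i l) x := by
    filter_upwards [hnear] with a' h x hx i l
    exact resolve_congr (hIcc h.2.1 h.2.2) hker (htw i l) (hKb.contKernel _ _) hx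
  have hmem : ∀ᶠ a' in 𝓝 a, ∀ j, a' j ∈ Ioo c d := by
    filter_upwards [hnear] with a' h j
    fin_cases j
    · exact ⟨h.2.1, h.1.trans h.2.2⟩
    · exact ⟨h.2.1.trans h.1, h.2.2⟩
  have hval : ∀ i l j, (fun a' => resolve (kernel b Φ) (a' 0) (a' 1) (twist b Φ i l) (a' j))
      =ᶠ[𝓝 a] fun a' => resolve (kernel b Φ') (a' 0) (a' 1) (twist b Φ' i l) (a' j) := by
    intro i l j
    filter_upwards [hres, hmem] with a' h1 h2
    exact h1 _ (h2 j) i l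
  have hpair : ∀ i i' l, pairing b Φ i i' l =ᶠ[𝓝 a] pairing b Φ' i i' l := by
    intro i i' l
    filter_upwards [hres, hnear] with a' h1 h2
    refine setIntegral_congr_fun measurableSet_Icc fun x hx => ?_
    have hx' := hIcc h2.2.1 h2.2.2 hx
    simp only [h1 x hx' i' l, hEq hx']
  refine ⟨?_, contKernel_congr hker' (hKb.contKernel _ _), ?_, ?_, fun L hL => ?_⟩
  · filter_upwards [hnear, hdet, hKb.continuous_fredholmDet.continuousAt.eventually_ne hD]
      with a' h1 h2 h3
    have hI := hIcc h1.2.1 h1.2.2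
    exact ⟨h1.1, hI.trans hUS, hinj.mono hI, h2 ▸ h3⟩
  · rw [intOp_congr hker' (hKb.contKernel _ _)]
    exact hKb.isUnit_one_sub hD
  · obtain ⟨L, h1, h2⟩ := exists_isLogBranchAt hKb.continuous_fredholmDet.continuousAt hD
    exact ⟨L, h1, by filter_upwards [h2, hdet] with a' h2 h3 using h2.trans h3.symm⟩
  · have hI := hIcc hc hd
    have hode := hΦ.solvesOn hm hdeg isOpen_Ioo hUS hinj hreg.contDiff hEq
    have hL' : IsLogBranchAt L (fun a' => fredholmDet (kernel b Φ') (a' 0) (a' 1)) a :=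
      ⟨hL.1, by filter_upwards [hL.2, hdet] with a' h2 h3 using h2.trans h3⟩
    refine (hreg.systemAt hD ha.lt hdeg ha.injOn
      ⟨fun x hx => hode.eq0 x (hI hx), fun x hx => hode.eq1 x (hI hx)⟩ hL').congr_of_eventuallyEq
      (Eventually.of_forall fun _ => rfl) (fun j k => ?_) (hval 0) (hval 1) (hpair 0 0)
      (hpair 1 1) (hpair 0 1) (hpair 1 0)
    have hmem' := hmem.self_of_nhds
    exact resolve_congr hI hker (fun x hx => hker x hx _ (hmem' k)) (hKb.contKernel _ _) (hmem' j)

end ExpTW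

end

noncomputable section

namespace ExpTW

/-! ### Functions agreeing up to a multiple of a given function -/

/-- `X` and `Y` are bounded along `l` and differ by `O(N)`. -/
structure Near (l : Filter ℝ) (N : ℝ → ℝ) (X Y : ℝ → ℂ) : Prop where
  left : X =O[l] fun _ => (1 : ℝ)
  right : Y =O[l] fun _ => (1 : ℝ)
  sub : (fun t => X t - Y t) =O[l] N

namespace Near

variable {l : Filter ℝ} {N : ℝ → ℝ} {X Y X' Y' : ℝ → ℂ}

theorem refl (h : X =O[l] fun _ => (1 : ℝ)) : Near l N X X :=
  ⟨h, h, by simpa using Asymptotics.isBigO_zero N l⟩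

theorem const (c : ℂ) : Near l N (fun _ => c) (fun _ => c) :=
  refl (Asymptotics.isBigO_const_const c one_ne_zero l)

theorem of_continuousAt {t₀ : ℝ} (h : ContinuousAt X t₀) : Near (𝓝 t₀) N X X :=
  refl (h.tendsto.isBigO_one ℝ)

theorem add (h : Near l N X Y) (h' : Near l N X' Y') :
    Near l N (fun t => X t + X' t) (fun t => Y t + Y' t) :=
  ⟨h.left.add h'.left, h.right.add h'.right,
    (h.sub.add h'.sub).congr_left fun t => by ring⟩

/-- XX' - YY' = (X - Y)X' + Y(X' - Y'); this is why boundedness belongs to the definition of `Near`.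
-/
theorem mul (h : Near l N X Y) (h' : Near l N X' Y') :
    Near l N (fun t => X t * X' t) (fun t => Y t * Y' t) := by
  refine ⟨by simpa using h.left.mul h'.left, by simpa using h.right.mul h'.right, ?_⟩
  have h1 := h.sub.mul h'.left
  have h2 := h.right.mul h'.sub
  simp only [mul_one, one_mul] at h1 h2
  exact (h1.add h2).congr_left fun t => by ring

theorem neg (h : Near l N X Y) : Near l N (fun t => -X t) (fun t => -Y t) :=
  ⟨h.left.neg_left, h.right.neg_left, h.sub.neg_left.congr_left fun t => by ring⟩

theorem fun_sub (h : Near l N X Y) (h' : Near l N X' Y') :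
    Near l N (fun t => X t - X' t) (fun t => Y t - Y' t) := by
  simpa only [sub_eq_add_neg] using h.add h'.neg

theorem sum {s : Finset ℕ} {X Y : ℕ → ℝ → ℂ} (h : ∀ n ∈ s, Near l N (X n) (Y n)) :
    Near l N (fun t => ∑ n ∈ s, X n t) (fun t => ∑ n ∈ s, Y n t) := by
  induction s using Finset.cons_induction with
  | empty => simpa using const (l := l) (N := N) 0
  | cons a s ha ih =>
    simp only [Finset.sum_cons]
    exact (h a (Finset.mem_cons_self a s)).add
      (ih fun n hn => h n (Finset.mem_cons_of_mem hn))

theorem congr (h : Near l N X Y) (hX : X' =ᶠ[l] X) (hY : Y' =ᶠ[l] Y) : Near l N X' Y' := by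
  refine ⟨h.left.congr' hX.symm EventuallyEq.rfl, h.right.congr' hY.symm EventuallyEq.rfl,
    h.sub.congr' ?_ EventuallyEq.rfl⟩
  filter_upwards [hX, hY] with t h1 h2
  rw [h1, h2]

end Near

/-- A solution of a linear differential inequality which vanishes at a point vanishes nearby. -/
theorem eventually_eq_zero_of_isBigO {E : Type*} [NormedAddCommGroup E] [NormedSpace ℝ E]
    {e e' : ℝ → E} {t₀ : ℝ} (h : ∀ᶠ t in 𝓝 t₀, HasDerivAt e (e' t) t) (hO : e' =O[𝓝 t₀] e)
    (h0 : e t₀ = 0) : ∀ᶠ t in 𝓝 t₀, e t = 0 := by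
  obtain ⟨C, hC⟩ := hO.bound
  obtain ⟨δ, hδ, hball⟩ := Metric.eventually_nhds_iff.1 (h.and hC)
  have hpt : ∀ s, |s| < δ → HasDerivAt e (e' (t₀ + s)) (t₀ + s) ∧ ‖e' (t₀ + s)‖ ≤ C * ‖e (t₀ + s)‖ :=
    fun s hs => hball (by simpa [Real.dist_eq] using hs)
  -- The choices σ = ±1 let the one-sided Grönwall estimate cover both sides of t₀.
  have key : ∀ σ : ℝ, |σ| = 1 → ∀ r ∈ Icc (0 : ℝ) (δ / 2), e (t₀ + σ * r) = 0 := by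
    intro σ hσ
    have hs : ∀ r ∈ Icc (0 : ℝ) (δ / 2), |σ * r| < δ := by
      rintro r ⟨h1, h2⟩
      rw [abs_mul, hσ, one_mul, abs_of_nonneg h1]
      linarith
    have hd : ∀ r ∈ Icc (0 : ℝ) (δ / 2),
        HasDerivAt (fun r => e (t₀ + σ * r)) (σ • e' (t₀ + σ * r)) r := by
      intro r hr
      have h1 : HasDerivAt (fun r => t₀ + σ * r) σ r := by
        simpa using ((hasDerivAt_id r).const_mul σ).const_add t₀
      exact (hpt _ (hs r hr)).1.scomp r h1
    refine eq_zero_of_abs_deriv_le_mul_abs_self_of_eq_zero_right (K := C)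
      (f' := fun r => σ • e' (t₀ + σ * r))
      (fun r hr => (hd r hr).continuousAt.continuousWithinAt)
      (fun r hr => (hd r (Ico_subset_Icc_self hr)).hasDerivWithinAt) (by simpa using h0) ?_
    intro r hr
    rw [norm_smul, Real.norm_eq_abs, hσ, one_mul]
    exact (hpt _ (hs r (Ico_subset_Icc_self hr))).2
  filter_upwards [Metric.ball_mem_nhds t₀ (half_pos hδ)] with t ht
  rw [Metric.mem_ball, Real.dist_eq] at ht
  rcases le_total t₀ t with hle | hle
  · have := key 1 (by simp) (t - t₀) ⟨by linarith, by rw [abs_of_nonneg (by linarith)] at ht; linarith⟩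
    simpa using this
  · have := key (-1) (by simp) (t₀ - t) ⟨by linarith, by rw [abs_of_nonpos (by linarith)] at ht; linarith⟩
    simpa using this

/-! ### Uniqueness for the system -/

/-- The finitely many unknowns which determine all the others. -/
abbrev Index (d : ℕ) : Type := Unit ⊕ (Fin 2 ⊕ Fin 2) ⊕ (Fin d ⊕ Fin d) ⊕ (Fin d ⊕ Fin d)

/-- The basic unknowns as a vector. -/
def Unknowns.coord (F : Unknowns) (d : ℕ) (a : Fin 2 → ℝ) : Index d → ℂ :=
  Sum.elim (fun _ => F.L a) (Sum.elim (Sum.elim (fun j => F.q 0 j a) (fun j => F.p 0 j a))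
    (Sum.elim (Sum.elim (fun l => F.u l a) (fun l => F.w l a))
      (Sum.elim (fun l => F.v l a) (fun l => F.vt l a))))

theorem agreeAt_iff {d : ℕ} {F G : Unknowns} {a : Fin 2 → ℝ} :
    AgreeAt d F G a ↔ F.coord d a - G.coord d a = 0 := by
  rw [sub_eq_zero]
  constructor
  · intro h
    funext i
    rcases i with _ | ((j | j) | ((l | l) | (l | l)))
    exacts [h.L, h.q j, h.p j, h.u l l.2, h.w l l.2, h.v l l.2, h.vt l l.2]
  · intro h
    refine ⟨congrFun h (.inl ()), fun j => congrFun h (.inr (.inl (.inl j))),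
      fun j => congrFun h (.inr (.inl (.inr j))),
      fun l hl => congrFun h (.inr (.inr (.inl (.inl ⟨l, hl⟩)))),
      fun l hl => congrFun h (.inr (.inr (.inl (.inr ⟨l, hl⟩)))),
      fun l hl => congrFun h (.inr (.inr (.inr (.inl ⟨l, hl⟩)))),
      fun l hl => congrFun h (.inr (.inr (.inr (.inr ⟨l, hl⟩))))⟩

/-- The derivative of the basic unknowns with respect to `a_k`, according to the system. -/
def Unknowns.coordDeriv (F : Unknowns) (d : ℕ) (k : Fin 2) (a : Fin 2 → ℝ) : Index d → ℂ :=
  Sum.elim (fun _ => -(sgn k * F.R k k a)) (Sum.elim (Sum.elim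
      (fun j => if j = k then pd (F.q 0 j) j a else sgn k * F.R j k a * F.q 0 k a)
      (fun j => if j = k then pd (F.p 0 j) j a else sgn k * F.R j k a * F.p 0 k a))
    (Sum.elim (Sum.elim (fun l => sgn k * F.q l k a * F.q 0 k a)
        (fun l => sgn k * F.p l k a * F.p 0 k a))
      (Sum.elim (fun l => sgn k * F.p l k a * F.q 0 k a)
        (fun l => sgn k * F.q l k a * F.p 0 k a))))

variable {b : ℂ} {m A B C : ℂ[X]}

theorem SystemAt.hasDerivAt_coord {F : Unknowns} {a : Fin 2 → ℝ} {k : Fin 2} {t : ℝ}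
    (h : SystemAt b m A B C F (Function.update a k t)) (d : ℕ) :
    HasDerivAt (fun t => F.coord d (Function.update a k t))
      (F.coordDeriv d k (Function.update a k t)) t := by
  have key : ∀ {H : (Fin 2 → ℝ) → ℂ} {c : ℂ}, HasPartial H k c (Function.update a k t) →
      HasDerivAt (fun t => H (Function.update a k t)) c t := by
    intro H c hH
    simpa only [HasPartial, Function.update_idem, Function.update_self] using hH
  refine hasDerivAt_pi.2 fun i => ?_
  rcases i with _ | ((j | j) | ((l | l) | (l | l)))
  · exact key (h.logdet k)
  · change HasDerivAt (fun t => F.q 0 j (Function.update a k t))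
      (if j = k then _ else _) t
    split_ifs with hjk
    · subst hjk
      exact key (h.diff_q j).hasDerivAt
    · exact key (h.dq j k hjk)
  · change HasDerivAt (fun t => F.p 0 j (Function.update a k t))
      (if j = k then _ else _) t
    split_ifs with hjk
    · subst hjk
      exact key (h.diff_p j).hasDerivAt
    · exact key (h.dp j k hjk)
  · exact key (h.du l k)
  · exact key (h.dw l k)
  · exact key (h.dv l k)
  · exact key (h.dvt l k)

/-- Common shape of the right hand sides of `nu1` and `nu2`; it needs the pairings of index below d
and the moments q_n, p_n up to n = d. -/
theorem Near.rhs {l : Filter ℝ} {N : ℝ → ℝ} {d : ℕ} {A B C : ℂ[X]} (hA : A.natDegree ≤ d)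
    (hB : B.natDegree ≤ d) (hC : C.natDegree ≤ d) (e₀ e₁ : ℕ → ℂ) (κ : ℂ)
    {u v q p u' v' q' p' : ℕ → ℝ → ℂ} {z w z' w' r r' : ℝ → ℂ}
    (hu : ∀ n < d, Near l N (u n) (u' n)) (hv : ∀ n < d, Near l N (v n) (v' n))
    (hz : Near l N z z') (hw : Near l N w w') (hr : Near l N r r')
    (hq : ∀ n ≤ d, Near l N (q n) (q' n)) (hp : ∀ n ≤ d, Near l N (p n) (p' n)) :
    Near l N
      (fun t => (∑ n ∈ Finset.range (d + 1), (e₀ n + (∑ n' ∈ Finset.range (d + 1),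
          (A.coeff (n + n' + 1) * v n' t + C.coeff (n + n' + 1) * u n' t))
          - κ * z t * delta n) * q n t)
        + (∑ n ∈ Finset.range (d + 1), (e₁ n + (∑ n' ∈ Finset.range (d + 1),
          (A.coeff (n + n' + 1) * u n' t + B.coeff (n + n' + 1) * v n' t))
          + κ * w t * delta n) * p n t) - r t)
      (fun t => (∑ n ∈ Finset.range (d + 1), (e₀ n + (∑ n' ∈ Finset.range (d + 1),
          (A.coeff (n + n' + 1) * v' n' t + C.coeff (n + n' + 1) * u' n' t))
          - κ * z' t * delta n) * q' n t)
        + (∑ n ∈ Finset.range (d + 1), (e₁ n + (∑ n' ∈ Finset.range (d + 1),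
          (A.coeff (n + n' + 1) * u' n' t + B.coeff (n + n' + 1) * v' n' t))
          + κ * w' t * delta n) * p' n t) - r' t) := by
  have hcoef : ∀ {P : ℂ[X]} {f f' : ℕ → ℝ → ℂ}, P.natDegree ≤ d →
      (∀ n < d, Near l N (f n) (f' n)) → ∀ n n', n' ∈ Finset.range (d + 1) →
      Near l N (fun t => P.coeff (n + n' + 1) * f n' t)
        (fun t => P.coeff (n + n' + 1) * f' n' t) := by
    intro P f f' hP hf n n' hn'
    -- For n' = d the pairing is not a basic unknown, but its coefficient has index n + d + 1,
    -- beyond the degree.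
    rcases lt_or_ge n' d with h | h
    · exact (Near.const _).mul (hf n' h)
    · rw [coeff_eq_zero_of_natDegree_lt (p := P) (by omega)]
      simpa using Near.const 0
  have hle : ∀ {n}, n ∈ Finset.range (d + 1) → n ≤ d := fun hn => by
    rw [Finset.mem_range] at hn
    omega
  refine ((Near.sum fun n hn => ?_).add (Near.sum fun n hn => ?_)).fun_sub hr
  · exact ((((Near.const _).add (Near.sum fun n' hn' =>
      (hcoef hA hv n n' hn').add (hcoef hC hu n n' hn'))).fun_sub
      (((Near.const κ).mul hz).mul (Near.const _)))).mul (hq n (hle hn))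
  · exact ((((Near.const _).add (Near.sum fun n' hn' =>
      (hcoef hA hu n n' hn').add (hcoef hB hv n n' hn'))).add
      (((Near.const κ).mul hw).mul (Near.const _)))).mul (hp n (hle hn))

/-- The right hand sides of the system depend on the basic unknowns in a Lipschitz way. -/
theorem near_coordDeriv {F G : Unknowns} {a : Fin 2 → ℝ} {k : Fin 2}
    (hF : ∀ᶠ t in 𝓝 (a k), SystemAt b m A B C F (Function.update a k t))
    (hG : ∀ᶠ t in 𝓝 (a k), SystemAt b m A B C G (Function.update a k t))
    (hex : ex b (a 0) ≠ ex b (a 1)) (hm0 : ∀ j, m.eval (ex b (a j)) ≠ 0) :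
    ∀ i, Near (𝓝 (a k)) (fun t => ‖F.coord (bdeg A B C) (Function.update a k t) -
        G.coord (bdeg A B C) (Function.update a k t)‖)
      (fun t => F.coordDeriv (bdeg A B C) k (Function.update a k t) i)
      (fun t => G.coordDeriv (bdeg A B C) k (Function.update a k t) i) := by
  obtain ⟨h1, hA, hB, hC⟩ := natDegree_lt_bdeg A B C
  set d := bdeg A B C with hd
  set γ : ℝ → Fin 2 → ℝ := fun t => Function.update a k t with hγ
  set N : ℝ → ℝ := fun t => ‖F.coord d (γ t) - G.coord d (γ t)‖ with hN
  have hγ0 : γ (a k) = a := Function.update_eq_self _ _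
  have hγc : Continuous γ := by fun_prop
  -- the basic unknowns
  have hcoord : ∀ i : Index d, Near (𝓝 (a k)) N (fun t => F.coord d (γ t) i)
      (fun t => G.coord d (γ t) i) := by
    intro i
    have hb : ∀ {H : Unknowns}, (∀ᶠ t in 𝓝 (a k), SystemAt b m A B C H (γ t)) →
        (fun t => H.coord d (γ t) i) =O[𝓝 (a k)] fun _ => (1 : ℝ) := fun hH =>
      (hasDerivAt_pi.1 (hH.self_of_nhds.hasDerivAt_coord d) i).continuousAt.tendsto.isBigO_one ℝ
    refine ⟨hb hF, hb hG, Asymptotics.IsBigO.of_bound 1 (Eventually.of_forall fun t => ?_)⟩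
    rw [one_mul, hN, norm_norm]
    exact norm_le_pi_norm (F.coord d (γ t) - G.coord d (γ t)) i
  have hq0 : ∀ j, Near (𝓝 (a k)) N (fun t => F.q 0 j (γ t)) (fun t => G.q 0 j (γ t)) :=
    fun j => hcoord (.inr (.inl (.inl j)))
  have hp0 : ∀ j, Near (𝓝 (a k)) N (fun t => F.p 0 j (γ t)) (fun t => G.p 0 j (γ t)) :=
    fun j => hcoord (.inr (.inl (.inr j)))
  have hu : ∀ n < d, Near (𝓝 (a k)) N (fun t => F.u n (γ t)) (fun t => G.u n (γ t)) :=
    fun n hn => hcoord (.inr (.inr (.inl (.inl ⟨n, hn⟩))))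
  have hw : ∀ n < d, Near (𝓝 (a k)) N (fun t => F.w n (γ t)) (fun t => G.w n (γ t)) :=
    fun n hn => hcoord (.inr (.inr (.inl (.inr ⟨n, hn⟩))))
  have hv : ∀ n < d, Near (𝓝 (a k)) N (fun t => F.v n (γ t)) (fun t => G.v n (γ t)) :=
    fun n hn => hcoord (.inr (.inr (.inr (.inl ⟨n, hn⟩))))
  have hvt : ∀ n < d, Near (𝓝 (a k)) N (fun t => F.vt n (γ t)) (fun t => G.vt n (γ t)) :=
    fun n hn => hcoord (.inr (.inr (.inr (.inr ⟨n, hn⟩))))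
  -- the coefficients
  have hXc : ∀ j, Continuous fun t => ex b (γ t j) := fun j =>
    (continuous_ex b).comp ((continuous_apply j).comp hγc)
  have hX : ∀ j, Near (𝓝 (a k)) N (fun t => ex b (γ t j)) (fun t => ex b (γ t j)) :=
    fun j => Near.of_continuousAt (hXc j).continuousAt
  have hmc : ∀ j, Continuous fun t => m.eval (ex b (γ t j)) := fun j =>
    m.continuous.comp (hXc j)
  have hmev : ∀ j, ∀ᶠ t in 𝓝 (a k), m.eval (ex b (γ t j)) ≠ 0 := fun j =>
    (hmc j).continuousAt.eventually_ne (by rw [hγ0]; exact hm0 j)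
  have hminv : ∀ j, Near (𝓝 (a k)) N (fun t => (m.eval (ex b (γ t j)))⁻¹)
      (fun t => (m.eval (ex b (γ t j)))⁻¹) :=
    fun j => Near.of_continuousAt ((hmc j).continuousAt.inv₀ (by rw [hγ0]; exact hm0 j))
  -- the higher moments
  have hqp : ∀ n ≤ d, ∀ j, Near (𝓝 (a k)) N (fun t => F.q n j (γ t)) (fun t => G.q n j (γ t)) ∧
      Near (𝓝 (a k)) N (fun t => F.p n j (γ t)) (fun t => G.p n j (γ t)) := by
    intro n
    induction n using Nat.strong_induction_on with
    | _ n ih =>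
      intro hn j
      have hpow : Near (𝓝 (a k)) N (fun t => ex b (γ t j) ^ n) (fun t => ex b (γ t j) ^ n) :=
        Near.of_continuousAt ((hXc j).pow n).continuousAt
      -- For n ≤ d the recursion uses only pairings of index below d and moments of order below n,
      -- so the induction closes within the basic unknowns.
      have hlt : ∀ {n'}, n' ∈ Finset.range n → n' < d ∧ n - 1 - n' < n ∧ n - 1 - n' ≤ d := by
        intro n' hn'
        rw [Finset.mem_range] at hn'
        omega
      constructor
      · refine ((hpow.mul (hq0 j)).fun_sub (Near.sum fun n' hn' =>
          ((hv n' (hlt hn').1).mul (ih _ (hlt hn').2.1 (hlt hn').2.2 j).1).fun_sub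
          ((hu n' (hlt hn').1).mul (ih _ (hlt hn').2.1 (hlt hn').2.2 j).2))).congr ?_ ?_
        · filter_upwards [hF] with t ht
          linear_combination -ht.qlj n j
        · filter_upwards [hG] with t ht
          linear_combination -ht.qlj n j
      · refine ((hpow.mul (hp0 j)).fun_sub (Near.sum fun n' hn' =>
          ((hw n' (hlt hn').1).mul (ih _ (hlt hn').2.1 (hlt hn').2.2 j).1).fun_sub
          ((hvt n' (hlt hn').1).mul (ih _ (hlt hn').2.1 (hlt hn').2.2 j).2))).congr ?_ ?_
        · filter_upwards [hF] with t ht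
          linear_combination -ht.plj n j
        · filter_upwards [hG] with t ht
          linear_combination -ht.plj n j
  -- the resolvent kernel off the diagonal
  have hR : ∀ j k', j ≠ k' → Near (𝓝 (a k)) N (fun t => F.R j k' (γ t))
      (fun t => G.R j k' (γ t)) := by
    intro j k' hjk
    have hne : ex b (a j) - ex b (a k') ≠ 0 := by
      fin_cases j <;> fin_cases k'
      · exact absurd rfl hjk
      · exact sub_ne_zero.2 hex
      · exact sub_ne_zero.2 hex.symm
      · exact absurd rfl hjk
    have hinv : Near (𝓝 (a k)) N (fun t => (ex b (γ t j) - ex b (γ t k'))⁻¹)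
        (fun t => (ex b (γ t j) - ex b (γ t k'))⁻¹) :=
      Near.of_continuousAt (((hXc j).sub (hXc k')).continuousAt.inv₀ (by
        simpa only [Pi.sub_apply, hγ0] using hne))
    refine ((((hq0 j).mul (hp0 k')).fun_sub ((hp0 j).mul (hq0 k'))).mul hinv).congr ?_ ?_
    · filter_upwards [hF] with t ht
      rw [ht.Rjk j k' hjk, div_eq_mul_inv]
    · filter_upwards [hG] with t ht
      rw [ht.Rjk j k' hjk, div_eq_mul_inv]
  have hother : ∀ j : Fin 2, ∃ k', j ≠ k' := by decide
  have hd0 : 0 < d := by omega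
  have hmN : ∀ j, Near (𝓝 (a k)) N (fun t => m.eval (ex b (γ t j)))
      (fun t => m.eval (ex b (γ t j))) := fun j => Near.of_continuousAt (hmc j).continuousAt
  -- the derivatives in the moving endpoint
  have hpdq : ∀ j, Near (𝓝 (a k)) N (fun t => pd (F.q 0 j) j (γ t))
      (fun t => pd (G.q 0 j) j (γ t)) := by
    intro j
    obtain ⟨k', hjk⟩ := hother j
    have := Near.rhs (Nat.le_of_lt_succ hA) (Nat.le_of_lt_succ hB) (Nat.le_of_lt_succ hC)
      (fun n => A.coeff n + b / 2 * m.coeff n) (fun n => B.coeff n) (b / 2 * m.coeff 1) hu hv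
      (hv 0 hd0) (hu 0 hd0) ((((Near.const (sgn k')).mul (hmN k')).mul (hR j k' hjk)).mul (hq0 k'))
      (fun n hn => (hqp n hn j).1) (fun n hn => (hqp n hn j).2)
    refine ((hminv j).mul this).congr ?_ ?_
    · filter_upwards [hF, hmev j] with t ht hm
      rw [eq_inv_mul_iff_mul_eq₀ hm]
      exact ht.nu1 j k' hjk
    · filter_upwards [hG, hmev j] with t ht hm
      rw [eq_inv_mul_iff_mul_eq₀ hm]
      exact ht.nu1 j k' hjk
  have hpdp : ∀ j, Near (𝓝 (a k)) N (fun t => pd (F.p 0 j) j (γ t))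
      (fun t => pd (G.p 0 j) j (γ t)) := by
    intro j
    obtain ⟨k', hjk⟩ := hother j
    have := Near.rhs (Nat.le_of_lt_succ hA) (Nat.le_of_lt_succ hB) (Nat.le_of_lt_succ hC)
      (fun n => -C.coeff n) (fun n => -A.coeff n + b / 2 * m.coeff n) (b / 2 * m.coeff 1) hvt hw
      (hw 0 hd0) (hv 0 hd0) ((((Near.const (sgn k')).mul (hmN k')).mul (hR j k' hjk)).mul (hp0 k'))
      (fun n hn => (hqp n hn j).1) (fun n hn => (hqp n hn j).2)
    refine ((hminv j).mul this).congr ?_ ?_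
    · filter_upwards [hF, hmev j] with t ht hm
      rw [eq_inv_mul_iff_mul_eq₀ hm]
      exact ht.nu2 j k' hjk
    · filter_upwards [hG, hmev j] with t ht hm
      rw [eq_inv_mul_iff_mul_eq₀ hm]
      exact ht.nu2 j k' hjk
  have hRd : ∀ j, Near (𝓝 (a k)) N (fun t => F.R j j (γ t)) (fun t => G.R j j (γ t)) := by
    intro j
    have hinv : Near (𝓝 (a k)) N (fun t => b⁻¹ * (ex b (γ t j))⁻¹)
        (fun t => b⁻¹ * (ex b (γ t j))⁻¹) :=
      Near.of_continuousAt (continuousAt_const.mul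
        ((hXc j).continuousAt.inv₀ (ex_ne_zero b _)))
    refine (hinv.mul (((hp0 j).mul (hpdq j)).fun_sub ((hq0 j).mul (hpdp j)))).congr ?_ ?_
    · filter_upwards [hF] with t ht
      rw [ht.Rjj j, one_div, mul_inv]
    · filter_upwards [hG] with t ht
      rw [ht.Rjj j, one_div, mul_inv]
  have hs := Near.const (l := 𝓝 (a k)) (N := N) (sgn k)
  rintro (_ | ((j | j) | ((l | l) | (l | l))))
  · exact (hs.mul (hRd k)).neg
  · by_cases hjk : j = k
    · simpa only [Unknowns.coordDeriv, Sum.elim_inr, Sum.elim_inl, if_pos hjk] using hpdq j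
    · simpa only [Unknowns.coordDeriv, Sum.elim_inr, Sum.elim_inl, if_neg hjk] using
        (hs.mul (hR j k hjk)).mul (hq0 k)
  · by_cases hjk : j = k
    · simpa only [Unknowns.coordDeriv, Sum.elim_inr, Sum.elim_inl, if_pos hjk] using hpdp j
    · simpa only [Unknowns.coordDeriv, Sum.elim_inr, Sum.elim_inl, if_neg hjk] using
        (hs.mul (hR j k hjk)).mul (hp0 k)
  · exact (hs.mul (hqp l l.2.le k).1).mul (hq0 k)
  · exact (hs.mul (hqp l l.2.le k).2).mul (hp0 k)
  · exact (hs.mul (hqp l l.2.le k).2).mul (hq0 k)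
  · exact (hs.mul (hqp l l.2.le k).1).mul (hp0 k)

/-- Along the line the difference e of the two vectors of basic unknowns satisfies e' = O(e) by
`near_coordDeriv`, so it stays zero near a zero. -/
theorem eventually_agreeAt {F G : Unknowns} {a : Fin 2 → ℝ} {k : Fin 2}
    (hF : ∀ᶠ t in 𝓝 (a k), SystemAt b m A B C F (Function.update a k t))
    (hG : ∀ᶠ t in 𝓝 (a k), SystemAt b m A B C G (Function.update a k t))
    (hex : ex b (a 0) ≠ ex b (a 1)) (hm0 : ∀ j, m.eval (ex b (a j)) ≠ 0)
    (h : AgreeAt (bdeg A B C) F G a) :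
    ∀ᶠ t in 𝓝 (a k), AgreeAt (bdeg A B C) F G (Function.update a k t) := by
  simp only [agreeAt_iff]
  refine eventually_eq_zero_of_isBigO
    (e' := fun t => F.coordDeriv (bdeg A B C) k (Function.update a k t) -
      G.coordDeriv (bdeg A B C) k (Function.update a k t)) ?_ ?_ ?_
  · filter_upwards [hF, hG] with t h1 h2
    exact (h1.hasDerivAt_coord _).sub (h2.hasDerivAt_coord _)
  · exact Asymptotics.isBigO_pi.2 fun i =>
      Asymptotics.isBigO_norm_right.1 (near_coordDeriv hF hG hex hm0 i).sub
  · rw [Function.update_eq_self]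
    exact agreeAt_iff.1 h

/-! ### From local to global agreement -/

variable {D : Set (Fin 2 → ℝ)} {F G : Unknowns}

/-- Uniqueness along a line parallel to a coordinate axis. -/
theorem agreeAt_of_line (hD : IsOpen D)
    (hne : ∀ a ∈ D, ex b (a 0) ≠ ex b (a 1) ∧ ∀ j, m.eval (ex b (a j)) ≠ 0)
    (hF : ∀ a ∈ D, SystemAt b m A B C F a) (hG : ∀ a ∈ D, SystemAt b m A B C G a)
    {a : Fin 2 → ℝ} {k : Fin 2} {s : Set ℝ} (hs : IsPreconnected s)
    (hsD : ∀ t ∈ s, Function.update a k t ∈ D) {t₀ t₁ : ℝ} (h₀ : t₀ ∈ s) (h₁ : t₁ ∈ s)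
    (h : AgreeAt (bdeg A B C) F G (Function.update a k t₀)) :
    AgreeAt (bdeg A B C) F G (Function.update a k t₁) := by
  set γ : ℝ → Fin 2 → ℝ := fun t => Function.update a k t with hγ
  have hγc : Continuous γ := by fun_prop
  have hopen : IsOpen (γ ⁻¹' D) := hD.preimage hγc
  have hext : ∀ t ∈ γ ⁻¹' D, AgreeAt (bdeg A B C) F G (γ t) →
      ∀ᶠ t' in 𝓝 t, AgreeAt (bdeg A B C) F G (γ t') := by
    intro t ht hag
    have hcurve : ∀ t', Function.update (γ t) k t' = γ t' := fun t' => Function.update_idem _ _ _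
    have hk : γ t k = t := Function.update_self _ _ _
    have hnear : ∀ᶠ t' in 𝓝 t, γ t' ∈ D := hopen.mem_nhds ht
    have := eventually_agreeAt (F := F) (G := G) (k := k) (a := γ t) (b := b) (m := m)
      (by simpa only [hcurve, hk] using hnear.mono fun t' => hF (γ t'))
      (by simpa only [hcurve, hk] using hnear.mono fun t' => hG (γ t'))
      (hne _ ht).1 (hne _ ht).2 hag
    simpa only [hcurve, hk] using this
  have hcont : ContinuousOn (fun t => F.coord (bdeg A B C) (γ t) - G.coord (bdeg A B C) (γ t))
      (γ ⁻¹' D) := fun t ht =>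
    (((hF _ ht).hasDerivAt_coord _).sub ((hG _ ht).hasDerivAt_coord _)).continuousAt.continuousWithinAt
  -- Agreement is open by local uniqueness and disagreement is open by continuity; a preconnected
  -- set cannot meet both.
  have hopen' : IsOpen {t | t ∈ γ ⁻¹' D ∧ AgreeAt (bdeg A B C) F G (γ t)} :=
    isOpen_iff_mem_nhds.2 fun t ht => (hopen.eventually_mem ht.1).and (hext t ht.1 ht.2)
  have hopen'' : IsOpen {t | t ∈ γ ⁻¹' D ∧ ¬ AgreeAt (bdeg A B C) F G (γ t)} := by
    simp only [agreeAt_iff]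
    exact hcont.isOpen_inter_preimage hopen isOpen_compl_singleton
  by_contra hcon
  obtain ⟨t, -, h1, h2⟩ := hs _ _ hopen' hopen''
    (fun t ht => by by_cases h : AgreeAt (bdeg A B C) F G (γ t)
                    · exact Or.inl ⟨hsD t ht, h⟩
                    · exact Or.inr ⟨hsD t ht, h⟩)
    ⟨t₀, h₀, hsD _ h₀, h⟩ ⟨t₁, h₁, hsD _ h₁, hcon⟩
  exact h2.2 h1.2

/-- Two solutions of the system on a connected open set which agree at one point are equal. -/
theorem agreeAt_of_agreeAt (hD : IsOpen D) (hconn : IsPreconnected D)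
    (hne : ∀ a ∈ D, ex b (a 0) ≠ ex b (a 1) ∧ ∀ j, m.eval (ex b (a j)) ≠ 0)
    (hF : ∀ a ∈ D, SystemAt b m A B C F a) (hG : ∀ a ∈ D, SystemAt b m A B C G a)
    {a₀ a₁ : Fin 2 → ℝ} (h₀ : a₀ ∈ D) (h₁ : a₁ ∈ D) (h : AgreeAt (bdeg A B C) F G a₀) :
    AgreeAt (bdeg A B C) F G a₁ := by
  -- A ball of the supremum norm is a product of intervals, so two moves parallel to the axes join
  -- any two of its points without leaving it.
  have key : ∀ c ∈ D, ∃ r > 0, Metric.ball c r ⊆ D ∧ ∀ x ∈ Metric.ball c r,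
      ∀ y ∈ Metric.ball c r, AgreeAt (bdeg A B C) F G x → AgreeAt (bdeg A B C) F G y := by
    intro c hc
    obtain ⟨r, hr, hball⟩ := Metric.isOpen_iff.1 hD c hc
    refine ⟨r, hr, hball, fun x hx y hy hxy => ?_⟩
    have hmem : ∀ z : Fin 2 → ℝ, z ∈ Metric.ball c r ↔ ∀ j, z j ∈ Metric.ball (c j) r :=
      fun z => by simp only [Metric.mem_ball, dist_pi_lt_iff hr]
    have step : ∀ z ∈ Metric.ball c r, ∀ k, ∀ t ∈ Metric.ball (c k) r,
        AgreeAt (bdeg A B C) F G z → AgreeAt (bdeg A B C) F G (Function.update z k t) := by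
      intro z hz k t ht hag
      refine agreeAt_of_line hD hne hF hG (convex_ball (c k) r).isPreconnected
        (fun s hs => hball ((hmem _).2 fun j => ?_)) ((hmem z).1 hz k) ht
        (by rwa [Function.update_eq_self])
      by_cases hjk : j = k
      · subst hjk
        simpa using hs
      · simpa [hjk] using (hmem z).1 hz j
    have h1 := step x hx 0 (y 0) ((hmem y).1 hy 0) hxy
    have hx' : Function.update x 0 (y 0) ∈ Metric.ball c r := (hmem _).2 fun j => by
      fin_cases j
      · simpa using (hmem y).1 hy 0
      · simpa using (hmem x).1 hx 1
    have h2 := step _ hx' 1 (y 1) ((hmem y).1 hy 1) h1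
    convert h2 using 1
    funext j
    fin_cases j <;> simp
  -- Agreement is constant on small balls, so it and its negation are both open; P is taken to be
  -- `id` and `Not`.
  have hopen : ∀ P : Prop → Prop, IsOpen {a | a ∈ D ∧ P (AgreeAt (bdeg A B C) F G a)} := by
    intro P
    refine isOpen_iff_mem_nhds.2 fun c hc => ?_
    obtain ⟨r, hr, hball, hag⟩ := key c hc.1
    filter_upwards [Metric.ball_mem_nhds c hr] with y hy
    have hiff : AgreeAt (bdeg A B C) F G y ↔ AgreeAt (bdeg A B C) F G c :=
      ⟨hag y hy c (Metric.mem_ball_self hr), hag c (Metric.mem_ball_self hr) y hy⟩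
    exact ⟨hball hy, (propext hiff).symm ▸ hc.2⟩
  by_contra hcon
  obtain ⟨x, -, h1, h2⟩ := hconn _ _ (hopen id) (hopen Not)
    (fun x hx => by by_cases h : AgreeAt (bdeg A B C) F G x
                    · exact Or.inl ⟨hx, h⟩
                    · exact Or.inr ⟨hx, h⟩)
    ⟨a₀, h₀, h₀, h⟩ ⟨a₁, h₁, h₁, hcon⟩
  exact h2.2 h1.2

end ExpTW

end
-- The theorem: the system and its closedness
theorem mainTheorem1 (b : ℂ) (m A B C : Polynomial ℂ) (hm : m ≠ 0) (hdeg : m.natDegree ≤ 1) :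
    -- the quantities attached to a kernel satisfy the system
    (∀ (S : Set ℝ) (Φ : ℝ → Fin 2 → ℂ), IsOpen S → ExpTW.SolvesODE b m A B C S Φ →
      IsOpen {a : Fin 2 → ℝ | ExpTW.Admissible b Φ S a} ∧
      ∀ a : Fin 2 → ℝ, ExpTW.Admissible b Φ S a →
        ExpTW.ContKernel (ExpTW.kernel b Φ) (a 0) (a 1) ∧
        IsUnit (1 - ExpTW.intOp (ExpTW.kernel b Φ) (a 0) (a 1)) ∧
        (∃ L : (Fin 2 → ℝ) → ℂ, ExpTW.IsLogBranchAt L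
          (fun a' => ExpTW.fredholmDet (ExpTW.kernel b Φ) (a' 0) (a' 1)) a) ∧
        ∀ L : (Fin 2 → ℝ) → ℂ, ExpTW.IsLogBranchAt L
          (fun a' => ExpTW.fredholmDet (ExpTW.kernel b Φ) (a' 0) (a' 1)) a →
          ExpTW.SystemAt b m A B C (ExpTW.actual b Φ L) a) ∧
    -- the system is closed: finitely many initial values determine its solution
    (∀ D : Set (Fin 2 → ℝ), IsOpen D → IsPreconnected D →
      (∀ a ∈ D, ExpTW.ex b (a 0) ≠ ExpTW.ex b (a 1) ∧ ∀ j, m.eval (ExpTW.ex b (a j)) ≠ 0) →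
      ∀ F G : ExpTW.Unknowns,
        (∀ a ∈ D, ExpTW.SystemAt b m A B C F a) → (∀ a ∈ D, ExpTW.SystemAt b m A B C G a) →
        ∀ a₀ ∈ D, ExpTW.AgreeAt (ExpTW.bdeg A B C) F G a₀ →
          ∀ a ∈ D, ExpTW.AgreeAt (ExpTW.bdeg A B C) F G a) := by
  refine ⟨fun S Φ hS hΦ => ⟨isOpen_iff_mem_nhds.2 fun a ha => (ha.system hm hdeg hS hΦ).1,
    fun a ha => (ha.system hm hdeg hS hΦ).2⟩, fun D hD hconn hne F G hF hG a₀ h₀ h a₁ h₁ =>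
    ExpTW.agreeAt_of_agreeAt hD hconn hne hF hG h₀ h₁ h⟩
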